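/- For $j\ge 1$ let $\phi_j(x)=\sqrt{2/\pi}\,\sin jx$ on $[0,\pi]$, and for $f$ on $[0,\pi]$ let $f_j=\int_0^\pi f\phi_j\,dx$. For real $r$ put $|f|_r^2=\sum_{j\ge1} j^{2r}f_j^2$, and let $H^r_*$ be the space of $f=\sum_j f_j\phi_j$ with $|f|_r<\infty$ (for $r<0$, of the formal series). For $m\ge -1/2$ let $\omega_j^2=j^4+mj^2$ and $$|f|_{\tilde H^{-1}}^2=\sum_{j\ge1}\frac{j^2}{\omega_j^2}f_j^2,\qquad |f|_{H^r_N}^2=\sum_{j\le N}j^2f_j^2+\sum_{j>N}j^{2r}f_j^2,\qquad \mu=\min\Big\{2\sqrt{1+m},\tfrac32\sqrt{4+m}\Big\}.$$ For $\varepsilon\ge 0$ set $$T_0=T_0(\varepsilon)=0.948\,\frac{1-c_\dagger c_*\varepsilon^2/\mu}{c_\dagger c_*^2},\qquad c_*=\Big(\frac{11}{10}\Big)^2\Big(\frac56-\frac1{80e}\Big)^{-2},\qquad c_\dagger=\frac{44e}{\pi}.$$ Consider the hinged-hinged beam equation $$u_{tt}+u_{xxxx}-\Big(m+\frac1{2\pi}\int_0^\pi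 u_x^2\,dx\Big)u_{xx}=0,\qquad u=u_{xx}=0\ \text{ at } x=0,\pi,\qquad u(0,\cdot)=u_0,\quad u_t(0,\cdot)=v_0 .$$ Given $s>1/2$, $u_0\in H^{s+2}_*$, $v_0\in H^s_*$ and an open interval $I\ni 0$, a weak solution on $I$ is a curve $u\in C(I;H^{s+2}_*)\cap C^1(I;H^s_*)\cap C^2(I;H^{s-2}_*)$ with these initial data such that for all $t\in I$ and all $\eta\in C^\infty_c((0,\pi))$ $$\langle u_{tt},\eta\rangle+\int_0^\pi u_{xx}\eta_{xx}\,dx+\Big(m+\frac1{2\pi}\int_0^\pi u_x^2\,dx\Big)\int_0^\pi u_x\eta_x\,dx=0 ,\qquad \langle u_{tt},\eta\rangle=\frac{d^2}{dt^2}\int_0^\pi u\,\eta\,dx .$$ Theorem. Let $m\ge-1/2$, $s>1/2$, $u_0\in H^{s+2}_*$, $v_0\in H^s_*$. On every open interval containing $0$ there is at most one weak solution. Moreover: (a) Let $\varepsilon=\max\{|u_0|_1,\ |v_0|_0/\sqrt{1+m}\}\le 0.08\sqrt\mu$. Then a weak solution exists on an open interval containing all $t$ with $|t|\,\varepsilon^4\le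 T_0\mu$, and every weak solution satisfies $$\sup_{x\in[0,\pi]}|u(t,x)|\le 2\varepsilon$$ for all $t$ in its interval with $|t|\le T_0\mu\varepsilon^{-4}$ (all $t$ if $\varepsilon=0$), where $T_0\ge 0.008\,(1-68\varepsilon^2/\mu)\ge 0.0045$. (b) Let $\varepsilon=\max\{|u_0|_1,\ |v_0|_{\tilde H^{-1}}\}\le 0.08\sqrt\mu$. Then a weak solution exists on an open interval containing all $t$ with $|t|\,\varepsilon^4\le T_0\mu$, and there is $N\ge1$ (depending on the data) such that every weak solution satisfies $$u(t,\cdot)\in H^{s+2}_*,\qquad |u(t,\cdot)|_{H^{s+2}_N}\le 1.9\,\varepsilon,\qquad \sup_{x\in[0,\pi]}|u(t,x)|\le2\varepsilon$$ for all $t$ in its interval with $|t|\le T_0\mu\varepsilon^{-4}$ (all $t$ if $\varepsilon=0$). -/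

import Mathlib

open Real Set Filter Topology

noncomputable section

/-- The eigenfunctions `φ_j(x) = √(2/π) sin (j x)`, `j ≥ 1`, orthonormal in `L²(0,π)`. -/
def phi (j : ℕ+) (x : ℝ) : ℝ := √(2 / π) * Real.sin ((j : ℝ) * x)

/-- The sine coefficients `f_j = ∫_0^π f φ_j`, `j ≥ 1`, of `f`. -/
def sineCoeff (f : ℝ → ℝ) (j : ℕ+) : ℝ := ∫ x in (0 : ℝ)..π, f x * phi j x

/-- `f ∈ H^r_*` for `r > 1/2` (only the values on `[0,π]` matter): `f = ∑ f_j φ_j` on `[0,π]`,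
and `∑ j^{2r} f_j²` converges. For such `r` the sine series converges absolutely and uniformly,
and `f` is the continuous representative. -/
def MemHstar (r : ℝ) (f : ℝ → ℝ) : Prop :=
  Summable (fun j : ℕ+ => (j : ℝ) ^ (2 * r) * sineCoeff f j ^ 2) ∧
    ∀ x ∈ Icc (0 : ℝ) π, HasSum (fun j : ℕ+ => sineCoeff f j * phi j x) (f x)

/-- The norm `|f|_r = (∑ j^{2r} f_j²)^{1/2}`. -/
def hNorm (r : ℝ) (f : ℝ → ℝ) : ℝ :=
  √(∑' j : ℕ+, (j : ℝ) ^ (2 * r) * sineCoeff f j ^ 2)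

/-- The norm `|f|_{H^r_N}`, with `|f|²_{H^r_N} = ∑_{j ≤ N} j² f_j² + ∑_{j > N} j^{2r} f_j²`. -/
def hNormN (r : ℝ) (N : ℕ) (f : ℝ → ℝ) : ℝ :=
  √(∑' j : ℕ+, (if (j : ℕ) ≤ N then (j : ℝ) ^ 2 else (j : ℝ) ^ (2 * r)) * sineCoeff f j ^ 2)

/-- The linear frequencies `ω_j = √(j⁴ + m j²)`. -/
def omegaFreq (m : ℝ) (j : ℕ+) : ℝ := √((j : ℝ) ^ 4 + m * (j : ℝ) ^ 2)

/-- The weighted `H^{-1}` norm, with square `∑ (j² / ω_j²) f_j²`. -/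
def hTildeNegOneNorm (m : ℝ) (f : ℝ → ℝ) : ℝ :=
  √(∑' j : ℕ+, (j : ℝ) ^ 2 / omegaFreq m j ^ 2 * sineCoeff f j ^ 2)

/-- `μ = min {2 √(1+m), (3/2) √(4+m)}`. -/
def mu (m : ℝ) : ℝ := min (2 * √(1 + m)) (3 / 2 * √(4 + m))

def cStar : ℝ := (11 / 10) ^ 2 * ((5 / 6 - 1 / (80 * Real.exp 1)) ^ 2)⁻¹

def cDagger : ℝ := 44 * Real.exp 1 / π

/-- The constant `T₀ = 0.948 (1 - c_† c_* ε² / μ) / (c_† c_*²)`. -/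
def T0 (m ε : ℝ) : ℝ :=
  0.948 * (1 - cDagger * cStar * ε ^ 2 / mu m) / (cDagger * cStar ^ 2)

/-- Open intervals of times containing `0`. -/
def IsTimeInterval (I : Set ℝ) : Prop := IsOpen I ∧ I.OrdConnected ∧ (0 : ℝ) ∈ I

/-- `t ↦ u(t,·)` is of class `C^k` on `I` with values in `H^r_*`, for any real `r`: the weighted
coefficients `(j^r u_j(t))_j` form a `C^k` curve in `ℓ²`. -/
def ContDiffOnH (k : ℕ) (r : ℝ) (I : Set ℝ) (u : ℝ → ℝ → ℝ) : Prop :=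
  ∃ U : ℝ → lp (fun _ : ℕ+ => ℝ) 2, ContDiffOn ℝ k U I ∧
    ∀ t ∈ I, ∀ j : ℕ+, U t j = (j : ℝ) ^ r * sineCoeff (u t) j

/-- `η ∈ C^∞_c((0,π))`. -/
def IsTestFunction (η : ℝ → ℝ) : Prop :=
  ContDiff ℝ (⊤ : ℕ∞) η ∧ HasCompactSupport η ∧ tsupport η ⊆ Ioo 0 π

/-- `u` is a weak solution on the time interval `I` of
`u_tt + u_xxxx - (m + (1/2π) ∫_0^π u_x²) u_xx = 0`, with hinged-hinged boundary conditions (they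
are part of `u(t,·) ∈ H^{s+2}_*`) and initial data `u(0,·) = u₀`, `u_t(0,·) = v₀`.
Regularity: each time derivative costs two space derivatives. The pairing of `u_tt ∈ H^{s-2}_*`
with a test function `η` is `d²/dt² ∫_0^π u η dx`. -/
structure IsWeakSolution (m s : ℝ) (I : Set ℝ) (u₀ v₀ : ℝ → ℝ) (u : ℝ → ℝ → ℝ) : Prop where
  mem : ∀ t ∈ I, MemHstar (s + 2) (u t)
  continuous : ContDiffOnH 0 (s + 2) I u
  contDiff_one : ContDiffOnH 1 s I u
  contDiff_two : ContDiffOnH 2 (s - 2) I u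
  init_pos : ∀ x ∈ Icc (0 : ℝ) π, u 0 x = u₀ x
  init_vel : ∀ x ∈ Icc (0 : ℝ) π, HasDerivAt (fun t => u t x) (v₀ x) 0
  weak_eq : ∀ t ∈ I, ∀ η : ℝ → ℝ, IsTestFunction η →
    iteratedDeriv 2 (fun τ => ∫ x in (0 : ℝ)..π, u τ x * η x) t
      + (∫ x in (0 : ℝ)..π, iteratedDeriv 2 (u t) x * iteratedDeriv 2 η x)
      + (m + 1 / (2 * π) * ∫ x in (0 : ℝ)..π, deriv (u t) x ^ 2)
          * (∫ x in (0 : ℝ)..π, deriv (u t) x * deriv η x) = 0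

end

/-!
In the variables `z_j = j^r (c_j + i d_j / ω_j)`, where `c_j`, `d_j` are the sine coefficients of
`u`, `u_t` and `r = s + 2`, the beam equation is a family of oscillators
`z_j' = -i ω_j z_j + i F_j(z)` coupled only through the scalar `∫ u_x²`. In the
rotating frame `exp(i ω_j t) z_j` the right-hand side is locally Lipschitz on `ℓ²`, which gives
uniqueness and, after truncation to a ball, existence.

The time derivative of the weighted energy `∑ w_j |c_j + i d_j / ω_j|²` is quartic. Since every
`ω_j` and every gap `ω_j - ω_k` is at least `μ / 2`, all of its quartic terms are time
derivatives of quartic polynomials of size `O(energy² / μ)`. The energy corrected by these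
polynomials grows at a rate of sixth order only, so an energy of size `ε²` stays comparable to
`ε²` for times of order `μ ε⁻⁴`; in particular the solution never reaches the truncation. Giving
the first `N` modes the weight `j²` and the others `j^{2r}`, with `N` depending on the data,
makes the initial energy at most `2.1 ε²`.
-/

noncomputable section

/-! ### Square-summable sequences -/

section SequenceSpace

open scoped lp ENNReal

variable {ι F G : Type*} [NormedAddCommGroup F] [NormedAddCommGroup G]

theorem memℓp_two_iff {f : ι → F} : Memℓp f 2 ↔ Summable fun i => ‖f i‖ ^ 2 := by
  rw [memℓp_gen_iff (by simp)]
  simp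

theorem lpTwo_norm_sq (f : ℓ²(ι, F)) : ‖f‖ ^ 2 = ∑' i, ‖f i‖ ^ 2 := by
  simpa using lp.norm_rpow_eq_tsum (p := 2) (by simp) f

theorem lpTwo_summable_sq (f : ℓ²(ι, ℝ)) : Summable fun i => f i ^ 2 := by
  simpa using memℓp_two_iff.1 (lp.memℓp f)

/-- The element of `ℓ²` whose coordinates are a given square-summable family. -/
def lpTwoOfSummable (f : ι → F) (hf : Summable fun i => ‖f i‖ ^ 2) : ℓ²(ι, F) :=
  ⟨f, memℓp_two_iff.2 hf⟩

/-- The functional `f ↦ ∑ a_i f_i` on `ℓ²` given by a square-summable family `a`. -/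
def lpTwoPairing (a : ι → ℝ) (ha : Summable fun i => a i ^ 2) : ℓ²(ι, ℝ) →L[ℝ] ℝ :=
  innerSL ℝ (lpTwoOfSummable a (by simpa using ha))

theorem hasSum_lpTwoPairing {a : ι → ℝ} (ha : Summable fun i => a i ^ 2) (f : ℓ²(ι, ℝ)) :
    HasSum (fun i => a i * f i) (lpTwoPairing a ha f) :=
  (lp.hasSum_inner (𝕜 := ℝ) (lpTwoOfSummable a (by simpa using ha)) f).congr_fun fun i =>
    mul_comm (a i) (f i)

theorem summable_mul_of_summable_sq {a b : ι → ℝ} (ha : Summable fun i => a i ^ 2)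
    (hb : Summable fun i => b i ^ 2) : Summable fun i => a i * b i :=
  (hasSum_lpTwoPairing ha (lpTwoOfSummable b (by simpa using hb))).summable

variable {p : ℝ≥0∞} [NormedSpace ℝ F] [NormedSpace ℝ G]

theorem norm_apply_le_norm_abs_smul {T : ι → F →ₗ[ℝ] G} {C : ℝ} (h : ∀ i x, ‖T i x‖ ≤ C * ‖x‖)
    (f : ℓ^p(ι, F)) (i : ι) : ‖T i (f i)‖ ≤ ‖(|C| • f) i‖ := by
  rw [lp.coeFn_smul, Pi.smul_apply, norm_smul, norm_abs_eq_norm, Real.norm_eq_abs]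
  exact (h i _).trans (mul_le_mul_of_nonneg_right (le_abs_self C) (norm_nonneg _))

variable [Fact (1 ≤ p)]

/-- The diagonal operator `f ↦ (T_i f_i)_i` on `ℓ^p` given by a uniformly bounded family `T`. The
bound `C` is not assumed to be nonnegative, since the index type may be empty. -/
def diagOp (T : ι → F →ₗ[ℝ] G) (C : ℝ) (h : ∀ i x, ‖T i x‖ ≤ C * ‖x‖) :
    ℓ^p(ι, F) →L[ℝ] ℓ^p(ι, G) :=
  LinearMap.mkContinuous
    { toFun := fun f =>
        ⟨fun i => T i (f i), (lp.memℓp (|C| • f)).mono' (norm_apply_le_norm_abs_smul h f)⟩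
      map_add' := fun f g => Subtype.ext (funext fun i => map_add (T i) (f i) (g i))
      map_smul' := fun c f => Subtype.ext (funext fun i => map_smul (T i) c (f i)) }
    |C| fun f =>
      (lp.norm_mono (zero_lt_one.trans_le Fact.out).ne' (norm_apply_le_norm_abs_smul h f)).trans_eq
        (by rw [norm_smul, norm_abs_eq_norm, Real.norm_eq_abs])

theorem norm_diagOp_le (T : ι → F →ₗ[ℝ] G) {C : ℝ} (hC : 0 ≤ C) (h : ∀ i x, ‖T i x‖ ≤ C * ‖x‖)
    (f : ℓ^p(ι, F)) : ‖diagOp T C h f‖ ≤ C * ‖f‖ := by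
  simpa only [abs_of_nonneg hC] using
    (diagOp T C h).le_of_opNorm_le (LinearMap.mkContinuous_norm_le _ (abs_nonneg C) _) f

/-- The Fourier-type multiplier `f ↦ (k_i f_i)_i` on `ℓ^p` with a bounded real symbol `k`. -/
def multiplierOp (k : ι → ℝ) (C : ℝ) (hk : ∀ i, |k i| ≤ C) : ℓ^p(ι, ℝ) →L[ℝ] ℓ^p(ι, ℝ) :=
  diagOp (fun i => LinearMap.mulLeft ℝ (k i)) C fun i x => by
    rw [LinearMap.mulLeft_apply, norm_mul]
    exact mul_le_mul_of_nonneg_right (hk i) (norm_nonneg x)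

@[simp] theorem multiplierOp_apply {k : ι → ℝ} {C : ℝ} (hk : ∀ i, |k i| ≤ C) (f : ℓ^p(ι, ℝ))
    (i : ι) : multiplierOp k C hk f i = k i * f i := rfl

theorem continuousOn_tsum_sq {X : Type*} [TopologicalSpace X] {S : Set X} {U : X → ℓ²(ι, ℝ)}
    (hU : ContinuousOn U S) {k : ι → ℝ} {C : ℝ} (hk : ∀ i, |k i| ≤ C) :
    ContinuousOn (fun t => ∑' i, (k i * U t i) ^ 2) S := by
  refine (((multiplierOp k C hk).continuous.comp_continuousOn hU).norm.pow 2).congr fun t _ => ?_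
  simp only [Pi.pow_apply, Function.comp_apply, lpTwo_norm_sq, multiplierOp_apply,
    Real.norm_eq_abs, sq_abs]

theorem hasDerivAt_lp_apply {U : ℝ → ℓ^p(ι, F)} {V : ℓ^p(ι, F)} {t : ℝ} (h : HasDerivAt U V t)
    (i : ι) : HasDerivAt (fun τ => U τ i) (V i) t :=
  (lp.evalCLM ℝ (fun _ : ι => F) p i).hasFDerivAt.comp_hasDerivAt t h

theorem hasDerivAt_lp_of_apply [CompleteSpace F] {I : Set ℝ} (hI : IsOpen I) (hc : I.OrdConnected)
    {U V : ℝ → ℓ^p(ι, F)} (hV : ContinuousOn V I)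
    (hUV : ∀ t ∈ I, ∀ i, HasDerivAt (fun τ => U τ i) (V t i) t) {t : ℝ} (ht : t ∈ I) :
    HasDerivAt U (V t) t := by
  have hsub : ∀ τ ∈ I, uIcc t τ ⊆ I := fun τ hτ => hc.uIcc_subset ht hτ
  have hint : ∀ τ ∈ I, IntervalIntegrable V MeasureTheory.volume t τ := fun τ hτ =>
    (hV.mono (hsub τ hτ)).intervalIntegrable
  have hprim : HasDerivAt (fun τ => U t + ∫ x in t..τ, V x) (V t) t :=
    (intervalIntegral.integral_hasDerivAt_right (hint t ht) (hV.stronglyMeasurableAtFilter hI t ht)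
      (hV.continuousAt (hI.mem_nhds ht))).const_add _
  refine hprim.congr_of_eventuallyEq ?_
  filter_upwards [hI.mem_nhds ht] with τ hτ
  ext i
  let L := lp.evalCLM ℝ (fun _ : ι => F) p i
  have hcoord : ∫ x in t..τ, L (V x) = U τ i - U t i :=
    intervalIntegral.integral_eq_sub_of_hasDerivAt (fun x hx => hUV x (hsub τ hτ hx) i)
      (L.continuous.comp_continuousOn (hV.mono (hsub τ hτ))).intervalIntegrable
  rw [L.intervalIntegral_comp_comm (hint τ hτ)] at hcoord
  change L (U τ) = L (U t + _)
  rw [map_add, hcoord]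
  exact (add_sub_cancel _ _).symm

end SequenceSpace

/-! ### Sine series -/

section BoundedSeries

variable {ι : Type*} {c : ι → ℝ}

theorem summable_mul_of_abs_le_one {e : ι → ℝ} (hc : Summable fun i => |c i|)
    (he : ∀ i, |e i| ≤ 1) : Summable fun i => c i * e i :=
  Summable.of_norm_bounded hc fun i => by
    rw [norm_mul, Real.norm_eq_abs, Real.norm_eq_abs]
    exact mul_le_of_le_one_right (abs_nonneg _) (he i)

theorem continuous_tsum_mul {X : Type*} [TopologicalSpace X] {e : ι → X → ℝ}
    (he : ∀ i, Continuous (e i)) (hb : ∀ i x, |e i x| ≤ 1) (hc : Summable fun i => |c i|) :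
    Continuous fun x => ∑' i, c i * e i x := by
  refine continuous_tsum (fun i => (he i).const_mul _) hc fun i x => ?_
  rw [norm_mul, Real.norm_eq_abs, Real.norm_eq_abs]
  exact mul_le_of_le_one_right (abs_nonneg _) (hb i x)

theorem hasDerivAt_tsum_mul {e e' : ι → ℝ → ℝ} {k : ι → ℝ}
    (he : ∀ i x, HasDerivAt (e i) (k i * e' i x) x) (hb : ∀ i x, |e i x| ≤ 1)
    (hb' : ∀ i x, |e' i x| ≤ 1) (hc : Summable fun i => |c i|)
    (hc' : Summable fun i => |k i * c i|) (x : ℝ) :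
    HasDerivAt (fun x => ∑' i, c i * e i x) (∑' i, k i * c i * e' i x) x := by
  refine hasDerivAt_tsum (g := fun i x => c i * e i x) (g' := fun i x => k i * c i * e' i x)
    hc' (fun i y => ?_) (fun i y => ?_) (y₀ := 0)
    (summable_mul_of_abs_le_one hc fun i => hb i 0) x
  · exact ((he i y).const_mul (c i)).congr_deriv (by ring)
  · rw [norm_mul, Real.norm_eq_abs, Real.norm_eq_abs]
    exact mul_le_of_le_one_right (abs_nonneg _) (hb' i y)

theorem hasSum_integral_series_mul [Countable ι] {a b : ℝ} (hab : a ≤ b) {e : ι → ℝ → ℝ}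
    (he : ∀ i, Continuous (e i)) (hb : ∀ i x, |e i x| ≤ 1) (hc : Summable fun i => |c i|)
    {f g : ℝ → ℝ} (hg : Continuous g)
    (hf : ∀ x ∈ Ioo a b, HasSum (fun i => c i * e i x) (f x)) :
    HasSum (fun i => c i * ∫ x in a..b, e i x * g x) (∫ x in a..b, f x * g x) := by
  have hcongr : ∫ x in a..b, f x * g x = ∫ x in a..b, (∑' i, c i * e i x) * g x :=
    intervalIntegral.integral_congr_Ioo_of_le hab fun x hx => by
      simp only [(hf x hx).tsum_eq]
  rw [hcongr]
  simp only [← intervalIntegral.integral_const_mul]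
  refine intervalIntegral.hasSum_integral_of_dominated_convergence
    (fun i x => |c i| * |g x|) (fun i => ?_) (fun i => Eventually.of_forall fun x _ => ?_)
    (Eventually.of_forall fun x _ => hc.mul_right _) ?_ (Eventually.of_forall fun x _ => ?_)
  · exact (((he i).mul hg).const_mul _).aestronglyMeasurable
  · rw [norm_mul, norm_mul, Real.norm_eq_abs, Real.norm_eq_abs, Real.norm_eq_abs]
    exact mul_le_mul_of_nonneg_left (mul_le_of_le_one_left (abs_nonneg _) (hb i x)) (abs_nonneg _)
  · simp_rw [tsum_mul_right]
    exact (by fun_prop : Continuous fun x => (∑' i, |c i|) * |g x|).intervalIntegrable _ _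
  · simpa only [mul_assoc] using
      (summable_mul_of_abs_le_one hc fun i => hb i x).hasSum.mul_right (g x)

end BoundedSeries

/-- `ψ_j(x) = √(2/π) cos (j x)`, the companion basis for derivatives: `φ_j' = j ψ_j` and
`ψ_j' = -j φ_j`. -/
def psi (j : ℕ+) (x : ℝ) : ℝ := √(2 / π) * Real.cos ((j : ℝ) * x)

theorem pnat_cast_pos (j : ℕ+) : (0 : ℝ) < j := Nat.cast_pos.2 j.pos

theorem one_le_pnat_cast (j : ℕ+) : (1 : ℝ) ≤ j := Nat.one_le_cast.2 j.pos

theorem sqrt_two_div_pi_le_one : √(2 / π) ≤ 1 :=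
  Real.sqrt_le_one.2 ((div_le_one pi_pos).2 (by linarith [pi_gt_three]))

@[fun_prop] theorem continuous_phi (j : ℕ+) : Continuous (phi j) := by unfold phi; fun_prop

@[fun_prop] theorem continuous_psi (j : ℕ+) : Continuous (psi j) := by unfold psi; fun_prop

theorem abs_phi_le_sqrt (j : ℕ+) (x : ℝ) : |phi j x| ≤ √(2 / π) := by
  rw [phi, abs_mul, abs_of_nonneg (sqrt_nonneg _)]
  exact mul_le_of_le_one_right (sqrt_nonneg _) (abs_sin_le_one _)

theorem abs_phi_le (j : ℕ+) (x : ℝ) : |phi j x| ≤ 1 :=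
  (abs_phi_le_sqrt j x).trans sqrt_two_div_pi_le_one

theorem abs_psi_le (j : ℕ+) (x : ℝ) : |psi j x| ≤ 1 := by
  rw [psi, abs_mul, abs_of_nonneg (sqrt_nonneg _)]
  exact mul_le_one₀ sqrt_two_div_pi_le_one (abs_nonneg _) (abs_cos_le_one _)

theorem phi_zero (j : ℕ+) : phi j 0 = 0 := by simp [phi]

theorem phi_pi (j : ℕ+) : phi j π = 0 := by simp [phi, Real.sin_nat_mul_pi]

theorem hasDerivAt_phi (j : ℕ+) (x : ℝ) : HasDerivAt (phi j) ((j : ℝ) * psi j x) x :=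
  (((hasDerivAt_id x).const_mul (j : ℝ)).sin.const_mul √(2 / π)).congr_deriv
    (by simp only [psi, id]; ring)

theorem hasDerivAt_psi (j : ℕ+) (x : ℝ) : HasDerivAt (psi j) (-((j : ℝ) * phi j x)) x :=
  (((hasDerivAt_id x).const_mul (j : ℝ)).cos.const_mul √(2 / π)).congr_deriv
    (by simp only [phi, id]; ring)

theorem integral_cos_int_mul {n : ℤ} (hn : n ≠ 0) :
    ∫ x in (0 : ℝ)..π, Real.cos ((n : ℝ) * x) = 0 := by
  rw [intervalIntegral.integral_comp_mul_left (fun y => Real.cos y) (Int.cast_ne_zero.2 hn),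
    integral_cos]
  simp [Real.sin_int_mul_pi]

theorem phi_mul_phi (j k : ℕ+) (x : ℝ) :
    phi j x * phi k x
      = (1 / π) * (Real.cos (((j - k : ℤ) : ℝ) * x) - Real.cos (((j + k : ℤ) : ℝ) * x)) := by
  have h : √(2 / π) * √(2 / π) = 2 / π := Real.mul_self_sqrt (by positivity)
  push_cast
  rw [sub_mul, add_mul, Real.cos_sub, Real.cos_add, phi, phi]
  linear_combination (Real.sin (j * x) * Real.sin (k * x)) * h

theorem integral_phi_mul_phi (j k : ℕ+) :
    ∫ x in (0 : ℝ)..π, phi j x * phi k x = if j = k then 1 else 0 := by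
  have hint (n : ℤ) :
      IntervalIntegrable (fun x => Real.cos ((n : ℝ) * x)) MeasureTheory.volume 0 π :=
    (by fun_prop : Continuous fun x => Real.cos ((n : ℝ) * x)).intervalIntegrable _ _
  simp_rw [phi_mul_phi]
  rw [intervalIntegral.integral_const_mul, intervalIntegral.integral_sub (hint _) (hint _),
    integral_cos_int_mul (n := j + k) (by have := j.pos; have := k.pos; positivity)]
  split_ifs with h
  · subst h
    simp [pi_ne_zero]
  · rw [integral_cos_int_mul, sub_zero, mul_zero]
    exact fun hjk => h (PNat.coe_injective (by exact_mod_cast sub_eq_zero.1 hjk))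

theorem sineCoeff_of_hasSum {c : ℕ+ → ℝ} (hc : Summable fun j => |c j|) {f : ℝ → ℝ}
    (hf : ∀ x ∈ Ioo 0 π, HasSum (fun j => c j * phi j x) (f x)) (j : ℕ+) :
    sineCoeff f j = c j := by
  have h := hasSum_integral_series_mul pi_pos.le continuous_phi abs_phi_le hc (continuous_phi j) hf
  simp_rw [integral_phi_mul_phi, mul_ite, mul_one, mul_zero] at h
  refine h.unique ?_
  convert hasSum_ite_eq j (c j) using 3 with k hk
  rw [hk]

theorem pnat_rpow_sq (r : ℝ) (j : ℕ+) : ((j : ℝ) ^ r) ^ 2 = (j : ℝ) ^ (2 * r) := by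
  rw [← rpow_natCast, ← rpow_mul (pnat_cast_pos j).le, mul_comm, Nat.cast_ofNat]

theorem summable_rpow_mul_abs {r k : ℝ} (hr : k + 1 / 2 < r) {c : ℕ+ → ℝ}
    (hc : Summable fun j : ℕ+ => (j : ℝ) ^ (2 * r) * c j ^ 2) :
    Summable fun j : ℕ+ => (j : ℝ) ^ k * |c j| := by
  have hk : Summable fun j : ℕ+ => ((j : ℝ) ^ (k - r)) ^ 2 := by
    simp only [pnat_rpow_sq]
    exact (Real.summable_nat_rpow.2 (by linarith)).comp_injective PNat.coe_injective
  have hrc : Summable fun j : ℕ+ => ((j : ℝ) ^ r * |c j|) ^ 2 := by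
    simpa only [mul_pow, sq_abs, pnat_rpow_sq] using hc
  refine (summable_mul_of_summable_sq hk hrc).congr fun j => ?_
  rw [← mul_assoc, ← rpow_add (pnat_cast_pos j), sub_add_cancel]

/-- The sine series `∑ c_j φ_j` with coefficients `c`. -/
def sineSeries (c : ℕ+ → ℝ) (x : ℝ) : ℝ := ∑' j, c j * phi j x

theorem sineSeries_zero (c : ℕ+ → ℝ) : sineSeries c 0 = 0 := by simp [sineSeries, phi_zero]

theorem sineSeries_pi (c : ℕ+ → ℝ) : sineSeries c π = 0 := by simp [sineSeries, phi_pi]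

section SineSeries

variable {c : ℕ+ → ℝ}

theorem hasSum_sineSeries (hc : Summable fun j => |c j|) (x : ℝ) :
    HasSum (fun j => c j * phi j x) (sineSeries c x) :=
  (summable_mul_of_abs_le_one hc fun j => abs_phi_le j x).hasSum

theorem continuous_sineSeries (hc : Summable fun j => |c j|) : Continuous (sineSeries c) :=
  continuous_tsum_mul continuous_phi abs_phi_le hc

theorem sineCoeff_sineSeries (hc : Summable fun j => |c j|) (j : ℕ+) :
    sineCoeff (sineSeries c) j = c j :=
  sineCoeff_of_hasSum hc (fun x _ => hasSum_sineSeries hc x) j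

theorem hasDerivAt_sineSeries (hc : Summable fun j => |c j|)
    (hc' : Summable fun j : ℕ+ => |(j : ℝ) * c j|) (x : ℝ) :
    HasDerivAt (sineSeries c) (∑' j : ℕ+, (j : ℝ) * c j * psi j x) x :=
  hasDerivAt_tsum_mul hasDerivAt_phi abs_phi_le abs_psi_le hc hc' x

theorem hasDerivAt_deriv_sineSeries (hc' : Summable fun j : ℕ+ => |(j : ℝ) * c j|)
    (hc'' : Summable fun j : ℕ+ => |(j : ℝ) ^ 2 * c j|) (x : ℝ) :
    HasDerivAt (fun x => ∑' j : ℕ+, (j : ℝ) * c j * psi j x)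
      (sineSeries (fun j => -((j : ℝ) ^ 2 * c j)) x) x := by
  have h := hasDerivAt_tsum_mul (e := psi) (e' := phi) (k := fun j : ℕ+ => -(j : ℝ))
    (fun j x => (hasDerivAt_psi j x).congr_deriv (by ring)) abs_psi_le abs_phi_le hc'
    (by simpa [pow_two, mul_assoc] using hc'') x
  exact h.congr_deriv (tsum_congr fun j => by ring)

end SineSeries

/-- `f` is represented on `[0,π]` by a sine series whose coefficients satisfy `∑ j² |f_j| < ∞`: the
regularity under which the weak formulation can be integrated termwise. -/
structure IsSineRegular (f : ℝ → ℝ) : Prop where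
  summable_zero : Summable fun j => |sineCoeff f j|
  summable_one : Summable fun j : ℕ+ => |(j : ℝ) * sineCoeff f j|
  summable_two : Summable fun j : ℕ+ => |(j : ℝ) ^ 2 * sineCoeff f j|
  eq_series : ∀ x ∈ Icc 0 π, f x = sineSeries (sineCoeff f) x

theorem MemHstar.summable_abs {r : ℝ} (hr : 1 / 2 < r) {f : ℝ → ℝ} (hf : MemHstar r f) :
    Summable fun j => |sineCoeff f j| := by
  simpa using summable_rpow_mul_abs (k := 0) (by linarith) hf.1

theorem MemHstar.eq_sineSeries {r : ℝ} {f : ℝ → ℝ} (hf : MemHstar r f) {x : ℝ}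
    (hx : x ∈ Icc 0 π) : f x = sineSeries (sineCoeff f) x := (hf.2 x hx).tsum_eq.symm

theorem MemHstar.isSineRegular {s : ℝ} (hs : 1 / 2 < s) {f : ℝ → ℝ} (hf : MemHstar (s + 2) f) :
    IsSineRegular f where
  summable_zero := hf.summable_abs (by linarith)
  summable_one := by simpa [abs_mul] using summable_rpow_mul_abs (k := 1) (by linarith) hf.1
  summable_two := by simpa [abs_mul] using summable_rpow_mul_abs (k := 2) (by linarith) hf.1
  eq_series := fun _ hx => hf.eq_sineSeries hx

section IntegrationByParts

variable {g g' : ℝ → ℝ}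

theorem integral_psi_mul_deriv (hg : ∀ x, HasDerivAt g (g' x) x) (hg' : Continuous g')
    (h0 : g 0 = 0) (hpi : g π = 0) (j : ℕ+) :
    ∫ x in (0 : ℝ)..π, psi j x * g' x = (j : ℝ) * sineCoeff g j := by
  have hpsi : Continuous fun x => -((j : ℝ) * phi j x) := by fun_prop
  rw [intervalIntegral.integral_mul_deriv_eq_deriv_mul (fun x _ => hasDerivAt_psi j x)
    (fun x _ => hg x) (hpsi.intervalIntegrable _ _) (hg'.intervalIntegrable _ _), h0, hpi,
    sineCoeff, ← intervalIntegral.integral_const_mul]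
  simp only [mul_zero, sub_zero, zero_sub, ← intervalIntegral.integral_neg]
  exact intervalIntegral.integral_congr fun x _ => by ring

theorem sineCoeff_deriv (hg : ∀ x, HasDerivAt g (g' x) x) (hg' : Continuous g') (j : ℕ+) :
    sineCoeff g' j = -((j : ℝ) * ∫ x in (0 : ℝ)..π, psi j x * g x) := by
  have hphi : Continuous fun x => (j : ℝ) * psi j x := by fun_prop
  have h := intervalIntegral.integral_mul_deriv_eq_deriv_mul (a := 0) (b := π)
    (fun x _ => hasDerivAt_phi j x) (fun x _ => hg x) (hphi.intervalIntegrable _ _)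
    (hg'.intervalIntegrable _ _)
  simp only [phi_zero, phi_pi, zero_mul, sub_zero, zero_sub, mul_assoc,
    intervalIntegral.integral_const_mul] at h
  simp only [sineCoeff, mul_comm (g' _), h]

end IntegrationByParts

namespace IsSineRegular

variable {f g : ℝ → ℝ}

theorem eventuallyEq (hf : IsSineRegular f) {x : ℝ} (hx : x ∈ Ioo 0 π) :
    f =ᶠ[𝓝 x] sineSeries (sineCoeff f) := by
  filter_upwards [Ioo_mem_nhds hx.1 hx.2] with y hy using hf.eq_series y (Ioo_subset_Icc_self hy)

theorem deriv_eq (hf : IsSineRegular f) {x : ℝ} (hx : x ∈ Ioo 0 π) :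
    deriv f x = ∑' j : ℕ+, (j : ℝ) * sineCoeff f j * psi j x := by
  rw [(hf.eventuallyEq hx).deriv_eq]
  exact (hasDerivAt_sineSeries hf.summable_zero hf.summable_one x).deriv

theorem iteratedDeriv_two_eq (hf : IsSineRegular f) {x : ℝ} (hx : x ∈ Ioo 0 π) :
    iteratedDeriv 2 f x = sineSeries (fun j => -((j : ℝ) ^ 2 * sineCoeff f j)) x := by
  have hderiv : deriv f =ᶠ[𝓝 x] fun x => ∑' j : ℕ+, (j : ℝ) * sineCoeff f j * psi j x := by
    filter_upwards [Ioo_mem_nhds hx.1 hx.2] with y hy using hf.deriv_eq hy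
  rw [iteratedDeriv_succ, iteratedDeriv_one, hderiv.deriv_eq]
  exact (hasDerivAt_deriv_sineSeries hf.summable_one hf.summable_two x).deriv

theorem hasSum_integral_mul (hf : IsSineRegular f) (hg : Continuous g) :
    HasSum (fun j => sineCoeff f j * sineCoeff g j) (∫ x in (0 : ℝ)..π, f x * g x) := by
  have h := hasSum_integral_series_mul pi_pos.le continuous_phi abs_phi_le hf.summable_zero hg
    (f := f) fun x hx => by
      rw [hf.eq_series x (Ioo_subset_Icc_self hx)]
      exact hasSum_sineSeries hf.summable_zero x
  simpa only [sineCoeff, mul_comm] using h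

theorem hasSum_integral_deriv_mul (hf : IsSineRegular f) (hg : Continuous g) :
    HasSum (fun j : ℕ+ => (j : ℝ) * sineCoeff f j * ∫ x in (0 : ℝ)..π, psi j x * g x)
      (∫ x in (0 : ℝ)..π, deriv f x * g x) :=
  hasSum_integral_series_mul pi_pos.le continuous_psi abs_psi_le hf.summable_one hg fun x hx => by
    rw [hf.deriv_eq hx]
    exact (summable_mul_of_abs_le_one hf.summable_one fun j => abs_psi_le j x).hasSum

theorem hasSum_integral_iteratedDeriv_two_mul (hf : IsSineRegular f) (hg : Continuous g) :
    HasSum (fun j : ℕ+ => -((j : ℝ) ^ 2 * sineCoeff f j) * sineCoeff g j)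
      (∫ x in (0 : ℝ)..π, iteratedDeriv 2 f x * g x) := by
  have hc : Summable fun j : ℕ+ => |-((j : ℝ) ^ 2 * sineCoeff f j)| := by
    simpa only [abs_neg] using hf.summable_two
  have h := hasSum_integral_series_mul pi_pos.le continuous_phi abs_phi_le hc hg
    (f := iteratedDeriv 2 f) fun x hx => by
      rw [hf.iteratedDeriv_two_eq hx]
      exact hasSum_sineSeries hc x
  simpa only [sineCoeff, mul_comm] using h

theorem hasSum_integral_deriv_sq (hf : IsSineRegular f) :
    HasSum (fun j : ℕ+ => (j : ℝ) ^ 2 * sineCoeff f j ^ 2) (∫ x in (0 : ℝ)..π, deriv f x ^ 2) := by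
  have hcont := continuous_tsum_mul continuous_psi abs_psi_le hf.summable_one
  have hpsi (j : ℕ+) : ∫ x in (0 : ℝ)..π, psi j x * (∑' k : ℕ+, (k : ℝ) * sineCoeff f k * psi k x)
      = (j : ℝ) * sineCoeff f j := by
    rw [integral_psi_mul_deriv (hasDerivAt_sineSeries hf.summable_zero hf.summable_one) hcont
      (sineSeries_zero _) (sineSeries_pi _), sineCoeff_sineSeries hf.summable_zero]
  have h := hf.hasSum_integral_deriv_mul hcont
  simp only [hpsi] at h
  convert h using 1
  · exact funext fun j => by ring
  · exact intervalIntegral.integral_congr_Ioo_of_le pi_pos.le fun x hx => by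
      simp only [← hf.deriv_eq hx, sq]

end IsSineRegular

/-! ### Test functions -/

theorem exists_abs_sineCoeff_le {g : ℝ → ℝ} (hg : Continuous g) :
    ∃ C, ∀ j, |sineCoeff g j| ≤ C := by
  refine ⟨|∫ x in (0 : ℝ)..π, ‖g x‖|, fun j => ?_⟩
  refine intervalIntegral.norm_integral_le_abs_of_norm_le (f := fun x => g x * phi j x)
    (Eventually.of_forall fun x => ?_) (hg.norm.intervalIntegrable _ _)
  rw [norm_mul]
  exact mul_le_of_le_one_right (norm_nonneg _) (abs_phi_le j x)

theorem support_integral_subset_Icc {ξ : ℝ → ℝ} (hξ : Continuous ξ) {A B a b : ℝ} (hA : A < a)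
    (hB : b < B) (hsupp : Function.support ξ ⊆ Icc a b) (h0 : ∫ x in A..B, ξ x = 0) :
    Function.support (fun x => ∫ y in A..x, ξ y) ⊆ Icc a b := by
  have hzero {c d : ℝ} {s : Set ℝ} (hs : s.OrdConnected) (hc : c ∈ s) (hd : d ∈ s)
      (hsI : Disjoint s (Icc a b)) : ∫ y in c..d, ξ y = 0 := by
    refine (intervalIntegral.integral_congr fun y hy => ?_).trans intervalIntegral.integral_zero
    by_contra hy'
    exact hsI.le_bot ⟨hs.uIcc_subset hc hd hy, hsupp hy'⟩
  intro x hx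
  refine ⟨not_lt.1 fun hxa => hx ?_, not_lt.1 fun hbx => hx ?_⟩
  · exact hzero ordConnected_Iio hA hxa
      (Set.disjoint_left.2 fun y hy hyI => (mem_Iio.1 hy).not_ge hyI.1)
  · have htail : ∫ y in x..B, ξ y = 0 := hzero ordConnected_Ioi hbx hB
      (Set.disjoint_left.2 fun y hy hyI => (mem_Ioi.1 hy).not_ge hyI.2)
    simpa [htail, h0] using intervalIntegral.integral_add_adjacent_intervals
      (hξ.intervalIntegrable (μ := MeasureTheory.volume) A x) (hξ.intervalIntegrable x B)

theorem integral_mul_sub_const_mul {f g h : ℝ → ℝ} (hf : Continuous f) (hg : Continuous g)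
    (hh : Continuous h) (a b c : ℝ) :
    ∫ x in a..b, f x * (g x - c * h x) = (∫ x in a..b, f x * g x) - c * ∫ x in a..b, f x * h x := by
  rw [← intervalIntegral.integral_const_mul, ← intervalIntegral.integral_sub
    ((by fun_prop : Continuous fun x => f x * g x).intervalIntegrable _ _)
    ((by fun_prop : Continuous fun x => c * (f x * h x)).intervalIntegrable _ _)]
  exact intervalIntegral.integral_congr fun x _ => by ring

namespace IsTestFunction

variable {η ξ ρ : ℝ → ℝ}

theorem continuous (hη : IsTestFunction η) : Continuous η := hη.1.continuous

theorem deriv (hη : IsTestFunction η) : IsTestFunction (deriv η) :=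
  ⟨(contDiff_infty_iff_deriv.1 hη.1).2, hη.2.1.deriv, tsupport_deriv_subset.trans hη.2.2⟩

theorem hasDerivAt (hη : IsTestFunction η) (x : ℝ) : HasDerivAt η (_root_.deriv η x) x :=
  (hη.1.differentiable (by simp) x).hasDerivAt

theorem apply_zero (hη : IsTestFunction η) : η 0 = 0 :=
  image_eq_zero_of_notMem_tsupport fun h => lt_irrefl _ (hη.2.2 h).1

theorem apply_pi (hη : IsTestFunction η) : η π = 0 :=
  image_eq_zero_of_notMem_tsupport fun h => lt_irrefl _ (hη.2.2 h).2

theorem iteratedDeriv_two (hη : IsTestFunction η) : IsTestFunction (iteratedDeriv 2 η) := by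
  rw [iteratedDeriv_succ, iteratedDeriv_one]
  exact hη.deriv.deriv

theorem sineCoeff_iteratedDeriv_two (hη : IsTestFunction η) (j : ℕ+) :
    sineCoeff (iteratedDeriv 2 η) j = -((j : ℝ) ^ 2 * sineCoeff η j) := by
  rw [iteratedDeriv_succ, iteratedDeriv_one, sineCoeff_deriv hη.deriv.hasDerivAt
    hη.deriv.deriv.continuous, integral_psi_mul_deriv hη.hasDerivAt hη.deriv.continuous
    hη.apply_zero hη.apply_pi]
  ring

theorem exists_sq_mul_abs_sineCoeff_le (hη : IsTestFunction η) :
    ∃ C, ∀ j : ℕ+, (j : ℝ) ^ 2 * |sineCoeff η j| ≤ C := by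
  obtain ⟨C, hC⟩ := exists_abs_sineCoeff_le hη.iteratedDeriv_two.continuous
  refine ⟨C, fun j => ?_⟩
  simpa [hη.sineCoeff_iteratedDeriv_two, abs_mul] using hC j

theorem sub_const_mul (hξ : IsTestFunction ξ) (hρ : IsTestFunction ρ) (c : ℝ) :
    IsTestFunction (fun x => ξ x - c * ρ x) := by
  have hsupp : tsupport (fun x => ξ x - c * ρ x) ⊆ tsupport ξ ∪ tsupport ρ := by
    refine closure_minimal (fun x hx => ?_) ((isClosed_tsupport _).union (isClosed_tsupport _))
    by_contra h
    rw [mem_union, not_or] at h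
    exact hx (by simp [image_eq_zero_of_notMem_tsupport h.1, image_eq_zero_of_notMem_tsupport h.2])
  exact ⟨hξ.1.sub (contDiff_const.mul hρ.1),
    (hξ.2.1.isCompact.union hρ.2.1.isCompact).of_isClosed_subset (isClosed_tsupport _) hsupp,
    hsupp.trans (union_subset hξ.2.2 hρ.2.2)⟩

theorem exists_tsupport_subset_Icc (hξ : IsTestFunction ξ) :
    ∃ a b : ℝ, 0 < a ∧ b < π ∧ tsupport ξ ⊆ Icc a b := by
  rcases (tsupport ξ).eq_empty_or_nonempty with hempty | hne
  · exact ⟨1, 1, one_pos, by linarith [pi_gt_three], by simp [hempty]⟩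
  · obtain ⟨a, ha⟩ := hξ.2.1.isCompact.exists_isLeast hne
    obtain ⟨b, hb⟩ := hξ.2.1.isCompact.exists_isGreatest hne
    exact ⟨a, b, (hξ.2.2 ha.1).1, (hξ.2.2 hb.1).2, fun x hx => ⟨ha.2 hx, hb.2 hx⟩⟩

theorem exists_primitive (hξ : IsTestFunction ξ) (h0 : ∫ x in (0 : ℝ)..π, ξ x = 0) :
    ∃ η, IsTestFunction η ∧ ∀ x, HasDerivAt η (ξ x) x := by
  have hprim (x : ℝ) : HasDerivAt (fun x => ∫ y in (0 : ℝ)..x, ξ y) (ξ x) x :=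
    hξ.continuous.integral_hasStrictDerivAt 0 x |>.hasDerivAt
  have hsmooth : ContDiff ℝ (⊤ : ℕ∞) (fun x => ∫ y in (0 : ℝ)..x, ξ y) := by
    rw [contDiff_infty_iff_deriv, funext fun x => (hprim x).deriv]
    exact ⟨fun x => (hprim x).differentiableAt, hξ.1⟩
  obtain ⟨a, b, ha, hb, hab⟩ := hξ.exists_tsupport_subset_Icc
  have hsupp := support_integral_subset_Icc hξ.continuous ha hb ((subset_tsupport ξ).trans hab) h0
  exact ⟨_, ⟨hsmooth, HasCompactSupport.of_support_subset_isCompact isCompact_Icc hsupp,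
    (closure_minimal hsupp isClosed_Icc).trans (Icc_subset_Ioo ha hb)⟩, hprim⟩

end IsTestFunction

theorem exists_isTestFunction_integral_eq_one :
    ∃ ρ, IsTestFunction ρ ∧ ∫ x in (0 : ℝ)..π, ρ x = 1 := by
  let f : ContDiffBump (1 : ℝ) := ⟨1 / 4, 1 / 2, by norm_num, by norm_num⟩
  have hsupp : tsupport (f.normed MeasureTheory.volume) ⊆ Ioo 0 π := by
    have hr : f.rOut = 1 / 2 := rfl
    rw [f.tsupport_normed_eq, Real.closedBall_eq_Icc, hr]
    exact Icc_subset_Ioo (by norm_num) (by linarith [pi_gt_three])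
  refine ⟨f.normed MeasureTheory.volume,
    ⟨f.contDiff_normed, f.hasCompactSupport_normed, hsupp⟩, ?_⟩
  exact (intervalIntegral.integral_eq_integral_of_support_subset
    ((subset_tsupport _).trans (hsupp.trans Ioo_subset_Ioc_self))).trans f.integral_normed

section DuBoisReymond

/-- The functional is arbitrary, so that the lemma applies to the distributional derivative of a
function as well as to the function itself. -/
theorem exists_eq_const_mul_integral {L : (ℝ → ℝ) → ℝ}
    (hL : ∀ ξ ρ c, IsTestFunction ξ → IsTestFunction ρ → L (fun x => ξ x - c * ρ x) = L ξ - c * L ρ)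
    (h : ∀ η, IsTestFunction η → L (deriv η) = 0) :
    ∃ c, ∀ ξ, IsTestFunction ξ → L ξ = c * ∫ x in (0 : ℝ)..π, ξ x := by
  obtain ⟨ρ, hρ, hρ1⟩ := exists_isTestFunction_integral_eq_one
  refine ⟨L ρ, fun ξ hξ => ?_⟩
  have hmean : ∫ x in (0 : ℝ)..π, (ξ x - (∫ x in (0 : ℝ)..π, ξ x) * ρ x) = 0 := by
    have h1 := integral_mul_sub_const_mul (f := fun _ => 1) continuous_const
      hξ.continuous hρ.continuous 0 π (∫ x in (0 : ℝ)..π, ξ x)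
    simpa only [one_mul, hρ1, mul_one, sub_self] using h1
  obtain ⟨η, hη, hderiv⟩ := (hξ.sub_const_mul hρ _).exists_primitive hmean
  have hzero := h η hη
  rw [funext fun x => (hderiv x).deriv, hL _ _ _ hξ hρ] at hzero
  linarith

theorem eqOn_Icc_zero_of_integral_mul {f : ℝ → ℝ} (hf : Continuous f)
    (h : ∀ ξ, IsTestFunction ξ → ∫ x in (0 : ℝ)..π, f x * ξ x = 0) : EqOn f 0 (Icc 0 π) := by
  have hae : ∀ᵐ x ∂MeasureTheory.volume, x ∈ Ioo 0 π → f x = 0 := by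
    refine IsOpen.ae_eq_zero_of_integral_contDiff_smul_eq_zero isOpen_Ioo
      (hf.locallyIntegrable.locallyIntegrableOn _) fun ξ hξ hξc hξs => ?_
    simp only [smul_eq_mul, mul_comm (ξ _)]
    rw [← intervalIntegral.integral_eq_integral_of_support_subset, h ξ ⟨hξ, hξc, hξs⟩]
    exact (Function.support_mul_subset_right f ξ).trans
      ((subset_tsupport ξ).trans (hξs.trans Ioo_subset_Ioc_self))
  have hIoo : EqOn f 0 (Ioo 0 π) := MeasureTheory.Measure.eqOn_open_of_ae_eq
    ((MeasureTheory.ae_restrict_iff' measurableSet_Ioo).2 hae) isOpen_Ioo hf.continuousOn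
    continuousOn_const
  rw [← closure_Ioo pi_pos.ne]
  exact hIoo.closure hf continuous_const

theorem exists_eqOn_const_of_integral_mul_deriv {f : ℝ → ℝ} (hf : Continuous f)
    (h : ∀ η, IsTestFunction η → ∫ x in (0 : ℝ)..π, f x * deriv η x = 0) :
    ∃ d, ∀ x ∈ Icc 0 π, f x = d := by
  obtain ⟨d, hd⟩ := exists_eq_const_mul_integral (L := fun ξ => ∫ x in (0 : ℝ)..π, f x * ξ x)
    (fun ξ ρ c hξ hρ =>
      integral_mul_sub_const_mul hf hξ.continuous hρ.continuous 0 π c) h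
  have hzero := eqOn_Icc_zero_of_integral_mul (hf.sub continuous_const) (f := fun x => f x - d)
    fun ξ hξ => by
      have hsub := integral_mul_sub_const_mul hξ.continuous hf
        (continuous_const (y := (1 : ℝ))) 0 π d
      simp only [mul_one, one_mul, mul_comm (ξ _)] at hsub
      rw [hsub, hd ξ hξ, sub_self]
  exact ⟨d, fun x hx => sub_eq_zero.1 (hzero hx)⟩

theorem exists_eqOn_affine_of_integral_mul_iteratedDeriv_two {w : ℝ → ℝ} (hw : Continuous w)
    (h : ∀ η, IsTestFunction η → ∫ x in (0 : ℝ)..π, w x * iteratedDeriv 2 η x = 0) :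
    ∃ c d, ∀ x ∈ Icc 0 π, w x = c * x + d := by
  have hderiv_sub (ξ ρ : ℝ → ℝ) (c : ℝ) (hξ : IsTestFunction ξ) (hρ : IsTestFunction ρ) :
      deriv (fun x => ξ x - c * ρ x) = fun x => deriv ξ x - c * deriv ρ x :=
    funext fun x => ((hξ.hasDerivAt x).sub ((hρ.hasDerivAt x).const_mul c)).deriv
  obtain ⟨c, hc⟩ := exists_eq_const_mul_integral
    (L := fun ξ => ∫ x in (0 : ℝ)..π, w x * deriv ξ x)
    (fun ξ ρ c hξ hρ => by
      simp only [hderiv_sub ξ ρ c hξ hρ]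
      exact integral_mul_sub_const_mul hw hξ.deriv.continuous hρ.deriv.continuous 0 π c)
    (fun η hη => by simpa only [iteratedDeriv_succ, iteratedDeriv_zero] using h η hη)
  have hcx (η : ℝ → ℝ) (hη : IsTestFunction η) :
      ∫ x in (0 : ℝ)..π, x * deriv η x = -∫ x in (0 : ℝ)..π, η x := by
    rw [intervalIntegral.integral_mul_deriv_eq_deriv_mul (u' := fun _ => 1)
      (fun x _ => hasDerivAt_id' x) (fun x _ => hη.hasDerivAt x)
      (continuous_const.intervalIntegrable _ _) (hη.deriv.continuous.intervalIntegrable _ _),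
      hη.apply_zero, hη.apply_pi]
    simp only [mul_zero, sub_zero, zero_sub, one_mul]
  obtain ⟨d, hd⟩ := exists_eqOn_const_of_integral_mul_deriv (f := fun x => w x - (-c) * x)
    (by fun_prop) fun η hη => by
      have hsub := integral_mul_sub_const_mul hη.deriv.continuous hw
        continuous_id' 0 π (-c)
      simp only [mul_comm (deriv η _)] at hsub
      rw [hsub, hc η hη, hcx η hη]
      ring
  exact ⟨-c, d, fun x hx => by linarith [hd x hx]⟩

theorem eqOn_zero_of_integral_mul_iteratedDeriv_two {w : ℝ → ℝ} (hw : Continuous w) (h0 : w 0 = 0)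
    (hpi : w π = 0)
    (h : ∀ η, IsTestFunction η → ∫ x in (0 : ℝ)..π, w x * iteratedDeriv 2 η x = 0) :
    EqOn w 0 (Icc 0 π) := by
  obtain ⟨c, d, hcd⟩ := exists_eqOn_affine_of_integral_mul_iteratedDeriv_two hw h
  have hd : d = 0 := by simpa [h0] using (hcd 0 ⟨le_rfl, pi_pos.le⟩).symm
  have hc : c = 0 := by simpa [hpi, hd, pi_ne_zero] using hcd π ⟨pi_pos.le, le_rfl⟩
  exact fun x hx => by simpa [hc, hd] using hcd x hx

theorem eq_zero_of_hasSum_mul_sineCoeff {g : ℕ+ → ℝ}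
    (hg : Summable fun j : ℕ+ => |g j / (j : ℝ) ^ 2|)
    (h : ∀ η, IsTestFunction η → HasSum (fun j => g j * sineCoeff η j) 0) (j : ℕ+) : g j = 0 := by
  have hne (k : ℕ+) : (k : ℝ) ^ 2 ≠ 0 := pow_ne_zero 2 (ne_of_gt (pnat_cast_pos k))
  -- The series `∑ g_j φ_j` only exists as a distribution; `w` is its second antiderivative.
  set w := sineSeries fun j => g j / (j : ℝ) ^ 2 with hw_def
  have hw : EqOn w 0 (Icc 0 π) := by
    refine eqOn_zero_of_integral_mul_iteratedDeriv_two (continuous_sineSeries hg)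
      (sineSeries_zero _) (sineSeries_pi _) fun η hη => ?_
    refine (hasSum_integral_series_mul pi_pos.le continuous_phi abs_phi_le hg
      hη.iteratedDeriv_two.continuous fun x _ => hasSum_sineSeries hg x).unique ?_
    refine (neg_zero (G := ℝ) ▸ (h η hη).neg).congr_fun fun k => ?_
    have hcoeff := hη.sineCoeff_iteratedDeriv_two k
    simp only [sineCoeff, mul_comm (iteratedDeriv 2 η _)] at hcoeff
    have := hne k
    rw [hcoeff, sineCoeff]
    field_simp
  have hcoeff : sineCoeff w j = 0 := by
    refine (intervalIntegral.integral_congr_Ioo_of_le pi_pos.le fun x hx => ?_).trans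
      intervalIntegral.integral_zero
    simp [hw (Ioo_subset_Icc_self hx)]
  rw [hw_def, sineCoeff_sineSeries hg] at hcoeff
  exact (div_eq_zero_iff.1 hcoeff).resolve_right (hne j)

end DuBoisReymond

/-! ### Quartic corrections -/

section Corrections

/-- For the flow `u' = α p, p' = -α u` and a second oscillator `(v, q)` of frequency `β ≠ α`, the
polynomial with derivative `u p v²`. -/
def pairCorrection (α β u p v q : ℝ) : ℝ :=
  ((v ^ 2 + q ^ 2) * (u ^ 2 - p ^ 2) * (1 / (2 * α))
    + (α * (u ^ 2 - p ^ 2) * (v ^ 2 - q ^ 2) + β * (2 * u * p) * (2 * v * q))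
      * (1 / (2 * (α ^ 2 - β ^ 2)))) / 4

/-- For the flow `u' = α p, p' = -α u`, a polynomial with derivative `u³ p`. -/
def selfCorrection (α u p : ℝ) : ℝ :=
  ((u ^ 2 + p ^ 2) * (u ^ 2 - p ^ 2) * (1 / (2 * α)) + (u ^ 2 - p ^ 2) ^ 2 * (1 / (4 * α))) / 4

/-- What the perturbations `-γ u` and `-γ' v` of the two oscillator equations contribute to the
derivative of `pairCorrection`. -/
def pairRemainder (α β γ γ' u p v q : ℝ) : ℝ :=
  (((v ^ 2 + q ^ 2) * (γ * (2 * u * p)) - γ' * (2 * v * q) * (u ^ 2 - p ^ 2)) * (1 / (2 * α))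
    + (α * (γ * (2 * u * p)) * (v ^ 2 - q ^ 2) + α * (u ^ 2 - p ^ 2) * (γ' * (2 * v * q))
      - β * (γ * (2 * u ^ 2)) * (2 * v * q) - β * (2 * u * p) * (γ' * (2 * v ^ 2)))
      * (1 / (2 * (α ^ 2 - β ^ 2)))) / 4

/-- What the perturbation `-γ u` of the oscillator equation contributes to the derivative of
`selfCorrection`. -/
def selfRemainder (α γ u p : ℝ) : ℝ :=
  ((u ^ 2 + p ^ 2) * (γ * (2 * u * p))) * (1 / (2 * α)) / 4

section Bounds

variable {α β γ γ' μ : ℝ}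

theorem norm_sq_sub_sq_le (u p : ℝ) : ‖u ^ 2 - p ^ 2‖ ≤ u ^ 2 + p ^ 2 := by
  rw [Real.norm_eq_abs, abs_le]
  constructor <;> nlinarith [sq_nonneg u, sq_nonneg p]

theorem norm_two_mul_mul_le (u p : ℝ) : ‖2 * u * p‖ ≤ u ^ 2 + p ^ 2 := by
  rw [Real.norm_eq_abs, abs_le]
  constructor <;> nlinarith [sq_nonneg (u - p), sq_nonneg (u + p)]

theorem norm_two_mul_sq_le (u p : ℝ) : ‖2 * u ^ 2‖ ≤ 2 * (u ^ 2 + p ^ 2) := by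
  rw [Real.norm_of_nonneg (by positivity)]
  nlinarith [sq_nonneg p]

theorem norm_one_div_two_mul_le (hμ : 0 < μ) (hα : μ ≤ 2 * α) : ‖1 / (2 * α)‖ ≤ 1 / μ := by
  rw [Real.norm_of_nonneg (one_div_nonneg.2 (hμ.le.trans hα))]
  exact one_div_le_one_div_of_le hμ hα

theorem sq_sub_sq_ne_zero (hμ : 0 < μ) (hα : 0 < α) (hβ : 0 < β) (hgap : μ / 2 ≤ |α - β|) :
    α ^ 2 - β ^ 2 ≠ 0 := by
  rw [sq_sub_sq]
  exact mul_ne_zero (by positivity) (abs_pos.1 ((half_pos hμ).trans_le hgap))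

theorem norm_one_div_two_mul_sq_sub_sq_le (hμ : 0 < μ) (hα : 0 < α) (hβ : 0 < β)
    (hgap : μ / 2 ≤ |α - β|) : ‖1 / (2 * (α ^ 2 - β ^ 2))‖ ≤ 1 / (μ * (α + β)) := by
  have hsum : 0 < α + β := add_pos hα hβ
  rw [Real.norm_eq_abs, sq_sub_sq, abs_div, abs_mul, abs_mul, abs_one, abs_two, abs_of_pos hsum]
  refine one_div_le_one_div_of_le (by positivity) ?_
  calc μ * (α + β) = 2 * ((α + β) * (μ / 2)) := by ring
    _ ≤ 2 * ((α + β) * |α - β|) := by gcongr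

theorem norm_pairCorrection_le (hμ : 0 < μ) (hα : μ ≤ 2 * α) (hβ : μ ≤ 2 * β)
    (hgap : μ / 2 ≤ |α - β|) (u p v q : ℝ) :
    ‖pairCorrection α β u p v q‖ ≤ 1 / (2 * μ) * ((u ^ 2 + p ^ 2) * (v ^ 2 + q ^ 2)) := by
  have hα₀ : 0 < α := by linarith
  have hβ₀ : 0 < β := by linarith
  set A := u ^ 2 + p ^ 2
  set B := v ^ 2 + q ^ 2 with hB
  have hX : ‖u ^ 2 - p ^ 2‖ ≤ A := norm_sq_sub_sq_le u p
  have hX' : ‖v ^ 2 - q ^ 2‖ ≤ B := norm_sq_sub_sq_le v q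
  have hY : ‖2 * u * p‖ ≤ A := norm_two_mul_mul_le u p
  have hY' : ‖2 * v * q‖ ≤ B := norm_two_mul_mul_le v q
  have hnα : ‖α‖ ≤ α := (Real.norm_of_nonneg hα₀.le).le
  have hnβ : ‖β‖ ≤ β := (Real.norm_of_nonneg hβ₀.le).le
  have hnB : ‖B‖ ≤ B := (Real.norm_of_nonneg (by positivity)).le
  have h : ‖pairCorrection α β u p v q‖
      ≤ (B * A * (1 / μ) + (α * A * B + β * A * B) * (1 / (μ * (α + β)))) / 4 := by
    rw [pairCorrection, norm_div, Real.norm_of_nonneg (zero_le_four (α := ℝ)), ← hB]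
    exact div_le_div_of_nonneg_right (norm_add_le_of_le
      (norm_mul_le_of_le (norm_mul_le_of_le hnB hX) (norm_one_div_two_mul_le hμ hα))
      (norm_mul_le_of_le (norm_add_le_of_le (norm_mul_le_of_le (norm_mul_le_of_le hnα hX) hX')
        (norm_mul_le_of_le (norm_mul_le_of_le hnβ hY) hY'))
        (norm_one_div_two_mul_sq_sub_sq_le hμ hα₀ hβ₀ hgap))) zero_le_four
  refine h.trans_eq ?_
  field_simp
  ring

theorem norm_selfCorrection_le (hμ : 0 < μ) (hα : μ ≤ 2 * α) (u p : ℝ) :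
    ‖selfCorrection α u p‖ ≤ 1 / (2 * μ) * ((u ^ 2 + p ^ 2) * (u ^ 2 + p ^ 2)) := by
  set A := u ^ 2 + p ^ 2 with hA
  have hX : ‖u ^ 2 - p ^ 2‖ ≤ A := norm_sq_sub_sq_le u p
  have hnA : ‖A‖ ≤ A := (Real.norm_of_nonneg (by positivity)).le
  have hα' : μ ≤ 2 * (2 * α) := by linarith
  have h : ‖selfCorrection α u p‖ ≤ (A * A * (1 / μ) + A * A * (1 / μ)) / 4 := by
    rw [selfCorrection, norm_div, Real.norm_of_nonneg (zero_le_four (α := ℝ)), ← hA, sq (_ - _),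
      show 4 * α = 2 * (2 * α) by ring]
    exact div_le_div_of_nonneg_right (norm_add_le_of_le
      (norm_mul_le_of_le (norm_mul_le_of_le hnA hX) (norm_one_div_two_mul_le hμ hα))
      (norm_mul_le_of_le (norm_mul_le_of_le hX hX) (norm_one_div_two_mul_le hμ hα'))) zero_le_four
  refine h.trans_eq ?_
  field_simp
  ring

theorem norm_pairRemainder_le (hμ : 0 < μ) (hα : μ ≤ 2 * α) (hβ : μ ≤ 2 * β)
    (hgap : μ / 2 ≤ |α - β|) (hγ : 0 ≤ γ) (hγ' : 0 ≤ γ') (u p v q : ℝ) :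
    ‖pairRemainder α β γ γ' u p v q‖
      ≤ (γ + γ') / μ * ((u ^ 2 + p ^ 2) * (v ^ 2 + q ^ 2)) := by
  have hα₀ : 0 < α := by linarith
  have hβ₀ : 0 < β := by linarith
  set A := u ^ 2 + p ^ 2
  set B := v ^ 2 + q ^ 2 with hB
  have hX : ‖u ^ 2 - p ^ 2‖ ≤ A := norm_sq_sub_sq_le u p
  have hX' : ‖v ^ 2 - q ^ 2‖ ≤ B := norm_sq_sub_sq_le v q
  have hnα : ‖α‖ ≤ α := (Real.norm_of_nonneg hα₀.le).le
  have hnβ : ‖β‖ ≤ β := (Real.norm_of_nonneg hβ₀.le).le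
  have hnγ : ‖γ‖ ≤ γ := (Real.norm_of_nonneg hγ).le
  have hnγ' : ‖γ'‖ ≤ γ' := (Real.norm_of_nonneg hγ').le
  have hY : ‖2 * u * p‖ ≤ A := norm_two_mul_mul_le u p
  have hY' : ‖2 * v * q‖ ≤ B := norm_two_mul_mul_le v q
  have hγY : ‖γ * (2 * u * p)‖ ≤ γ * A := norm_mul_le_of_le hnγ hY
  have hγY' : ‖γ' * (2 * v * q)‖ ≤ γ' * B := norm_mul_le_of_le hnγ' hY'
  have hγZ : ‖γ * (2 * u ^ 2)‖ ≤ γ * (2 * A) := norm_mul_le_of_le hnγ (norm_two_mul_sq_le u p)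
  have hγZ' : ‖γ' * (2 * v ^ 2)‖ ≤ γ' * (2 * B) := norm_mul_le_of_le hnγ' (norm_two_mul_sq_le v q)
  have hnB : ‖B‖ ≤ B := (Real.norm_of_nonneg (by positivity)).le
  have h : ‖pairRemainder α β γ γ' u p v q‖ ≤ ((B * (γ * A) + γ' * B * A) * (1 / μ)
      + (α * (γ * A) * B + α * A * (γ' * B) + β * (γ * (2 * A)) * B + β * A * (γ' * (2 * B)))
        * (1 / (μ * (α + β)))) / 4 := by
    rw [pairRemainder, norm_div, Real.norm_of_nonneg (zero_le_four (α := ℝ)), ← hB]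
    refine div_le_div_of_nonneg_right (norm_add_le_of_le (norm_mul_le_of_le (norm_sub_le_of_le
      (norm_mul_le_of_le hnB hγY) (norm_mul_le_of_le hγY' hX)) (norm_one_div_two_mul_le hμ hα))
      (norm_mul_le_of_le ?_ (norm_one_div_two_mul_sq_sub_sq_le hμ hα₀ hβ₀ hgap))) zero_le_four
    exact norm_sub_le_of_le (norm_sub_le_of_le (norm_add_le_of_le
      (norm_mul_le_of_le (norm_mul_le_of_le hnα hγY) hX')
      (norm_mul_le_of_le (norm_mul_le_of_le hnα hX) hγY'))
      (norm_mul_le_of_le (norm_mul_le_of_le hnβ hγZ) hY'))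
      (norm_mul_le_of_le (norm_mul_le_of_le hnβ hY) hγZ')
  have hrest : 0 ≤ (γ + γ') * (A * B) * (2 * α + β) := by positivity
  refine h.trans ?_
  field_simp
  linarith

theorem norm_selfRemainder_le (hμ : 0 < μ) (hα : μ ≤ 2 * α) (hγ : 0 ≤ γ) (u p : ℝ) :
    ‖selfRemainder α γ u p‖ ≤ (γ + γ) / μ * ((u ^ 2 + p ^ 2) * (u ^ 2 + p ^ 2)) := by
  set A := u ^ 2 + p ^ 2 with hA
  have hnA : ‖A‖ ≤ A := (Real.norm_of_nonneg (by positivity)).le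
  have hγY : ‖γ * (2 * u * p)‖ ≤ γ * A :=
    norm_mul_le_of_le (Real.norm_of_nonneg hγ).le (norm_two_mul_mul_le u p)
  have h : ‖selfRemainder α γ u p‖ ≤ A * (γ * A) * (1 / μ) / 4 := by
    rw [selfRemainder, norm_div, Real.norm_of_nonneg (zero_le_four (α := ℝ)), ← hA]
    exact div_le_div_of_nonneg_right (norm_mul_le_of_le (norm_mul_le_of_le hnA hγY)
      (norm_one_div_two_mul_le hμ hα)) zero_le_four
  have hrest : 0 ≤ γ * (A * A) := by positivity
  refine h.trans ?_
  field_simp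
  linarith

end Bounds

section Derivatives

variable {u p v q : ℝ → ℝ} {α β γ γ' t : ℝ}

theorem hasDerivAt_sq_sub_sq (hu : HasDerivAt u (α * p t) t)
    (hp : HasDerivAt p (-(α * u t) - γ * u t) t) :
    HasDerivAt (fun t => u t ^ 2 - p t ^ 2) (2 * α * (2 * u t * p t) + γ * (2 * u t * p t)) t :=
  ((hu.pow 2).sub (hp.pow 2)).congr_deriv (by push_cast; ring)

theorem hasDerivAt_sq_add_sq (hu : HasDerivAt u (α * p t) t)
    (hp : HasDerivAt p (-(α * u t) - γ * u t) t) :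
    HasDerivAt (fun t => u t ^ 2 + p t ^ 2) (-γ * (2 * u t * p t)) t :=
  ((hu.pow 2).add (hp.pow 2)).congr_deriv (by push_cast; ring)

theorem hasDerivAt_two_mul_mul (hu : HasDerivAt u (α * p t) t)
    (hp : HasDerivAt p (-(α * u t) - γ * u t) t) :
    HasDerivAt (fun t => 2 * u t * p t) (-2 * α * (u t ^ 2 - p t ^ 2) - γ * (2 * u t ^ 2)) t :=
  ((hu.const_mul 2).mul hp).congr_deriv (by ring)

theorem hasDerivAt_pairCorrection (hα : α ≠ 0) (hαβ : α ^ 2 - β ^ 2 ≠ 0)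
    (hu : HasDerivAt u (α * p t) t) (hp : HasDerivAt p (-(α * u t) - γ * u t) t)
    (hv : HasDerivAt v (β * q t) t) (hq : HasDerivAt q (-(β * v t) - γ' * v t) t) :
    HasDerivAt (fun t => pairCorrection α β (u t) (p t) (v t) (q t))
      (u t * p t * v t ^ 2 + pairRemainder α β γ γ' (u t) (p t) (v t) (q t)) t := by
  have hX := hasDerivAt_sq_sub_sq hu hp
  have hX' := hasDerivAt_sq_sub_sq hv hq
  have hY := hasDerivAt_two_mul_mul hu hp
  have hY' := hasDerivAt_two_mul_mul hv hq
  refine (((((hasDerivAt_sq_add_sq hv hq).mul hX).mul_const (1 / (2 * α))).add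
    ((((hX.const_mul α).mul hX').add ((hY.const_mul β).mul hY')).mul_const
      (1 / (2 * (α ^ 2 - β ^ 2))))).div_const 4).congr_deriv ?_
  rw [pairRemainder]
  field_simp
  ring

theorem hasDerivAt_selfCorrection (hα : α ≠ 0)
    (hu : HasDerivAt u (α * p t) t) (hp : HasDerivAt p (-(α * u t) - γ * u t) t) :
    HasDerivAt (fun t => selfCorrection α (u t) (p t))
      (u t * p t * u t ^ 2 + selfRemainder α γ (u t) (p t)) t := by
  have hX := hasDerivAt_sq_sub_sq hu hp
  refine (((((hasDerivAt_sq_add_sq hu hp).mul hX).mul_const (1 / (2 * α))).add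
    ((hX.pow 2).mul_const (1 / (4 * α)))).div_const 4).congr_deriv ?_
  rw [selfRemainder]
  push_cast
  field_simp
  ring

end Derivatives

end Corrections

/-! ### Energy growth for coupled oscillators -/

section Growth

variable {ι : Type*}

/-- Oscillators of frequencies `ω j ≥ μ / 2` and mutual gaps at least `μ / 2`, the `j`-th of them
stiffened by `σ r_j ∑ b_k u_k²`, together with the weights `W` of the energy to be controlled. The
`b_k` are negligible against `W_k` outside finite sets. -/
structure OscillatorSystem (ι : Type*) where
  ω : ι → ℝ
  r : ι → ℝ
  b : ι → ℝ
  W : ι → ℝ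
  σ : ℝ
  ρ : ℝ
  μ : ℝ
  sigma_nonneg : 0 ≤ σ
  rho_nonneg : 0 ≤ ρ
  mu_pos : 0 < μ
  b_nonneg : ∀ j, 0 ≤ b j
  b_le : ∀ j, b j ≤ W j
  r_nonneg : ∀ j, 0 ≤ r j
  r_le : ∀ j, r j ≤ ρ
  freq : ∀ j, μ ≤ 2 * ω j
  gap : ∀ j k, j ≠ k → μ / 2 ≤ |ω j - ω k|
  tail : ∀ δ > 0, ∃ F : Finset ι, ∀ k ∉ F, b k ≤ δ * W k

namespace OscillatorSystem

variable (S : OscillatorSystem ι)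

/-- The weighted energy `∑ W_j (u_j² + p_j²)`; meaningful when `S.FiniteEnergy u p`. -/
def energy (u p : ι → ℝ) : ℝ := ∑' j, S.W j * (u j ^ 2 + p j ^ 2)

/-- The series of `S.energy u p` converges. -/
def FiniteEnergy (u p : ι → ℝ) : Prop := Summable fun j => S.W j * (u j ^ 2 + p j ^ 2)

/-- The scalar `∑ b_k u_k²` through which the oscillators interact. -/
def coupling (u : ι → ℝ) : ℝ := ∑' k, S.b k * u k ^ 2

/-- A motion of the system at the times in `I`. The equations are only required where the energy
is at most `A`, so that solutions of an equation truncated at high energy qualify. -/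
structure IsMotion (A : ℝ) (I : Set ℝ) (u p : ℝ → ι → ℝ) : Prop where
  finiteEnergy : ∀ t ∈ I, S.FiniteEnergy (u t) (p t)
  hasDerivAt_fst : ∀ t ∈ I, S.energy (u t) (p t) ≤ A →
    ∀ j, HasDerivAt (fun t => u t j) (S.ω j * p t j) t
  hasDerivAt_snd : ∀ t ∈ I, S.energy (u t) (p t) ≤ A → ∀ j,
    HasDerivAt (fun t => p t j) (-(S.ω j * u t j) - S.σ * S.r j * S.coupling (u t) * u t j) t

open Classical in
/-- The quartic correction of one pair of modes. -/
def correction (u p : ι → ℝ) (j k : ι) : ℝ :=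
  if j = k then selfCorrection (S.ω j) (u j) (p j)
  else pairCorrection (S.ω j) (S.ω k) (u j) (p j) (u k) (p k)

/-- The energy of the modes in `F`, corrected so that its growth is of sixth order up to the
influence of the modes outside `F`. -/
def correctedEnergy (F : Finset ι) (u p : ι → ℝ) : ℝ :=
  ∑ j ∈ F, S.W j * (u j ^ 2 + p j ^ 2)
    + 2 * S.σ * ∑ j ∈ F, ∑ k ∈ F, S.W j * S.r j * S.b k * S.correction u p j k

theorem W_nonneg (j : ι) : 0 ≤ S.W j := (S.b_nonneg j).trans (S.b_le j)

theorem omega_pos (j : ι) : 0 < S.ω j := by linarith [S.mu_pos, S.freq j]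

theorem W_mul_nonneg (u p : ι → ℝ) (j : ι) : 0 ≤ S.W j * (u j ^ 2 + p j ^ 2) :=
  mul_nonneg (S.W_nonneg j) (by positivity)

theorem b_mul_sq_nonneg (u : ι → ℝ) (j : ι) : 0 ≤ S.b j * u j ^ 2 :=
  mul_nonneg (S.b_nonneg j) (sq_nonneg _)

theorem b_mul_sq_le (u p : ι → ℝ) (j : ι) : S.b j * u j ^ 2 ≤ S.W j * (u j ^ 2 + p j ^ 2) :=
  mul_le_mul (S.b_le j) (le_add_of_nonneg_right (sq_nonneg _)) (sq_nonneg _) (S.W_nonneg j)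

theorem energy_nonneg (u p : ι → ℝ) : 0 ≤ S.energy u p := tsum_nonneg (S.W_mul_nonneg u p)

theorem coupling_nonneg (u : ι → ℝ) : 0 ≤ S.coupling u := tsum_nonneg (S.b_mul_sq_nonneg u)

theorem energy_neg (u p : ι → ℝ) : S.energy u (-p) = S.energy u p := by
  simp only [energy, Pi.neg_apply, neg_sq]

theorem finiteEnergy_neg (u p : ι → ℝ) : S.FiniteEnergy u (-p) ↔ S.FiniteEnergy u p := by
  simp only [FiniteEnergy, Pi.neg_apply, neg_sq]

theorem norm_correction_le (u p : ι → ℝ) (j k : ι) :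
    ‖S.correction u p j k‖ ≤ 1 / (2 * S.μ) * ((u j ^ 2 + p j ^ 2) * (u k ^ 2 + p k ^ 2)) := by
  rw [correction]
  split_ifs with hjk
  · subst hjk
    exact norm_selfCorrection_le S.mu_pos (S.freq j) _ _
  · exact norm_pairCorrection_le S.mu_pos (S.freq j) (S.freq k) (S.gap j k hjk) _ _ _ _

section FiniteEnergy

variable {S} {u p : ι → ℝ} {A : ℝ}

theorem FiniteEnergy.summable_coupling (hE : S.FiniteEnergy u p) :
    Summable fun j => S.b j * u j ^ 2 :=
  .of_nonneg_of_le (S.b_mul_sq_nonneg u) (S.b_mul_sq_le u p) hE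

theorem FiniteEnergy.coupling_le (hE : S.FiniteEnergy u p) : S.coupling u ≤ S.energy u p :=
  hE.summable_coupling.tsum_le_tsum (S.b_mul_sq_le u p) hE

theorem FiniteEnergy.sum_le (hE : S.FiniteEnergy u p) (F : Finset ι) :
    ∑ j ∈ F, S.W j * (u j ^ 2 + p j ^ 2) ≤ S.energy u p :=
  hE.sum_le_tsum F fun j _ => S.W_mul_nonneg u p j

theorem FiniteEnergy.sum_sum_le (hE : S.FiniteEnergy u p) (hA : S.energy u p ≤ A)
    (F : Finset ι) :
    ∑ j ∈ F, ∑ k ∈ F, S.W j * S.r j * S.b k * ((u j ^ 2 + p j ^ 2) * (u k ^ 2 + p k ^ 2))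
      ≤ S.ρ * A ^ 2 := by
  have hterm : ∀ j k, S.W j * S.r j * S.b k * ((u j ^ 2 + p j ^ 2) * (u k ^ 2 + p k ^ 2))
      ≤ S.ρ * ((S.W j * (u j ^ 2 + p j ^ 2)) * (S.W k * (u k ^ 2 + p k ^ 2))) := fun j k => by
    have hW := S.W_nonneg j
    have hb := S.b_nonneg k
    have hρ := S.rho_nonneg
    calc _ ≤ S.W j * S.ρ * S.W k * ((u j ^ 2 + p j ^ 2) * (u k ^ 2 + p k ^ 2)) := by
          gcongr
          exacts [S.r_le j, S.b_le k]
      _ = _ := by ring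
  have hF : (∑ j ∈ F, S.W j * (u j ^ 2 + p j ^ 2)) ^ 2 ≤ A ^ 2 :=
    pow_le_pow_left₀ (Finset.sum_nonneg fun j _ => S.W_mul_nonneg u p j) ((hE.sum_le F).trans hA) 2
  calc _ ≤ ∑ j ∈ F, ∑ k ∈ F,
          S.ρ * ((S.W j * (u j ^ 2 + p j ^ 2)) * (S.W k * (u k ^ 2 + p k ^ 2))) :=
        Finset.sum_le_sum fun j _ => Finset.sum_le_sum fun k _ => hterm j k
    _ = S.ρ * (∑ j ∈ F, S.W j * (u j ^ 2 + p j ^ 2)) ^ 2 := by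
        simp_rw [sq (Finset.sum F _), Finset.sum_mul_sum, Finset.mul_sum]
    _ ≤ _ := mul_le_mul_of_nonneg_left hF S.rho_nonneg

theorem FiniteEnergy.abs_sum_sum_mul_le (hE : S.FiniteEnergy u p) (hA : S.energy u p ≤ A)
    (F : Finset ι) {x : ι → ι → ℝ} {c : ℝ} (hc : 0 ≤ c)
    (hx : ∀ j k, |x j k| ≤ c * ((u j ^ 2 + p j ^ 2) * (u k ^ 2 + p k ^ 2))) :
    |∑ j ∈ F, ∑ k ∈ F, S.W j * S.r j * S.b k * x j k| ≤ c * (S.ρ * A ^ 2) := by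
  have hcoeff : ∀ j k, 0 ≤ S.W j * S.r j * S.b k := fun j k =>
    mul_nonneg (mul_nonneg (S.W_nonneg j) (S.r_nonneg j)) (S.b_nonneg k)
  calc _ ≤ ∑ j ∈ F, ∑ k ∈ F, |S.W j * S.r j * S.b k * x j k| :=
        (Finset.abs_sum_le_sum_abs _ _).trans
          (Finset.sum_le_sum fun j _ => Finset.abs_sum_le_sum_abs _ _)
    _ ≤ ∑ j ∈ F, ∑ k ∈ F,
          c * (S.W j * S.r j * S.b k * ((u j ^ 2 + p j ^ 2) * (u k ^ 2 + p k ^ 2))) := by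
        refine Finset.sum_le_sum fun j _ => Finset.sum_le_sum fun k _ => ?_
        rw [abs_mul, abs_of_nonneg (hcoeff j k), mul_left_comm c]
        exact mul_le_mul_of_nonneg_left (hx j k) (hcoeff j k)
    _ ≤ _ := by
        simp_rw [← Finset.mul_sum]
        exact mul_le_mul_of_nonneg_left (hE.sum_sum_le hA F) hc

theorem FiniteEnergy.abs_correctedEnergy_sub_le (hE : S.FiniteEnergy u p)
    (hA : S.energy u p ≤ A) (F : Finset ι) :
    |S.correctedEnergy F u p - ∑ j ∈ F, S.W j * (u j ^ 2 + p j ^ 2)|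
      ≤ S.σ * S.ρ * A ^ 2 / S.μ := by
  have hσ := S.sigma_nonneg
  have hμ := S.mu_pos
  rw [correctedEnergy, add_sub_cancel_left, abs_mul, abs_of_nonneg (by positivity)]
  calc _ ≤ 2 * S.σ * (1 / (2 * S.μ) * (S.ρ * A ^ 2)) := by
        gcongr
        exact hE.abs_sum_sum_mul_le hA F (by positivity) (S.norm_correction_le u p)
    _ = _ := by field_simp

theorem FiniteEnergy.abs_sum_mul_le (hE : S.FiniteEnergy u p) (hA : S.energy u p ≤ A)
    (F : Finset ι) : |∑ j ∈ F, S.W j * S.r j * (u j * p j)| ≤ S.ρ * A / 2 := by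
  calc _ ≤ ∑ j ∈ F, |S.W j * S.r j * (u j * p j)| := Finset.abs_sum_le_sum_abs _ _
    _ ≤ ∑ j ∈ F, S.ρ / 2 * (S.W j * (u j ^ 2 + p j ^ 2)) := by
        refine Finset.sum_le_sum fun j _ => ?_
        have hW := S.W_nonneg j
        have hr := S.r_nonneg j
        have hup : |u j * p j| ≤ (u j ^ 2 + p j ^ 2) / 2 := by
          have := norm_two_mul_mul_le (u j) (p j)
          rw [mul_assoc, norm_mul, Real.norm_two] at this
          linarith [Real.norm_eq_abs (u j * p j)]
        rw [abs_mul, abs_of_nonneg (mul_nonneg hW hr)]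
        calc _ ≤ S.W j * S.ρ * ((u j ^ 2 + p j ^ 2) / 2) :=
              mul_le_mul (mul_le_mul_of_nonneg_left (S.r_le j) hW) hup (abs_nonneg _)
                (mul_nonneg hW S.rho_nonneg)
          _ = _ := by ring
    _ ≤ S.ρ / 2 * A := by
        have hρ := S.rho_nonneg
        rw [← Finset.mul_sum]
        exact mul_le_mul_of_nonneg_left ((hE.sum_le F).trans hA) (by positivity)
    _ = _ := by ring

theorem FiniteEnergy.coupling_sub_sum_mem_Icc (hE : S.FiniteEnergy u p) (hA : S.energy u p ≤ A)
    {F : Finset ι} {δ : ℝ} (hδ : 0 ≤ δ) (hF : ∀ k ∉ F, S.b k ≤ δ * S.W k) :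
    S.coupling u - ∑ k ∈ F, S.b k * u k ^ 2 ∈ Icc 0 (δ * A) := by
  have hsplit : S.coupling u - ∑ k ∈ F, S.b k * u k ^ 2
      = ∑' k : {k // k ∉ F}, S.b k * u k ^ 2 :=
    sub_eq_of_eq_add' (hE.summable_coupling.sum_add_tsum_subtype_compl F).symm
  rw [hsplit]
  refine ⟨tsum_nonneg fun k => S.b_mul_sq_nonneg u k, ?_⟩
  calc _ ≤ ∑' k : {k // k ∉ F}, δ * (S.W k * (u k ^ 2 + p k ^ 2)) := by
        refine (hE.summable_coupling.subtype _).tsum_le_tsum (fun k => ?_)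
          ((hE.mul_left δ).subtype _)
        rw [← mul_assoc]
        exact mul_le_mul (hF k k.2) (le_add_of_nonneg_right (sq_nonneg _)) (sq_nonneg _)
          (mul_nonneg hδ (S.W_nonneg k))
    _ ≤ δ * A := by
        rw [tsum_mul_left]
        exact mul_le_mul_of_nonneg_left ((Summable.tsum_subtype_le _ {k | k ∉ F}
          (S.W_mul_nonneg u p) hE).trans hA) hδ

end FiniteEnergy

namespace IsMotion

variable {S} {u p : ℝ → ι → ℝ} {A T t : ℝ} {I : Set ℝ}

theorem mono (h : S.IsMotion A I u p) {J : Set ℝ} (hJI : J ⊆ I) : S.IsMotion A J u p where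
  finiteEnergy t ht := h.finiteEnergy t (hJI ht)
  hasDerivAt_fst t ht := h.hasDerivAt_fst t (hJI ht)
  hasDerivAt_snd t ht := h.hasDerivAt_snd t (hJI ht)

theorem comp_neg (h : S.IsMotion A I u p) :
    S.IsMotion A (Neg.neg ⁻¹' I) (fun t => u (-t)) fun t => -p (-t) where
  finiteEnergy t ht := (S.finiteEnergy_neg _ _).2 (h.finiteEnergy (-t) ht)
  hasDerivAt_fst t ht hA j := by
    rw [energy_neg] at hA
    exact ((h.hasDerivAt_fst (-t) ht hA j).scomp t (hasDerivAt_neg t)).congr_deriv (by simp)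
  hasDerivAt_snd t ht hA j := by
    rw [energy_neg] at hA
    exact ((h.hasDerivAt_snd (-t) ht hA j).scomp t (hasDerivAt_neg t)).neg.congr_deriv
      (by simp [sub_eq_add_neg])

theorem hasDerivAt_correction (h : S.IsMotion A I u p) (ht : t ∈ I)
    (hA : S.energy (u t) (p t) ≤ A) (j k : ι) :
    ∃ e, HasDerivAt (fun t => S.correction (u t) (p t) j k)
        (u t j * p t j * u t k ^ 2 + e) t ∧
      |e| ≤ 2 * (S.σ * S.ρ * A) / S.μ
        * ((u t j ^ 2 + p t j ^ 2) * (u t k ^ 2 + p t k ^ 2)) := by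
  have hμ := S.mu_pos
  set γ : ι → ℝ := fun j => S.σ * S.r j * S.coupling (u t)
  have hγ : ∀ j, 0 ≤ γ j := fun j =>
    mul_nonneg (mul_nonneg S.sigma_nonneg (S.r_nonneg j)) (S.coupling_nonneg _)
  have hγ_le : ∀ j, γ j ≤ S.σ * S.ρ * A := fun j =>
    mul_le_mul (mul_le_mul_of_nonneg_left (S.r_le j) S.sigma_nonneg)
      ((h.finiteEnergy t ht).coupling_le.trans hA) (S.coupling_nonneg _)
      (mul_nonneg S.sigma_nonneg S.rho_nonneg)
  have hu := h.hasDerivAt_fst t ht hA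
  have hp := h.hasDerivAt_snd t ht hA
  suffices key : ∃ e, HasDerivAt (fun t => S.correction (u t) (p t) j k)
      (u t j * p t j * u t k ^ 2 + e) t ∧
      |e| ≤ (γ j + γ k) / S.μ * ((u t j ^ 2 + p t j ^ 2) * (u t k ^ 2 + p t k ^ 2)) by
    obtain ⟨e, he, hle⟩ := key
    refine ⟨e, he, hle.trans ?_⟩
    gcongr
    linarith [hγ_le j, hγ_le k]
  unfold correction
  split_ifs with hjk
  · subst hjk
    exact ⟨_, hasDerivAt_selfCorrection (S.omega_pos j).ne' (hu j) (hp j),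
      norm_selfRemainder_le hμ (S.freq j) (hγ j) _ _⟩
  · exact ⟨_, hasDerivAt_pairCorrection (S.omega_pos j).ne'
      (sq_sub_sq_ne_zero hμ (S.omega_pos j) (S.omega_pos k) (S.gap j k hjk))
      (hu j) (hp j) (hu k) (hp k),
      norm_pairRemainder_le hμ (S.freq j) (S.freq k) (S.gap j k hjk) (hγ j) (hγ k) _ _ _ _⟩

theorem hasDerivAt_sum (h : S.IsMotion A I u p) (ht : t ∈ I)
    (hA : S.energy (u t) (p t) ≤ A) (F : Finset ι) :
    HasDerivAt (fun t => ∑ j ∈ F, S.W j * (u t j ^ 2 + p t j ^ 2))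
      (-(2 * S.σ * S.coupling (u t) * ∑ j ∈ F, S.W j * S.r j * (u t j * p t j))) t := by
  refine (HasDerivAt.fun_sum fun j _ => (hasDerivAt_sq_add_sq (h.hasDerivAt_fst t ht hA j)
    (h.hasDerivAt_snd t ht hA j)).const_mul (S.W j)).congr_deriv ?_
  rw [Finset.mul_sum, ← Finset.sum_neg_distrib]
  exact Finset.sum_congr rfl fun j _ => by ring

/-- The corrections cancel the fourth order part of the derivative of the energy inside `F`; what
is left are the sixth order remainders and the coupling to the modes outside `F`. -/
theorem hasDerivAt_correctedEnergy (h : S.IsMotion A I u p) (ht : t ∈ I)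
    (hA : S.energy (u t) (p t) ≤ A) {F : Finset ι} {δ : ℝ} (hδ : 0 ≤ δ)
    (hF : ∀ k ∉ F, S.b k ≤ δ * S.W k) :
    ∃ d, HasDerivAt (fun t => S.correctedEnergy F (u t) (p t)) d t ∧
      |d| ≤ 4 * (S.σ * S.ρ) ^ 2 * A ^ 3 / S.μ + S.σ * S.ρ * A ^ 2 * δ := by
  have hσ := S.sigma_nonneg
  have hρ := S.rho_nonneg
  have hμ := S.mu_pos
  have hE := h.finiteEnergy t ht
  have hA₀ : 0 ≤ A := (S.energy_nonneg _ _).trans hA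
  choose e he he_le using h.hasDerivAt_correction ht hA
  set P := ∑ j ∈ F, S.W j * S.r j * (u t j * p t j) with hP
  set B := ∑ k ∈ F, S.b k * u t k ^ 2 with hB
  set R := ∑ j ∈ F, ∑ k ∈ F, S.W j * S.r j * S.b k * e j k with hR
  have hcorr : HasDerivAt
      (fun t => ∑ j ∈ F, ∑ k ∈ F, S.W j * S.r j * S.b k * S.correction (u t) (p t) j k)
      (P * B + R) t := by
    refine (HasDerivAt.fun_sum fun j _ => HasDerivAt.fun_sum fun k _ =>
      (he j k).const_mul (S.W j * S.r j * S.b k)).congr_deriv ?_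
    simp_rw [hP, hB, hR, Finset.sum_mul_sum, ← Finset.sum_add_distrib]
    exact Finset.sum_congr rfl fun j _ => Finset.sum_congr rfl fun k _ => by ring
  refine ⟨2 * S.σ * R - 2 * S.σ * ((S.coupling (u t) - B) * P),
    ((h.hasDerivAt_sum ht hA F).add (hcorr.const_mul (2 * S.σ))).congr_deriv (by ring), ?_⟩
  have hR_le : |R| ≤ 2 * (S.σ * S.ρ * A) / S.μ * (S.ρ * A ^ 2) :=
    hE.abs_sum_sum_mul_le hA F (by positivity) he_le
  have hP_le : |P| ≤ S.ρ * A / 2 := hE.abs_sum_mul_le hA F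
  obtain ⟨hB₀, hB_le⟩ := hE.coupling_sub_sum_mem_Icc hA hδ hF
  have h2σ : |2 * S.σ| = 2 * S.σ := abs_of_nonneg (by positivity)
  refine (abs_sub _ _).trans ?_
  rw [abs_mul, abs_mul (2 * S.σ), abs_mul (_ - _), h2σ, abs_of_nonneg hB₀]
  calc _ ≤ 2 * S.σ * (2 * (S.σ * S.ρ * A) / S.μ * (S.ρ * A ^ 2))
        + 2 * S.σ * (δ * A * (S.ρ * A / 2)) := by gcongr
    _ = _ := by ring

theorem sum_le (h : S.IsMotion A (Icc 0 T) u p) (hT : 0 ≤ T)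
    (hA : ∀ t ∈ Icc 0 T, S.energy (u t) (p t) ≤ A) {F : Finset ι} {δ : ℝ}
    (hδ : 0 ≤ δ) (hF : ∀ k ∉ F, S.b k ≤ δ * S.W k) :
    ∑ j ∈ F, S.W j * (u T j ^ 2 + p T j ^ 2) ≤ S.energy (u 0) (p 0)
      + 2 * (S.σ * S.ρ * A ^ 2 / S.μ)
      + (4 * (S.σ * S.ρ) ^ 2 * A ^ 3 / S.μ + S.σ * S.ρ * A ^ 2 * δ) * T := by
  have hmem₀ : (0 : ℝ) ∈ Icc 0 T := left_mem_Icc.2 hT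
  have hmemT : T ∈ Icc 0 T := right_mem_Icc.2 hT
  have hder : ∀ t ∈ Icc 0 T, ∃ d, HasDerivAt (fun t => S.correctedEnergy F (u t) (p t)) d t ∧
      |d| ≤ 4 * (S.σ * S.ρ) ^ 2 * A ^ 3 / S.μ + S.σ * S.ρ * A ^ 2 * δ := fun t ht =>
    h.hasDerivAt_correctedEnergy ht (hA t ht) hδ hF
  choose! d hd hd_le using hder
  have hgrowth := norm_image_sub_le_of_norm_deriv_le_segment'
    (fun t ht => (hd t ht).hasDerivWithinAt) (fun t ht => hd_le t (Ico_subset_Icc_self ht)) T hmemT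
  rw [sub_zero, Real.norm_eq_abs] at hgrowth
  have h₀ := (h.finiteEnergy 0 hmem₀).abs_correctedEnergy_sub_le (hA 0 hmem₀) F
  have hT := (h.finiteEnergy T hmemT).abs_correctedEnergy_sub_le (hA T hmemT) F
  linarith [(abs_le.1 hgrowth).2, (abs_le.1 h₀).2, (abs_le.1 hT).1,
    (h.finiteEnergy 0 hmem₀).sum_le F]

theorem energy_le (h : S.IsMotion A (Icc 0 T) u p) (hT : 0 ≤ T)
    (hA : ∀ t ∈ Icc 0 T, S.energy (u t) (p t) ≤ A) :
    S.energy (u T) (p T) ≤ S.energy (u 0) (p 0)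
      + 2 * (S.σ * S.ρ * A ^ 2 / S.μ) + 4 * (S.σ * S.ρ) ^ 2 * A ^ 3 / S.μ * T := by
  classical
  have hσ := S.sigma_nonneg
  have hρ := S.rho_nonneg
  refine le_of_forall_pos_le_add fun ε hε => ?_
  set δ := ε / (S.σ * S.ρ * A ^ 2 * T + 1)
  have hδ : 0 < δ := by positivity
  obtain ⟨F, hF⟩ := S.tail δ hδ
  have hδε : S.σ * S.ρ * A ^ 2 * δ * T ≤ ε := by
    have : δ * (S.σ * S.ρ * A ^ 2 * T + 1) = ε := div_mul_cancel₀ _ (by positivity)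
    linarith
  refine Real.tsum_le_of_sum_le (S.W_mul_nonneg _ _) fun G => ?_
  have hmono : ∑ j ∈ G, S.W j * (u T j ^ 2 + p T j ^ 2)
      ≤ ∑ j ∈ G ∪ F, S.W j * (u T j ^ 2 + p T j ^ 2) :=
    Finset.sum_le_sum_of_subset_of_nonneg Finset.subset_union_left
      fun j _ _ => S.W_mul_nonneg _ _ j
  have hfinite := h.sum_le hT hA (F := G ∪ F) hδ.le
    fun k hk => hF k fun hkF => hk (Finset.mem_union_right _ hkF)
  linarith

end IsMotion

end OscillatorSystem

theorem forall_lt_of_continuousOn_of_bootstrap {n : ℝ → ℝ} {A B T : ℝ}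
    (hn : ContinuousOn n (Icc 0 T)) (h₀ : n 0 < A) (hBA : B < A)
    (hboot : ∀ t ∈ Icc 0 T, (∀ x ∈ Icc 0 t, n x < A) → n t ≤ B) : ∀ t ∈ Icc 0 T, n t < A := by
  by_contra! hcon
  obtain ⟨t₁, ht₁, hnt₁⟩ := hcon
  have hK : IsCompact (Icc 0 T ∩ n ⁻¹' Ici A) :=
    isCompact_Icc.of_isClosed_subset (hn.preimage_isClosed_of_isClosed isClosed_Icc isClosed_Ici)
      inter_subset_left
  obtain ⟨τ, ⟨hτ, hnτ⟩, hmin⟩ := hK.exists_isLeast ⟨t₁, ht₁, hnt₁⟩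
  have hτ₀ : 0 < τ := hτ.1.lt_of_ne fun h => (h₀.trans_le (h ▸ hnτ)).false
  have hbelow : ∀ t ∈ Ico 0 τ, n t < A := fun t ht => not_le.1 fun hAt =>
    ht.2.not_ge (hmin ⟨⟨ht.1, ht.2.le.trans hτ.2⟩, hAt⟩)
  have hle : n τ ≤ B := ContinuousWithinAt.closure_le (s := Ico 0 τ)
    (by rw [closure_Ico hτ₀.ne]; exact right_mem_Icc.2 hτ₀.le)
    ((hn τ hτ).mono fun t ht => ⟨ht.1, ht.2.le.trans hτ.2⟩) continuousWithinAt_const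
    fun t ht => hboot t ⟨ht.1, ht.2.le.trans hτ.2⟩ fun x hx => hbelow x ⟨hx.1, hx.2.trans_lt ht.2⟩
  exact (hnτ.trans hle).not_gt hBA

namespace OscillatorSystem.IsMotion

variable {S : OscillatorSystem ι} {u p : ℝ → ι → ℝ} {A T : ℝ}

theorem energy_lt_of_nonneg (h : S.IsMotion A (Icc 0 T) u p) (hA : 0 < A) (hT : 0 ≤ T)
    (hcont : ContinuousOn (fun t => S.energy (u t) (p t)) (Icc 0 T))
    (hlt : S.energy (u 0) (p 0)
      + 2 * (S.σ * S.ρ * A ^ 2 / S.μ) + 4 * (S.σ * S.ρ) ^ 2 * A ^ 3 / S.μ * T < A) :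
    S.energy (u T) (p T) < A := by
  have hσ := S.sigma_nonneg
  have hρ := S.rho_nonneg
  have hμ := S.mu_pos
  have h₀ : S.energy (u 0) (p 0) < A := lt_of_le_of_lt (by
    rw [add_assoc]
    exact le_add_of_nonneg_right (by positivity)) hlt
  refine forall_lt_of_continuousOn_of_bootstrap hcont h₀ hlt (fun t ht hbelow => ?_) T
    (right_mem_Icc.2 hT)
  refine ((h.mono (Icc_subset_Icc_right ht.2)).energy_le ht.1 fun x hx =>
    (hbelow x hx).le).trans ?_
  gcongr
  exact ht.2

theorem energy_lt {I : Set ℝ} {t : ℝ} (h : S.IsMotion A I u p) (hI : I.OrdConnected)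
    (h₀ : 0 ∈ I) (hA : 0 < A) (hcont : ContinuousOn (fun t => S.energy (u t) (p t)) I) (ht : t ∈ I)
    (hlt : S.energy (u 0) (p 0)
      + 2 * (S.σ * S.ρ * A ^ 2 / S.μ) + 4 * (S.σ * S.ρ) ^ 2 * A ^ 3 / S.μ * |t| < A) :
    S.energy (u t) (p t) < A := by
  rcases le_total 0 t with ht₀ | ht₀
  · have hsub : Icc 0 t ⊆ I := hI.out h₀ ht
    rw [abs_of_nonneg ht₀] at hlt
    exact (h.mono hsub).energy_lt_of_nonneg hA ht₀ (hcont.mono hsub) hlt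
  · have hsub : Icc 0 (-t) ⊆ Neg.neg ⁻¹' I := fun x hx =>
      hI.out ht h₀ ⟨le_neg.2 hx.2, neg_nonpos.2 hx.1⟩
    rw [abs_of_nonpos ht₀] at hlt
    have key := (h.comp_neg.mono hsub).energy_lt_of_nonneg hA (neg_nonneg.2 ht₀)
      (by simpa only [energy_neg, Function.comp_def] using hcont.comp continuousOn_neg hsub)
      (by simpa only [energy_neg, neg_zero] using hlt)
    simpa only [energy_neg, neg_neg] using key

end OscillatorSystem.IsMotion

end Growth

/-! ### Differential equations in a rotating frame -/

section RadialProjection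

variable {E : Type*} [NormedAddCommGroup E]

theorem abs_max_norm_sub_max_norm_le (R : ℝ) (x y : E) :
    |max R ‖x‖ - max R ‖y‖| ≤ ‖x - y‖ := by
  rw [max_comm R, max_comm R]
  exact (abs_max_sub_max_le_abs _ _ _).trans (abs_norm_sub_norm_le _ _)

variable [NormedSpace ℝ E] {R : ℝ}

/-- The radial retraction of a normed space onto the closed ball of radius `R > 0`. -/
def radialProj (R : ℝ) (x : E) : E := (R / max R ‖x‖) • x

theorem radialProj_of_norm_le (hR : 0 < R) {x : E} (hx : ‖x‖ ≤ R) : radialProj R x = x := by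
  rw [radialProj, max_eq_left hx, div_self hR.ne', one_smul]

theorem norm_radialProj_le (hR : 0 < R) (x : E) : ‖radialProj R x‖ ≤ R := by
  have hm : 0 < max R ‖x‖ := hR.trans_le (le_max_left _ _)
  rw [radialProj, norm_smul, Real.norm_of_nonneg (by positivity), div_mul_eq_mul_div,
    div_le_iff₀ hm]
  exact mul_le_mul_of_nonneg_left (le_max_right _ _) hR.le

theorem radialProj_sub (hR : 0 < R) (x y : E) :
    radialProj R x - radialProj R y = (R / max R ‖x‖) •
      ((x - y) + ((max R ‖y‖ - max R ‖x‖) / max R ‖y‖) • y) := by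
  have hx : max R ‖x‖ ≠ 0 := (hR.trans_le (le_max_left _ _)).ne'
  have hy : max R ‖y‖ ≠ 0 := (hR.trans_le (le_max_left _ _)).ne'
  rw [radialProj, radialProj, smul_add, smul_sub, sub_add, smul_smul, ← sub_smul]
  congr 2
  field_simp [hx, hy]
  ring

theorem lipschitzWith_radialProj (hR : 0 < R) : LipschitzWith 2 (radialProj R : E → E) := by
  refine LipschitzWith.of_dist_le_mul fun x y => ?_
  rw [dist_eq_norm, dist_eq_norm, NNReal.coe_ofNat]
  have hx : 0 < max R ‖x‖ := hR.trans_le (le_max_left _ _)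
  have hy : 0 < max R ‖y‖ := hR.trans_le (le_max_left _ _)
  have hshrink : ‖R / max R ‖x‖‖ ≤ 1 := by
    rw [Real.norm_of_nonneg (by positivity)]
    exact (div_le_one hx).2 (le_max_left _ _)
  have hscale : ‖((max R ‖y‖ - max R ‖x‖) / max R ‖y‖) • y‖ ≤ ‖x - y‖ := by
    rw [norm_smul, norm_div, Real.norm_of_nonneg hy.le, div_mul_eq_mul_div, div_le_iff₀ hy,
      norm_sub_rev x y]
    exact mul_le_mul (abs_max_norm_sub_max_norm_le R y x) (le_max_right _ _) (norm_nonneg _)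
      (norm_nonneg _)
  calc ‖radialProj R x - radialProj R y‖
      ≤ 1 * (‖x - y‖ + ‖x - y‖) := by
        rw [radialProj_sub hR, norm_smul]
        exact mul_le_mul hshrink (norm_add_le_of_le le_rfl hscale) (norm_nonneg _) zero_le_one
    _ = 2 * ‖x - y‖ := by ring

end RadialProjection

section CubicMap

variable {E F : Type*} [NormedAddCommGroup E] [NormedSpace ℝ E] [NormedAddCommGroup F]
  [NormedSpace ℝ F] {B : E →L[ℝ] F} {D : E →L[ℝ] E} {R : ℝ}

/-- The cubic map `z ↦ ‖B z‖² D z`. -/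
def cubicMap (B : E →L[ℝ] F) (D : E →L[ℝ] E) (z : E) : E := ‖B z‖ ^ 2 • D z

theorem continuous_cubicMap (B : E →L[ℝ] F) (D : E →L[ℝ] E) : Continuous (cubicMap B D) := by
  unfold cubicMap; fun_prop

theorem norm_cubicMap_le (hB : ∀ z, ‖B z‖ ≤ ‖z‖) (hD : ∀ z, ‖D z‖ ≤ ‖z‖) {x : E} (hx : ‖x‖ ≤ R) :
    ‖cubicMap B D x‖ ≤ R ^ 3 := by
  have hBx := (hB x).trans hx
  have hDx := (hD x).trans hx
  rw [cubicMap, norm_smul, norm_pow, norm_norm, pow_succ R 2]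
  gcongr

theorem cubicMap_sub (B : E →L[ℝ] F) (D : E →L[ℝ] E) (x y : E) :
    cubicMap B D x - cubicMap B D y
      = ‖B x‖ ^ 2 • D (x - y) + ((‖B x‖ + ‖B y‖) * (‖B x‖ - ‖B y‖)) • D y := by
  rw [cubicMap, cubicMap, map_sub, smul_sub, sub_add, ← sub_smul]
  congr 2
  ring

theorem lipschitzOnWith_cubicMap (hB : ∀ z, ‖B z‖ ≤ ‖z‖) (hD : ∀ z, ‖D z‖ ≤ ‖z‖) (R : ℝ) :
    LipschitzOnWith (3 * R ^ 2).toNNReal (cubicMap B D) (Metric.closedBall 0 R) := by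
  refine LipschitzOnWith.of_dist_le_mul fun x hx y hy => ?_
  rw [mem_closedBall_zero_iff] at hx hy
  rw [dist_eq_norm, dist_eq_norm, Real.coe_toNNReal _ (by positivity), cubicMap_sub]
  have hBx := (hB x).trans hx
  have hBy := (hB y).trans hy
  have hDy := (hD y).trans hy
  have hR : 0 ≤ R := (norm_nonneg _).trans hx
  have hBxy : |‖B x‖ - ‖B y‖| ≤ ‖x - y‖ := by
    simpa only [map_sub] using (abs_norm_sub_norm_le (B x) (B y)).trans (map_sub B x y ▸ hB _)
  have hlinear : ‖‖B x‖ ^ 2 • D (x - y)‖ ≤ R ^ 2 * ‖x - y‖ := by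
    rw [norm_smul, norm_pow, norm_norm]
    exact mul_le_mul (by gcongr) (hD _) (norm_nonneg _) (by positivity)
  have hquadratic : ‖((‖B x‖ + ‖B y‖) * (‖B x‖ - ‖B y‖)) • D y‖ ≤ (R + R) * ‖x - y‖ * R := by
    rw [norm_smul, norm_mul, Real.norm_of_nonneg (by positivity), Real.norm_eq_abs]
    gcongr
  exact (norm_add_le_of_le hlinear hquadratic).trans_eq (by ring)

end CubicMap

section Rotation

open scoped lp ENNReal

variable {ι : Type*} (ω : ι → ℝ)

/-- The unitary group `a ↦ (exp(i ω_j t) a_j)_j` on the space `ℓ²` of mode amplitudes. -/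
def modeRot (t : ℝ) : ℓ²(ι, ℂ) →L[ℝ] ℓ²(ι, ℂ) :=
  diagOp (fun j => LinearMap.mulLeft ℝ (Complex.exp ((ω j * t : ℝ) * Complex.I))) 1 fun j x => by
    rw [LinearMap.mulLeft_apply, norm_mul, Complex.norm_exp_ofReal_mul_I]

theorem modeRot_apply (t : ℝ) (a : ℓ²(ι, ℂ)) (j : ι) :
    modeRot ω t a j = Complex.exp ((ω j * t : ℝ) * Complex.I) * a j := rfl

theorem norm_modeRot_apply (t : ℝ) (a : ℓ²(ι, ℂ)) (j : ι) : ‖modeRot ω t a j‖ = ‖a j‖ := by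
  rw [modeRot_apply, norm_mul, Complex.norm_exp_ofReal_mul_I, one_mul]

theorem norm_modeRot (t : ℝ) (a : ℓ²(ι, ℂ)) : ‖modeRot ω t a‖ = ‖a‖ := by
  refine (pow_left_inj₀ (norm_nonneg _) (norm_nonneg _) two_ne_zero).1 ?_
  simp only [lpTwo_norm_sq, norm_modeRot_apply]

theorem isometry_modeRot (t : ℝ) : Isometry (modeRot ω t) :=
  AddMonoidHomClass.isometry_of_norm _ (norm_modeRot ω t)

theorem modeRot_modeRot (s t : ℝ) (a : ℓ²(ι, ℂ)) :
    modeRot ω s (modeRot ω t a) = modeRot ω (s + t) a := by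
  ext j
  rw [modeRot_apply, modeRot_apply, modeRot_apply, ← mul_assoc, ← Complex.exp_add]
  congr 2
  push_cast
  ring

@[simp] theorem modeRot_zero (a : ℓ²(ι, ℂ)) : modeRot ω 0 a = a := by
  ext j
  simp [modeRot_apply]

@[simp] theorem modeRot_neg_modeRot (t : ℝ) (a : ℓ²(ι, ℂ)) :
    modeRot ω (-t) (modeRot ω t a) = a := by
  rw [modeRot_modeRot, neg_add_cancel, modeRot_zero]

theorem modeRot_injective (t : ℝ) : Function.Injective (modeRot ω t) :=
  (isometry_modeRot ω t).injective

theorem continuous_modeRot (a : ℓ²(ι, ℂ)) : Continuous fun t => modeRot ω t a := by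
  have hsq : ∀ t₀, Continuous fun t => ‖modeRot ω t a - modeRot ω t₀ a‖ ^ 2 := fun t₀ => by
    simp_rw [lpTwo_norm_sq]
    refine continuous_tsum (u := fun j => 2 ^ 2 * ‖a j‖ ^ 2) (fun j => ?_)
      ((memℓp_two_iff.1 (lp.memℓp a)).mul_left _) fun j t => ?_
    · simp only [lp.coeFn_sub, Pi.sub_apply, modeRot_apply]
      fun_prop
    · rw [norm_pow, norm_norm, lp.coeFn_sub, Pi.sub_apply, ← mul_pow, two_mul]
      exact pow_le_pow_left₀ (norm_nonneg _) (norm_sub_le_of_le (norm_modeRot_apply ω t a j).le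
        (norm_modeRot_apply ω t₀ a j).le) 2
  refine continuous_iff_continuousAt.2 fun t₀ => tendsto_iff_norm_sub_tendsto_zero.2 ?_
  simpa [Function.comp_def, Real.sqrt_sq (norm_nonneg _)]
    using (Real.continuous_sqrt.comp (hsq t₀)).tendsto t₀

theorem continuousOn_modeRot {f : ℝ → ℝ} {g : ℝ → ℓ²(ι, ℂ)} {I : Set ℝ}
    (hf : ContinuousOn f I) (hg : ContinuousOn g I) :
    ContinuousOn (fun t => modeRot ω (f t) (g t)) I := by
  let R (x : ℝ × ℓ²(ι, ℂ)) : ℓ²(ι, ℂ) := modeRot ω x.1 x.2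
  have hR : Continuous R :=
    continuous_prod_of_continuous_lipschitzWith' _ 1 (fun t => (isometry_modeRot ω t).lipschitz)
      (continuous_modeRot ω)
  change ContinuousOn (R ∘ fun t => (f t, g t)) I
  exact hR.comp_continuousOn (hf.prodMk hg)

theorem hasDerivAt_exp_ofReal_mul_I (w t : ℝ) :
    HasDerivAt (fun t : ℝ => Complex.exp ((w * t : ℝ) * Complex.I))
      (w * Complex.I * Complex.exp ((w * t : ℝ) * Complex.I)) t := by
  have hphase : HasDerivAt (fun t : ℝ => ((w * t : ℝ) : ℂ) * Complex.I) (w * Complex.I) t := by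
    simpa using (((hasDerivAt_id t).const_mul w).ofReal_comp).mul_const Complex.I
  exact hphase.cexp.congr_deriv (mul_comm _ _)

/-- The vector field `N` seen in the frame rotating with the frequencies `ω`. -/
def rotatedField (N : ℓ²(ι, ℂ) → ℓ²(ι, ℂ)) (t : ℝ) (a : ℓ²(ι, ℂ)) : ℓ²(ι, ℂ) :=
  modeRot ω t (N (modeRot ω (-t) a))

theorem lipschitzOnWith_rotatedField {N : ℓ²(ι, ℂ) → ℓ²(ι, ℂ)} {K : NNReal} {s : Set ℓ²(ι, ℂ)}
    (hN : LipschitzOnWith K N s) {t : ℝ} (hs : MapsTo (modeRot ω (-t)) s s) :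
    LipschitzOnWith K (rotatedField ω N t) s := by
  change LipschitzOnWith K (modeRot ω t ∘ N ∘ modeRot ω (-t)) s
  simpa only [one_mul, mul_one] using (isometry_modeRot ω t).lipschitz.comp_lipschitzOnWith
    (hN.comp (isometry_modeRot ω (-t)).lipschitz.lipschitzOnWith hs)

/-- The equation `z_j' = -i ω_j z_j + N(z)_j` on `I`, mode by mode. Since `ω` may be unbounded, this
is weaker than differentiability of `z` in `ℓ²`. -/
def IsModewiseSolution (N : ℓ²(ι, ℂ) → ℓ²(ι, ℂ)) (I : Set ℝ) (z : ℝ → ℓ²(ι, ℂ)) : Prop :=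
  ∀ t ∈ I, ∀ j, HasDerivAt (fun τ => z τ j) (-(ω j * Complex.I * z t j) + N (z t) j) t

variable {ω} {N : ℓ²(ι, ℂ) → ℓ²(ι, ℂ)} {I : Set ℝ} {z w : ℝ → ℓ²(ι, ℂ)}

theorem IsModewiseSolution.hasDerivAt_modeRot (h : IsModewiseSolution ω N I z) (hI : IsOpen I)
    (hc : I.OrdConnected) (hN : Continuous N) (hz : ContinuousOn z I) {t : ℝ} (ht : t ∈ I) :
    HasDerivAt (fun τ => modeRot ω τ (z τ)) (rotatedField ω N t (modeRot ω t (z t))) t := by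
  rw [rotatedField, modeRot_neg_modeRot]
  refine hasDerivAt_lp_of_apply hI hc (V := fun τ => modeRot ω τ (N (z τ)))
    (continuousOn_modeRot ω continuousOn_id (hN.comp_continuousOn hz)) (fun τ hτ j => ?_) ht
  exact ((hasDerivAt_exp_ofReal_mul_I (ω j) τ).mul (h τ hτ j)).congr_deriv (by
    rw [modeRot_apply]; ring)

theorem isModewiseSolution_modeRot_neg {a : ℝ → ℓ²(ι, ℂ)}
    (ha : ∀ t ∈ I, HasDerivAt a (rotatedField ω N t (a t)) t) :
    IsModewiseSolution ω N I fun t => modeRot ω (-t) (a t) := fun t ht j => by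
  have hphase : ∀ τ : ℝ, ω j * -τ = -ω j * τ := fun τ => by ring
  have hcancel : Complex.exp ((ω j * -t : ℝ) * Complex.I) * rotatedField ω N t (a t) j
      = N (modeRot ω (-t) (a t)) j :=
    congrArg (fun b : ℓ²(ι, ℂ) => b j) (modeRot_neg_modeRot ω t (N (modeRot ω (-t) (a t))))
  rw [hphase] at hcancel
  simp only [modeRot_apply, hphase]
  refine ((hasDerivAt_exp_ofReal_mul_I (-ω j) t).mul
    (hasDerivAt_lp_apply (ha t ht) j)).congr_deriv ?_
  rw [hcancel]
  push_cast
  ring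

theorem exists_isModewiseSolution (ω : ι → ℝ) {K C : NNReal} (hNl : LipschitzWith K N)
    (hNb : ∀ a, ‖N a‖ ≤ C) {T : ℝ} (hT : 0 ≤ T) (z₀ : ℓ²(ι, ℂ)) :
    ∃ z : ℝ → ℓ²(ι, ℂ), ContinuousOn z (Icc (-T) T) ∧ z 0 = z₀ ∧
      IsModewiseSolution ω N (Ioo (-T) T) z := by
  have hpl : IsPicardLindelof (rotatedField ω N) (tmin := -T) (tmax := T)
      ⟨0, neg_nonpos.2 hT, hT⟩ z₀ (C * T.toNNReal) 0 C K :=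
    { lipschitzOnWith := fun t _ =>
        (lipschitzOnWith_rotatedField ω hNl.lipschitzOnWith (mapsTo_univ _ _)).mono (subset_univ _)
      continuousOn := fun a _ => continuousOn_modeRot ω continuousOn_id
        (hNl.continuous.comp_continuousOn
          (continuousOn_modeRot ω continuous_neg.continuousOn continuousOn_const))
      norm_le := fun t _ a _ => (norm_modeRot ω t _).trans_le (hNb _)
      mul_max_le := by simp [hT] }
  obtain ⟨a, ha0, ha⟩ := hpl.exists_eq_forall_mem_Icc_hasDerivWithinAt₀
  refine ⟨fun t => modeRot ω (-t) (a t), continuousOn_modeRot ω continuous_neg.continuousOn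
    fun t ht => (ha t ht).continuousWithinAt, ?_, isModewiseSolution_modeRot_neg fun t ht =>
      (ha t (Ioo_subset_Icc_self ht)).hasDerivAt (Icc_mem_nhds ht.1 ht.2)⟩
  simpa only [neg_zero, modeRot_zero] using ha0

theorem exists_Ioo_of_isOpen_ordConnected {I : Set ℝ} (hI : IsOpen I) (hc : I.OrdConnected)
    {x y : ℝ} (hx : x ∈ I) (hy : y ∈ I) : ∃ a b, x ∈ Ioo a b ∧ y ∈ Ioo a b ∧ Icc a b ⊆ I := by
  have hmin : min x y ∈ I := by rcases min_choice x y with h | h <;> rwa [h]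
  have hmax : max x y ∈ I := by rcases max_choice x y with h | h <;> rwa [h]
  obtain ⟨a, ha, haI⟩ := (eventually_mem_nhdsWithin.and
    (mem_nhdsWithin_of_mem_nhds (t := Iio (min x y)) (hI.mem_nhds hmin))).exists
  obtain ⟨b, hb, hbI⟩ := (eventually_mem_nhdsWithin.and
    (mem_nhdsWithin_of_mem_nhds (t := Ioi (max x y)) (hI.mem_nhds hmax))).exists
  rw [mem_Iio, lt_min_iff] at ha
  rw [mem_Ioi, max_lt_iff] at hb
  exact ⟨a, b, ⟨ha.1, hb.1⟩, ⟨ha.2, hb.2⟩, hc.out haI hbI⟩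

theorem IsModewiseSolution.eqOn (hz : IsModewiseSolution ω N I z)
    (hw : IsModewiseSolution ω N I w) (hI : IsOpen I) (hc : I.OrdConnected) (hN : Continuous N)
    (hNl : ∀ R, ∃ K, LipschitzOnWith K N (Metric.closedBall 0 R)) (hzc : ContinuousOn z I)
    (hwc : ContinuousOn w I) {t₀ : ℝ} (ht₀ : t₀ ∈ I) (h : z t₀ = w t₀) : EqOn z w I := by
  intro t ht
  obtain ⟨a, b, ha, hb, hab⟩ := exists_Ioo_of_isOpen_ordConnected hI hc ht₀ ht
  obtain ⟨Rz, hRz⟩ := isCompact_Icc.exists_bound_of_continuousOn (hzc.mono hab)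
  obtain ⟨Rw, hRw⟩ := isCompact_Icc.exists_bound_of_continuousOn (hwc.mono hab)
  obtain ⟨K, hK⟩ := hNl (max Rz Rw)
  have hball : ∀ {t : ℝ} {a : ℓ²(ι, ℂ)}, ‖a‖ ≤ max Rz Rw →
      modeRot ω t a ∈ Metric.closedBall 0 (max Rz Rw) := fun {t a} ha =>
    mem_closedBall_zero_iff.2 ((norm_modeRot ω t a).trans_le ha)
  have hsub : Ioo a b ⊆ Icc a b := Ioo_subset_Icc_self
  refine modeRot_injective ω t (ODE_solution_unique_of_mem_Ioo (v := rotatedField ω N)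
    (s := fun _ => Metric.closedBall 0 (max Rz Rw))
    (fun τ _ => lipschitzOnWith_rotatedField ω hK fun a ha => hball (mem_closedBall_zero_iff.1 ha))
    ha (fun τ hτ => ⟨hz.hasDerivAt_modeRot hI hc hN hzc (hab (hsub hτ)),
      hball ((hRz τ (hsub hτ)).trans (le_max_left _ _))⟩)
    (fun τ hτ => ⟨hw.hasDerivAt_modeRot hI hc hN hwc (hab (hsub hτ)),
      hball ((hRw τ (hsub hτ)).trans (le_max_right _ _))⟩) (by simp only [h]) hb)

end Rotation

/-! ### Modes of the beam -/

section Frequencies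

variable {m : ℝ}

theorem sq_add_pos (hm : -1 < m) (j : ℕ+) : 0 < (j : ℝ) ^ 2 + m := by
  linarith [one_le_pow₀ (n := 2) (one_le_pnat_cast j)]

theorem omegaFreq_eq (m : ℝ) (j : ℕ+) : omegaFreq m j = j * √((j : ℝ) ^ 2 + m) := by
  rw [omegaFreq, show (j : ℝ) ^ 4 + m * (j : ℝ) ^ 2 = (j : ℝ) ^ 2 * ((j : ℝ) ^ 2 + m) by ring,
    Real.sqrt_mul (by positivity), Real.sqrt_sq (pnat_cast_pos j).le]

theorem omegaFreq_pos (hm : -1 < m) (j : ℕ+) : 0 < omegaFreq m j := by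
  rw [omegaFreq_eq]
  exact mul_pos (pnat_cast_pos j) (Real.sqrt_pos.2 (sq_add_pos hm j))

theorem omegaFreq_sq (hm : -1 < m) (j : ℕ+) :
    omegaFreq m j ^ 2 = (j : ℝ) ^ 4 + m * (j : ℝ) ^ 2 := by
  rw [omegaFreq_eq, mul_pow, Real.sq_sqrt (sq_add_pos hm j).le]
  ring

theorem mu_pos (hm : -1 < m) : 0 < mu m :=
  lt_min (mul_pos two_pos (Real.sqrt_pos.2 (by linarith)))
    (mul_pos (by norm_num) (Real.sqrt_pos.2 (by linarith)))

theorem mu_le_two_mul_omegaFreq (m : ℝ) (j : ℕ+) : mu m ≤ 2 * omegaFreq m j := by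
  have hj := one_le_pnat_cast j
  rw [omegaFreq_eq]
  calc mu m ≤ 2 * (1 * √(1 + m)) := by
        rw [one_mul]
        exact min_le_left _ _
    _ ≤ 2 * (j * √((j : ℝ) ^ 2 + m)) := by
        gcongr
        exact one_le_pow₀ hj

theorem half_mu_le_omegaFreq_sub {j k : ℕ+} (hjk : j < k) :
    mu m / 2 ≤ omegaFreq m k - omegaFreq m j := by
  have hj := one_le_pnat_cast j
  have hk : (j : ℝ) + 1 ≤ k := by exact_mod_cast (hjk : (j : ℕ) < k)
  have hgap : ((j : ℝ) + 1) * √((k : ℝ) ^ 2 + m) ≤ omegaFreq m k := by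
    rw [omegaFreq_eq]
    gcongr
  have hmono : omegaFreq m j ≤ j * √((k : ℝ) ^ 2 + m) := by
    rw [omegaFreq_eq]
    gcongr
    exact hjk.le
  have hsqrt : √(4 + m) ≤ √((k : ℝ) ^ 2 + m) := Real.sqrt_le_sqrt (by nlinarith)
  have hmu : mu m ≤ 3 / 2 * √(4 + m) := min_le_right _ _
  linarith [Real.sqrt_nonneg (4 + m)]

theorem half_mu_le_abs_omegaFreq_sub {j k : ℕ+} (hjk : j ≠ k) :
    mu m / 2 ≤ |omegaFreq m j - omegaFreq m k| := by
  rcases lt_or_gt_of_ne hjk with h | h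
  · rw [abs_sub_comm]
    exact (half_mu_le_omegaFreq_sub h).trans (le_abs_self _)
  · exact (half_mu_le_omegaFreq_sub h).trans (le_abs_self _)

theorem sq_div_omegaFreq_nonneg (m : ℝ) (j : ℕ+) : 0 ≤ (j : ℝ) ^ 2 / omegaFreq m j :=
  div_nonneg (sq_nonneg _) (Real.sqrt_nonneg _)

theorem sq_div_omegaFreq_le (hm : -1 / 2 ≤ m) (j : ℕ+) :
    (j : ℝ) ^ 2 / omegaFreq m j ≤ 3 / 2 := by
  have hω := omegaFreq_pos (by linarith : -1 < m) j
  have hj := one_le_pow₀ (n := 2) (one_le_pnat_cast j)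
  rw [div_le_iff₀ hω]
  refine le_of_sq_le_sq ?_ (by positivity)
  rw [mul_pow, omegaFreq_sq (by linarith)]
  nlinarith

end Frequencies

section Weights

/-- The weights of the norm of `H^r_N`. -/
def weightN (r : ℝ) (N : ℕ) (j : ℕ+) : ℝ := if (j : ℕ) ≤ N then (j : ℝ) ^ 2 else (j : ℝ) ^ (2 * r)

variable {r : ℝ} {N : ℕ}

theorem weightN_pos (r : ℝ) (N : ℕ) (j : ℕ+) : 0 < weightN r N j := by
  have := pnat_cast_pos j
  rw [weightN]
  split_ifs <;> positivity

theorem sq_le_rpow_two_mul (hr : 1 ≤ r) (j : ℕ+) : (j : ℝ) ^ 2 ≤ (j : ℝ) ^ (2 * r) := by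
  rw [← Real.rpow_natCast]
  exact Real.rpow_le_rpow_of_exponent_le (one_le_pnat_cast j) (by push_cast; linarith)

theorem sq_le_weightN (hr : 1 ≤ r) (N : ℕ) (j : ℕ+) : (j : ℝ) ^ 2 ≤ weightN r N j := by
  rw [weightN]
  split_ifs
  exacts [le_rfl, sq_le_rpow_two_mul hr j]

theorem weightN_le_rpow (hr : 1 ≤ r) (N : ℕ) (j : ℕ+) : weightN r N j ≤ (j : ℝ) ^ (2 * r) := by
  rw [weightN]
  split_ifs
  exacts [sq_le_rpow_two_mul hr j, le_rfl]

theorem rpow_le_mul_weightN (hr : 0 ≤ r) (hN : 1 ≤ N) (j : ℕ+) :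
    (j : ℝ) ^ (2 * r) ≤ (N : ℝ) ^ (2 * r) * weightN r N j := by
  have hj := one_le_pnat_cast j
  rw [weightN]
  split_ifs with h
  · calc (j : ℝ) ^ (2 * r) ≤ (N : ℝ) ^ (2 * r) := by gcongr
      _ ≤ (N : ℝ) ^ (2 * r) * (j : ℝ) ^ 2 :=
        le_mul_of_one_le_right (by positivity) (one_le_pow₀ hj)
  · exact le_mul_of_one_le_left (by positivity)
      (Real.one_le_rpow (Nat.one_le_cast.2 hN) (by linarith))

theorem exists_finset_sq_le_mul_weightN (hr : 3 / 2 ≤ r) (N : ℕ) {δ : ℝ} (hδ : 0 < δ) :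
    ∃ F : Finset ℕ+, ∀ k ∉ F, (k : ℝ) ^ 2 ≤ δ * weightN r N k := by
  obtain ⟨M, hM⟩ := exists_nat_gt (1 / δ)
  refine ⟨Finset.Icc 1 ⟨max M N + 1, Nat.succ_pos _⟩, fun k hk => ?_⟩
  have hlarge : max M N < (k : ℕ) := not_le.1 fun h =>
    hk (Finset.mem_Icc.2 ⟨one_le, (Nat.le_succ_of_le h : (k : ℕ) ≤ max M N + 1)⟩)
  have hδk : 1 ≤ δ * k := by
    have hMk : (M : ℝ) ≤ k := by exact_mod_cast (le_max_left M N).trans hlarge.le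
    rw [← div_le_iff₀' hδ]
    exact hM.le.trans hMk
  rw [weightN, if_neg ((le_max_right M N).trans_lt hlarge).not_ge]
  calc (k : ℝ) ^ 2 ≤ δ * k * (k : ℝ) ^ 2 := le_mul_of_one_le_left (by positivity) hδk
    _ = δ * (k : ℝ) ^ (3 : ℝ) := by
        rw [show (3 : ℝ) = (3 : ℕ) by norm_num, Real.rpow_natCast]
        ring
    _ ≤ δ * (k : ℝ) ^ (2 * r) := by
        gcongr
        exacts [one_le_pnat_cast k, by linarith]

theorem sqrt_weightN_div_rpow_le_one (hr : 1 ≤ r) (N : ℕ) (j : ℕ+) :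
    √(weightN r N j) / (j : ℝ) ^ r ≤ 1 := by
  rw [div_le_one (rpow_pos_of_pos (pnat_cast_pos j) r), Real.sqrt_le_iff, pnat_rpow_sq]
  exact ⟨by positivity, weightN_le_rpow hr N j⟩

end Weights

section Amplitudes

open scoped lp

variable {m r : ℝ} {N : ℕ}

/-- The position of the `j`-th mode in the state `z`. States are sequences
`z_j = j^r (c_j + i d_j / ω_j)` with `c_j` the position and `d_j` the velocity of the `j`-th mode,
so that `z ∈ ℓ²` encodes a pair in `H^r_* × H^{r-2}_*` and the linear flow is a rotation. -/
def modePosition (r : ℝ) (z : ℕ+ → ℂ) (j : ℕ+) : ℝ := (z j).re / (j : ℝ) ^ r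

/-- The velocity of the `j`-th mode in the state `z`, divided by `ω_j`. -/
def modeMomentum (r : ℝ) (z : ℕ+ → ℂ) (j : ℕ+) : ℝ := (z j).im / (j : ℝ) ^ r

/-- The integral of `u_x²` over `[0, π]` for `u = ∑ c_k φ_k`. -/
def modalStretch (c : ℕ+ → ℝ) : ℝ := ∑' k : ℕ+, (k : ℝ) ^ 2 * c k ^ 2

/-- The effect of the nonlinear tension on the imaginary part of `z_j`. -/
def modeForce (m r : ℝ) (z : ℕ+ → ℂ) (j : ℕ+) : ℝ :=
  -(1 / (2 * π) * ((j : ℝ) ^ 2 / omegaFreq m j) * modalStretch (modePosition r z) * (z j).re)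

/-- A continuous curve of states along which every mode follows the beam equation. -/
def IsModalSolution (m r : ℝ) (I : Set ℝ) (z : ℝ → ℓ²(ℕ+, ℂ)) : Prop :=
  ContinuousOn z I ∧ ∀ t ∈ I, ∀ j, HasDerivAt (fun τ => z τ j)
    (-(omegaFreq m j * Complex.I * z t j) + modeForce m r (z t) j * Complex.I) t

/-- The energy `∑ w_j (c_j² + d_j² / ω_j²)` whose square root controls the norm of `H^r_N`. -/
def weightedEnergy (r : ℝ) (N : ℕ) (z : ℕ+ → ℂ) : ℝ :=
  ∑' j, weightN r N j * (modePosition r z j ^ 2 + modeMomentum r z j ^ 2)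

/-- The operator whose squared norm is the integral of `u_x²`. -/
def stretchOp (hr : 1 ≤ r) : ℓ²(ℕ+, ℂ) →L[ℝ] ℓ²(ℕ+, ℝ) :=
  diagOp (fun j => ((j : ℝ) ^ (1 - r)) • Complex.reLm) 1 fun j x => by
    rw [LinearMap.smul_apply, norm_smul, Real.norm_of_nonneg (by positivity)]
    exact mul_le_mul (Real.rpow_le_one_of_one_le_of_nonpos (one_le_pnat_cast j) (by linarith))
      (Complex.abs_re_le_norm x) (norm_nonneg _) zero_le_one

theorem norm_stretchOp_le (hr : 1 ≤ r) (z : ℓ²(ℕ+, ℂ)) : ‖stretchOp hr z‖ ≤ ‖z‖ :=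
  (norm_diagOp_le _ zero_le_one _ z).trans_eq (one_mul _)

theorem norm_stretchOp_sq (hr : 1 ≤ r) (z : ℓ²(ℕ+, ℂ)) :
    ‖stretchOp hr z‖ ^ 2 = modalStretch (modePosition r z) := by
  refine (lpTwo_norm_sq _).trans (tsum_congr fun j => ?_)
  have happly : stretchOp hr z j = j * modePosition r z j := by
    change (j : ℝ) ^ (1 - r) * (z j).re = j * ((z j).re / (j : ℝ) ^ r)
    rw [Real.rpow_sub (pnat_cast_pos j), Real.rpow_one]
    ring
  rw [happly, Real.norm_eq_abs, sq_abs, mul_pow]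

/-- The linear factor of the nonlinear term of the beam equation. -/
def forcingOp (hm : -1 / 2 ≤ m) : ℓ²(ℕ+, ℂ) →L[ℝ] ℓ²(ℕ+, ℂ) :=
  diagOp (fun j => Complex.reLm.smulRight
    (((-(1 / (2 * π) * ((j : ℝ) ^ 2 / omegaFreq m j)) : ℝ) : ℂ) * Complex.I)) 1 fun j x => by
      have hpi : 1 / (2 * π) ≤ 1 / 6 := by
        gcongr
        linarith [pi_gt_three]
      have hcoeff := mul_le_mul hpi (sq_div_omegaFreq_le hm j) (sq_div_omegaFreq_nonneg m j)
        (by norm_num)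
      rw [LinearMap.smulRight_apply, norm_smul, norm_mul, Complex.norm_I, mul_one,
        Complex.norm_real, norm_neg, Real.norm_of_nonneg
          (mul_nonneg (by positivity) (sq_div_omegaFreq_nonneg m j)), mul_comm]
      exact mul_le_mul (by linarith) (Complex.abs_re_le_norm x) (norm_nonneg _) zero_le_one

theorem norm_forcingOp_le (hm : -1 / 2 ≤ m) (z : ℓ²(ℕ+, ℂ)) : ‖forcingOp hm z‖ ≤ ‖z‖ :=
  (norm_diagOp_le _ zero_le_one _ z).trans_eq (one_mul _)

theorem cubicMap_stretchOp_forcingOp_apply (hm : -1 / 2 ≤ m) (hr : 1 ≤ r) (z : ℓ²(ℕ+, ℂ))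
    (j : ℕ+) :
    cubicMap (stretchOp hr) (forcingOp hm) z j = modeForce m r z j * Complex.I := by
  have happly : forcingOp hm z j = (z j).re •
      (((-(1 / (2 * π) * ((j : ℝ) ^ 2 / omegaFreq m j)) : ℝ) : ℂ) * Complex.I) := rfl
  rw [cubicMap, norm_stretchOp_sq, lp.coeFn_smul, Pi.smul_apply, happly, modeForce]
  simp only [Complex.real_smul]
  push_cast
  ring

theorem isModalSolution_iff (hm : -1 / 2 ≤ m) (hr : 1 ≤ r) {I : Set ℝ} {z : ℝ → ℓ²(ℕ+, ℂ)} :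
    IsModalSolution m r I z ↔ ContinuousOn z I ∧
      IsModewiseSolution (omegaFreq m) (cubicMap (stretchOp hr) (forcingOp hm)) I z := by
  simp only [IsModalSolution, IsModewiseSolution, cubicMap_stretchOp_forcingOp_apply]

/-- The operator whose squared norm is `weightedEnergy r N`. -/
def energyOp (hr : 1 ≤ r) (N : ℕ) : ℓ²(ℕ+, ℂ) →L[ℝ] ℓ²(ℕ+, ℂ) :=
  diagOp (fun j => (√(weightN r N j) / (j : ℝ) ^ r) • LinearMap.id) 1 fun j x => by
    rw [LinearMap.smul_apply, norm_smul, Real.norm_of_nonneg (by positivity)]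
    exact mul_le_mul_of_nonneg_right (sqrt_weightN_div_rpow_le_one hr N j) (norm_nonneg x)

theorem norm_energyOp_apply_sq (hr : 1 ≤ r) (N : ℕ) (z : ℓ²(ℕ+, ℂ)) (j : ℕ+) :
    ‖energyOp hr N z j‖ ^ 2
      = weightN r N j * (modePosition r z j ^ 2 + modeMomentum r z j ^ 2) := by
  have happly : energyOp hr N z j = (√(weightN r N j) / (j : ℝ) ^ r) • z j := rfl
  rw [happly, norm_smul, mul_pow, Complex.sq_norm, Complex.normSq_apply, Real.norm_eq_abs, sq_abs,
    div_pow, Real.sq_sqrt (weightN_pos r N j).le, modePosition, modeMomentum]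
  ring

theorem summable_weightedEnergy (hr : 1 ≤ r) (N : ℕ) (z : ℓ²(ℕ+, ℂ)) :
    Summable fun j => weightN r N j * (modePosition r z j ^ 2 + modeMomentum r z j ^ 2) :=
  (memℓp_two_iff.1 (lp.memℓp (energyOp hr N z))).congr (norm_energyOp_apply_sq hr N z)

theorem norm_energyOp_sq (hr : 1 ≤ r) (N : ℕ) (z : ℓ²(ℕ+, ℂ)) :
    ‖energyOp hr N z‖ ^ 2 = weightedEnergy r N z :=
  (lpTwo_norm_sq _).trans (tsum_congr (norm_energyOp_apply_sq hr N z))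

theorem continuous_weightedEnergy (hr : 1 ≤ r) (N : ℕ) :
    Continuous fun z : ℓ²(ℕ+, ℂ) => weightedEnergy r N z := by
  simp only [← norm_energyOp_sq hr]
  fun_prop

theorem norm_sq_le_mul_weightedEnergy (hr : 1 ≤ r) (hN : 1 ≤ N) (z : ℓ²(ℕ+, ℂ)) :
    ‖z‖ ^ 2 ≤ (N : ℝ) ^ (2 * r) * weightedEnergy r N z := by
  rw [lpTwo_norm_sq, weightedEnergy, ← tsum_mul_left]
  refine (memℓp_two_iff.1 (lp.memℓp z)).tsum_le_tsum (fun j => ?_)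
    ((summable_weightedEnergy hr N z).mul_left _)
  have := rpow_pos_of_pos (pnat_cast_pos j) r
  calc ‖z j‖ ^ 2 = (j : ℝ) ^ (2 * r) * (modePosition r z j ^ 2 + modeMomentum r z j ^ 2) := by
        rw [modePosition, modeMomentum, ← pnat_rpow_sq, Complex.sq_norm, Complex.normSq_apply]
        field_simp
    _ ≤ (N : ℝ) ^ (2 * r) * weightN r N j * _ := by
        gcongr
        exact rpow_le_mul_weightN (by linarith) hN j
    _ = _ := mul_assoc _ _ _

theorem hasDerivAt_modePosition {z : ℝ → ℓ²(ℕ+, ℂ)} {t f : ℝ} {j : ℕ+}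
    (h : HasDerivAt (fun τ => z τ j)
      (-(omegaFreq m j * Complex.I * z t j) + f * Complex.I) t) :
    HasDerivAt (fun τ => modePosition r (z τ) j) (omegaFreq m j * modeMomentum r (z t) j) t := by
  refine ((Complex.reCLM.hasFDerivAt.comp_hasDerivAt t h).div_const _).congr_deriv ?_
  simp [modeMomentum, mul_div_assoc]

theorem hasDerivAt_modeMomentum {z : ℝ → ℓ²(ℕ+, ℂ)} {t : ℝ} {j : ℕ+}
    (h : HasDerivAt (fun τ => z τ j)
      (-(omegaFreq m j * Complex.I * z t j) + modeForce m r (z t) j * Complex.I) t) :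
    HasDerivAt (fun τ => modeMomentum r (z τ) j)
      (-(omegaFreq m j * modePosition r (z t) j) - 1 / (2 * π) * ((j : ℝ) ^ 2 / omegaFreq m j)
        * modalStretch (modePosition r (z t)) * modePosition r (z t) j) t := by
  refine ((Complex.imCLM.hasFDerivAt.comp_hasDerivAt t h).div_const _).congr_deriv ?_
  simp only [modeForce, modePosition, Complex.imCLM_apply, Complex.add_im, Complex.neg_im,
    Complex.mul_im, Complex.mul_re, Complex.ofReal_re, Complex.ofReal_im, Complex.I_re,
    Complex.I_im]
  ring

end Amplitudes

section LongTime

open scoped lp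

variable {m r : ℝ} {N : ℕ}

/-- The modes of the beam as an oscillator system, with the energy `weightedEnergy r N`. -/
def modalSystem (hm : -1 / 2 ≤ m) (hr : 3 / 2 ≤ r) (N : ℕ) : OscillatorSystem ℕ+ where
  ω := omegaFreq m
  r j := (j : ℝ) ^ 2 / omegaFreq m j
  b j := (j : ℝ) ^ 2
  W := weightN r N
  σ := 1 / (2 * π)
  ρ := 3 / 2
  μ := mu m
  sigma_nonneg := by positivity
  rho_nonneg := by norm_num
  mu_pos := mu_pos (by linarith)
  b_nonneg _ := sq_nonneg _
  b_le := sq_le_weightN (by linarith) N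
  r_nonneg := sq_div_omegaFreq_nonneg m
  r_le := sq_div_omegaFreq_le hm
  freq := mu_le_two_mul_omegaFreq m
  gap _ _ := half_mu_le_abs_omegaFreq_sub
  tail _ := exists_finset_sq_le_mul_weightN hr N

theorem sq_div_le_of_le_mul_sqrt {k μ ε : ℝ} (hμ : 0 < μ) (hε : 0 ≤ ε) (hεμ : ε ≤ k * √μ) :
    ε ^ 2 / μ ≤ k ^ 2 := by
  rw [div_le_iff₀ hμ, ← Real.sq_sqrt hμ.le, ← mul_pow]
  exact pow_le_pow_left₀ hε hεμ 2

theorem energy_budget {μ q ε τ : ℝ} (hμ : 0 < μ) (hq₀ : 0 ≤ q) (hq : q ≤ 1 / 4) (hε : 0 < ε)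
    (hεμ : ε ≤ 0.08 * √μ) (hτ : τ * ε ^ 4 ≤ 0.02 * μ) :
    2.1 * ε ^ 2 + 2 * (q * (3 * ε ^ 2) ^ 2 / μ) + 4 * q ^ 2 * (3 * ε ^ 2) ^ 3 / μ * τ
      < 3 * ε ^ 2 := by
  have hε_sq := sq_div_le_of_le_mul_sqrt hμ hε.le hεμ
  have hτ' : τ * ε ^ 4 / μ ≤ 0.02 := (div_le_iff₀ hμ).2 hτ
  have hsq : q * (3 * ε ^ 2) ^ 2 / μ ≤ 0.0144 * ε ^ 2 := by
    calc _ = 9 * q * ε ^ 2 * (ε ^ 2 / μ) := by ring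
      _ ≤ 9 * (1 / 4) * ε ^ 2 * 0.08 ^ 2 := by gcongr
      _ = _ := by ring
  have hcube : 4 * q ^ 2 * (3 * ε ^ 2) ^ 3 / μ * τ ≤ 0.135 * ε ^ 2 := by
    calc _ = 108 * q ^ 2 * ε ^ 2 * (τ * ε ^ 4 / μ) := by ring
      _ ≤ 108 * q ^ 2 * ε ^ 2 * 0.02 := by gcongr
      _ ≤ 108 * (1 / 4) ^ 2 * ε ^ 2 * 0.02 := by gcongr
      _ = _ := by ring
  linarith [pow_pos hε 2]

theorem weightedEnergy_lt (hm : -1 / 2 ≤ m) (hr : 3 / 2 ≤ r) {I : Set ℝ} {z : ℝ → ℓ²(ℕ+, ℂ)}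
    {ε t : ℝ} (hI : I.OrdConnected) (h₀ : 0 ∈ I) (hz : ContinuousOn z I)
    (hode : ∀ t ∈ I, weightedEnergy r N (z t) ≤ 3 * ε ^ 2 → ∀ j, HasDerivAt (fun τ => z τ j)
      (-(omegaFreq m j * Complex.I * z t j) + modeForce m r (z t) j * Complex.I) t)
    (hε : 0 < ε) (hεμ : ε ≤ 0.08 * √(mu m)) (hz₀ : weightedEnergy r N (z 0) ≤ 2.1 * ε ^ 2)
    (ht : t ∈ I) (htε : |t| * ε ^ 4 ≤ 0.02 * mu m) :
    weightedEnergy r N (z t) < 3 * ε ^ 2 := by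
  have hr₁ : 1 ≤ r := by linarith
  have hmotion : (modalSystem hm hr N).IsMotion (3 * ε ^ 2) I (fun t => modePosition r (z t))
      fun t => modeMomentum r (z t) :=
    { finiteEnergy t _ := summable_weightedEnergy hr₁ N (z t)
      hasDerivAt_fst t ht hA j := hasDerivAt_modePosition (hode t ht hA j)
      hasDerivAt_snd t ht hA j := hasDerivAt_modeMomentum (hode t ht hA j) }
  have hq : 1 / (2 * π) * (3 / 2) ≤ 1 / 4 := by
    rw [div_mul_div_comm, div_le_div_iff₀ (by positivity) (by norm_num)]
    linarith [pi_gt_three]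
  refine hmotion.energy_lt hI h₀ (by positivity)
    ((continuous_weightedEnergy hr₁ N).comp_continuousOn hz) ht (lt_of_le_of_lt ?_
      (energy_budget (mu_pos (by linarith)) (by positivity) hq hε hεμ htε))
  exact add_le_add_left (add_le_add_left hz₀ _) _

end LongTime

/-! ### Existence and uniqueness for the modes -/

section ModalSolutions

open scoped lp

variable {m r : ℝ} {I : Set ℝ} {z w : ℝ → ℓ²(ℕ+, ℂ)}

theorem isModalSolution_zero (m r : ℝ) (I : Set ℝ) : IsModalSolution m r I 0 :=
  ⟨continuousOn_const, fun t _ j => by simpa [modeForce] using hasDerivAt_const t (0 : ℂ)⟩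

theorem IsModalSolution.eqOn (hm : -1 / 2 ≤ m) (hr : 1 ≤ r) (hz : IsModalSolution m r I z)
    (hw : IsModalSolution m r I w) (hI : IsTimeInterval I) (h : z 0 = w 0) : EqOn z w I := by
  rw [isModalSolution_iff hm hr] at hz hw
  exact hz.2.eqOn hw.2 hI.1 hI.2.1 (continuous_cubicMap _ _)
    (fun R => ⟨_, lipschitzOnWith_cubicMap (norm_stretchOp_le hr) (norm_forcingOp_le hm) R⟩)
    hz.1 hw.1 hI.2.2 h

theorem lipschitzWith_cubicMap_comp_radialProj (hm : -1 / 2 ≤ m) (hr : 1 ≤ r) {R : ℝ} (hR : 0 < R) :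
    LipschitzWith ((3 * R ^ 2).toNNReal * 2)
      (cubicMap (stretchOp hr) (forcingOp hm) ∘ radialProj R) :=
  lipschitzOnWith_univ.1 <|
    (lipschitzOnWith_cubicMap (norm_stretchOp_le hr) (norm_forcingOp_le hm) R).comp
      (lipschitzWith_radialProj hR).lipschitzOnWith
      fun z _ => mem_closedBall_zero_iff.2 (norm_radialProj_le hR z)

theorem exists_isModalSolution (hm : -1 / 2 ≤ m) (hr : 3 / 2 ≤ r) {N : ℕ} (hN : 1 ≤ N) {ε T : ℝ}
    (hT : 0 < T) (hε : 0 < ε) (hεμ : ε ≤ 0.08 * √(mu m)) (hTε : T * ε ^ 4 ≤ 0.02 * mu m)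
    {z₀ : ℓ²(ℕ+, ℂ)} (hz₀ : weightedEnergy r N z₀ ≤ 2.1 * ε ^ 2) :
    ∃ z, IsModalSolution m r (Ioo (-T) T) z ∧ z 0 = z₀ := by
  have hr₁ : 1 ≤ r := by linarith
  set R := √((N : ℝ) ^ (2 * r) * (3 * ε ^ 2))
  have : (0 : ℝ) < N := Nat.cast_pos.2 hN
  have hR : 0 < R := Real.sqrt_pos.2 (by positivity)
  have hbound : ∀ z : ℓ²(ℕ+, ℂ),
      ‖(cubicMap (stretchOp hr₁) (forcingOp hm) ∘ radialProj R) z‖ ≤ (R ^ 3).toNNReal := fun z =>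
    (norm_cubicMap_le (norm_stretchOp_le hr₁) (norm_forcingOp_le hm)
      (norm_radialProj_le hR z)).trans (Real.le_coe_toNNReal _)
  obtain ⟨z, hzc, hz0, hz⟩ := exists_isModewiseSolution (omegaFreq m)
    (lipschitzWith_cubicMap_comp_radialProj hm hr₁ hR) hbound hT.le z₀
  have hzc' : ContinuousOn z (Ioo (-T) T) := hzc.mono Ioo_subset_Icc_self
  have hode : ∀ t ∈ Ioo (-T) T, weightedEnergy r N (z t) ≤ 3 * ε ^ 2 → ∀ j,
      HasDerivAt (fun τ => z τ j)
        (-(omegaFreq m j * Complex.I * z t j) + modeForce m r (z t) j * Complex.I) t := by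
    intro t ht hA j
    have hzR : ‖z t‖ ≤ R := Real.le_sqrt_of_sq_le
      ((norm_sq_le_mul_weightedEnergy hr₁ hN (z t)).trans (by gcongr))
    simpa only [Function.comp_apply, radialProj_of_norm_le hR hzR,
      cubicMap_stretchOp_forcingOp_apply] using hz t ht j
  refine ⟨z, ⟨hzc', fun t ht => hode t ht (le_of_lt ?_)⟩, hz0⟩
  refine weightedEnergy_lt hm hr ordConnected_Ioo (mem_Ioo.2 ⟨neg_lt_zero.2 hT, hT⟩) hzc' hode hε
    hεμ (hz0 ▸ hz₀) ht (le_trans ?_ hTε)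
  gcongr
  exact abs_le.2 ⟨ht.1.le, ht.2.le⟩

end ModalSolutions

/-! ### Curves of sine coefficients -/

section Lifts

open scoped lp

variable {r s t : ℝ} {I : Set ℝ} {U V : ℓ²(ℕ+, ℝ)} {a c d : ℕ+ → ℝ}

/-- `U` is the sequence of weighted coefficients `j^r c_j`, whose membership in `ℓ²` says that
`∑ c_j φ_j` lies in `H^r_*`. Curves in `H^r_*` are handled through their lifts to `ℓ²`. -/
def IsLift (r : ℝ) (U : ℓ²(ℕ+, ℝ)) (c : ℕ+ → ℝ) : Prop := ∀ j : ℕ+, U j = (j : ℝ) ^ r * c j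

theorem isLift_div (r : ℝ) (U : ℓ²(ℕ+, ℝ)) : IsLift r U fun j => U j / (j : ℝ) ^ r := fun j =>
  (mul_div_cancel₀ _ (rpow_pos_of_pos (pnat_cast_pos j) r).ne').symm

theorem IsLift.eq_div (h : IsLift r U c) (j : ℕ+) : c j = U j / (j : ℝ) ^ r :=
  eq_div_of_mul_eq (rpow_pos_of_pos (pnat_cast_pos j) r).ne' (by rw [h j, mul_comm])

theorem IsLift.summable_rpow_mul_sq (h : IsLift r U c) :
    Summable fun j : ℕ+ => (j : ℝ) ^ (2 * r) * c j ^ 2 :=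
  (lpTwo_summable_sq U).congr fun j => by rw [h j, mul_pow, pnat_rpow_sq]

theorem IsLift.summable_abs (hs : 1 / 2 < s) (h : IsLift s U c) : Summable fun j => |c j| := by
  simpa using summable_rpow_mul_abs (k := 0) (by linarith) h.summable_rpow_mul_sq

theorem summable_rpow_neg_mul_sq (hs : 1 / 2 < s) {C : ℝ} (ha : ∀ j, |a j| ≤ C) :
    Summable fun j : ℕ+ => ((j : ℝ) ^ (-s) * a j) ^ 2 := by
  have hsum : Summable fun j : ℕ+ => C ^ 2 * (j : ℝ) ^ (2 * -s) :=
    ((Real.summable_nat_rpow.2 (by linarith)).comp_injective PNat.coe_injective).mul_left _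
  refine hsum.of_nonneg_of_le (fun _ => sq_nonneg _) fun j => ?_
  rw [mul_pow, pnat_rpow_sq, mul_comm, ← sq_abs (a j)]
  gcongr
  exact ha j

theorem IsLift.hasSum_mul (ha : Summable fun j : ℕ+ => ((j : ℝ) ^ (-r) * a j) ^ 2)
    (h : IsLift r U c) :
    HasSum (fun j => c j * a j) (lpTwoPairing (fun j : ℕ+ => (j : ℝ) ^ (-r) * a j) ha U) := by
  convert hasSum_lpTwoPairing ha U using 2 with j
  have hj := pnat_cast_pos j
  rw [h j, Real.rpow_neg hj.le]
  field_simp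

theorem hasDerivAt_tsum_mul_of_isLift (ha : Summable fun j : ℕ+ => ((j : ℝ) ^ (-r) * a j) ^ 2)
    {U : ℝ → ℓ²(ℕ+, ℝ)} {c : ℝ → ℕ+ → ℝ} (hU : ∀ᶠ τ in 𝓝 t, IsLift r (U τ) (c τ))
    (hV : IsLift r V d) (h : HasDerivAt U V t) :
    HasDerivAt (fun τ => ∑' j, c τ j * a j) (∑' j, d j * a j) t := by
  rw [(hV.hasSum_mul ha).tsum_eq]
  refine ((lpTwoPairing _ ha).hasFDerivAt.comp_hasDerivAt t h).congr_of_eventuallyEq ?_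
  filter_upwards [hU] with τ hτ using (hτ.hasSum_mul ha).tsum_eq

theorem hasDerivAt_sineSeries_of_isLift (hs : 1 / 2 < s) {U : ℝ → ℓ²(ℕ+, ℝ)} {c : ℝ → ℕ+ → ℝ}
    (hU : ∀ᶠ τ in 𝓝 t, IsLift s (U τ) (c τ)) (hV : IsLift s V d) (h : HasDerivAt U V t) (x : ℝ) :
    HasDerivAt (fun τ => sineSeries (c τ) x) (sineSeries d x) t :=
  hasDerivAt_tsum_mul_of_isLift (summable_rpow_neg_mul_sq hs fun j => abs_phi_le j x) hU hV h

theorem hasDerivAt_apply_of_isLift {U : ℝ → ℓ²(ℕ+, ℝ)} {c : ℝ → ℕ+ → ℝ}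
    (hU : ∀ᶠ τ in 𝓝 t, IsLift r (U τ) (c τ)) (hV : IsLift r V d) (h : HasDerivAt U V t) (j : ℕ+) :
    HasDerivAt (fun τ => c τ j) (d j) t := by
  rw [hV.eq_div j]
  refine ((hasDerivAt_lp_apply h j).div_const _).congr_of_eventuallyEq ?_
  filter_upwards [hU] with τ hτ using hτ.eq_div j

theorem hasDerivAt_of_isLift (hI : IsOpen I) (hc : I.OrdConnected) {U V : ℝ → ℓ²(ℕ+, ℝ)}
    {c d : ℝ → ℕ+ → ℝ} (hU : ∀ t ∈ I, IsLift r (U t) (c t)) (hV : ∀ t ∈ I, IsLift r (V t) (d t))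
    (hVc : ContinuousOn V I) (h : ∀ t ∈ I, ∀ j, HasDerivAt (fun τ => c τ j) (d t j) t)
    (ht : t ∈ I) : HasDerivAt U (V t) t := by
  refine hasDerivAt_lp_of_apply hI hc hVc (fun t ht j => ?_) ht
  rw [hV t ht j]
  refine ((h t ht j).const_mul _).congr_of_eventuallyEq ?_
  filter_upwards [hI.mem_nhds ht] with τ hτ using hU τ hτ j

end Lifts

section WeakForm

open scoped lp

variable {m s t : ℝ} {I : Set ℝ} {f η : ℝ → ℝ}

/-- The acceleration of the `j`-th mode prescribed by the beam equation, for the positions `c`. -/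
def modalAccel (m : ℝ) (c : ℕ+ → ℝ) (j : ℕ+) : ℝ :=
  -((omegaFreq m j ^ 2 + 1 / (2 * π) * modalStretch c * (j : ℝ) ^ 2) * c j)

theorem modalAccel_eq (hm : -1 < m) (c : ℕ+ → ℝ) (j : ℕ+) :
    modalAccel m c j
      = -(((j : ℝ) ^ 4 + (m + 1 / (2 * π) * modalStretch c) * (j : ℝ) ^ 2) * c j) := by
  rw [modalAccel, omegaFreq_sq hm]
  ring

theorem summable_abs_modalAccel_div_sq (hm : -1 < m) {c : ℕ+ → ℝ} (hc : Summable fun j => |c j|)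
    (hc₂ : Summable fun j : ℕ+ => |(j : ℝ) ^ 2 * c j|) :
    Summable fun j : ℕ+ => |modalAccel m c j / (j : ℝ) ^ 2| := by
  refine (hc₂.add (hc.mul_left |m + 1 / (2 * π) * modalStretch c|)).of_nonneg_of_le
    (fun _ => abs_nonneg _) fun j => ?_
  have := pnat_cast_pos j
  have hdiv : modalAccel m c j / (j : ℝ) ^ 2
      = -((j : ℝ) ^ 2 * c j + (m + 1 / (2 * π) * modalStretch c) * c j) := by
    rw [modalAccel_eq hm]
    field_simp
  rw [hdiv, abs_neg, ← abs_mul (m + _)]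
  exact abs_add_le _ _

theorem IsSineRegular.hasSum_weak_form (hm : -1 < m) (hf : IsSineRegular f)
    (hη : IsTestFunction η) :
    HasSum (fun j => -modalAccel m (sineCoeff f) j * sineCoeff η j)
      ((∫ x in (0 : ℝ)..π, iteratedDeriv 2 f x * iteratedDeriv 2 η x)
        + (m + 1 / (2 * π) * ∫ x in (0 : ℝ)..π, deriv f x ^ 2)
          * (∫ x in (0 : ℝ)..π, deriv f x * deriv η x)) := by
  have hbend := hf.hasSum_integral_iteratedDeriv_two_mul hη.iteratedDeriv_two.continuous
  have htension := hf.hasSum_integral_deriv_mul hη.deriv.continuous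
  simp_rw [hη.sineCoeff_iteratedDeriv_two] at hbend
  simp_rw [integral_psi_mul_deriv hη.hasDerivAt hη.deriv.continuous hη.apply_zero
    hη.apply_pi] at htension
  have hstretch : ∫ x in (0 : ℝ)..π, deriv f x ^ 2 = modalStretch (sineCoeff f) :=
    hf.hasSum_integral_deriv_sq.tsum_eq.symm
  rw [hstretch]
  convert hbend.add (htension.mul_left (m + 1 / (2 * π) * modalStretch (sineCoeff f))) using 2
    with j
  rw [modalAccel_eq hm]
  ring

theorem IsTestFunction.summable_rpow_mul_sineCoeff_sq (hη : IsTestFunction η) (hs : 1 / 2 < s) :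
    Summable fun j : ℕ+ => ((j : ℝ) ^ (-(s - 2)) * sineCoeff η j) ^ 2 := by
  obtain ⟨C, hC⟩ := hη.exists_sq_mul_abs_sineCoeff_le
  refine (summable_rpow_neg_mul_sq hs (a := fun j => (j : ℝ) ^ 2 * sineCoeff η j) (C := C)
    fun j => ?_).congr fun j => ?_
  · rw [abs_mul, abs_of_nonneg (by positivity)]
    exact hC j
  · rw [neg_sub', sub_neg_eq_add, Real.rpow_add (pnat_cast_pos j), Real.rpow_two, mul_assoc]

theorem iteratedDeriv_two_eq_of_hasDerivAt {f f' : ℝ → ℝ} {f'' : ℝ}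
    (hf : ∀ᶠ τ in 𝓝 t, HasDerivAt f (f' τ) τ) (hf' : HasDerivAt f' f'' t) :
    iteratedDeriv 2 f t = f'' := by
  have hderiv : deriv f =ᶠ[𝓝 t] f' := hf.mono fun τ hτ => hτ.deriv
  rw [iteratedDeriv_succ, iteratedDeriv_one, hderiv.deriv_eq, hf'.deriv]

theorem IsTestFunction.hasSum_iteratedDeriv_two (hη : IsTestFunction η) (hs : 1 / 2 < s)
    (hI : IsOpen I) {u : ℝ → ℝ → ℝ} (hu : ∀ t ∈ I, IsSineRegular (u t)) {U V A : ℝ → ℓ²(ℕ+, ℝ)}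
    (hU : ∀ t ∈ I, IsLift (s - 2) (U t) (sineCoeff (u t)))
    (hUV : ∀ t ∈ I, HasDerivAt U (V t) t) (hVA : ∀ t ∈ I, HasDerivAt V (A t) t) (ht : t ∈ I)
    {a : ℕ+ → ℝ} (ha : IsLift (s - 2) (A t) a) :
    HasSum (fun j => a j * sineCoeff η j)
      (iteratedDeriv 2 (fun τ => ∫ x in (0 : ℝ)..π, u τ x * η x) t) := by
  have hηs := hη.summable_rpow_mul_sineCoeff_sq hs
  have hpair : ∀ τ ∈ I,
      ∫ x in (0 : ℝ)..π, u τ x * η x = ∑' j, sineCoeff (u τ) j * sineCoeff η j :=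
    fun τ hτ => ((hu τ hτ).hasSum_integral_mul hη.continuous).tsum_eq.symm
  have hfst : ∀ᶠ τ in 𝓝 t, HasDerivAt (fun τ => ∫ x in (0 : ℝ)..π, u τ x * η x)
      (∑' j, V τ j / (j : ℝ) ^ (s - 2) * sineCoeff η j) τ := by
    filter_upwards [hI.mem_nhds ht] with τ hτ
    have hτI := hI.mem_nhds hτ
    exact (hasDerivAt_tsum_mul_of_isLift hηs (eventually_of_mem hτI hU) (isLift_div _ _)
      (hUV τ hτ)).congr_of_eventuallyEq (eventually_of_mem hτI hpair)
  rw [iteratedDeriv_two_eq_of_hasDerivAt hfst (hasDerivAt_tsum_mul_of_isLift hηs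
    (Eventually.of_forall fun τ => isLift_div _ _) ha (hVA t ht))]
  exact (ha.hasSum_mul hηs).summable.hasSum

end WeakForm

/-! ### From weak solutions to modal curves -/

section WeakToModal

open scoped lp

variable {m s r t : ℝ} {I : Set ℝ} {u₀ v₀ : ℝ → ℝ} {u : ℝ → ℝ → ℝ}

/-- The coefficient curves of a solution of the beam equation: positions `c`, continuous in
`H^{s+2}_*`, and velocities `d`, continuous in `H^s_*`, with every mode obeying its equation. -/
structure IsModalCurve (m s : ℝ) (I : Set ℝ) (c d : ℝ → ℕ+ → ℝ) : Prop where
  exists_lift_pos : ∃ U : ℝ → ℓ²(ℕ+, ℝ), ContinuousOn U I ∧ ∀ t ∈ I, IsLift (s + 2) (U t) (c t)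
  exists_lift_vel : ∃ V : ℝ → ℓ²(ℕ+, ℝ), ContinuousOn V I ∧ ∀ t ∈ I, IsLift s (V t) (d t)
  hasDerivAt_pos : ∀ t ∈ I, ∀ j, HasDerivAt (fun τ => c τ j) (d t j) t
  hasDerivAt_vel : ∀ t ∈ I, ∀ j, HasDerivAt (fun τ => d τ j) (modalAccel m (c t) j) t

theorem sineCoeff_congr {f g : ℝ → ℝ} (h : EqOn f g (Icc 0 π)) : sineCoeff f = sineCoeff g :=
  funext fun j => intervalIntegral.integral_congr fun x hx => by
    rw [uIcc_of_le pi_pos.le] at hx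
    simp only [h hx]

theorem hasDerivAt_deriv_and_contDiffOn_deriv {E : Type*} [NormedAddCommGroup E] [NormedSpace ℝ E]
    {U : ℝ → E} {n : ℕ} (hI : IsOpen I) (hU : ContDiffOn ℝ ((n + 1 : ℕ) : WithTop ℕ∞) U I) :
    (∀ t ∈ I, HasDerivAt U (deriv U t) t) ∧ ContDiffOn ℝ n (deriv U) I := by
  rw [Nat.cast_add_one, contDiffOn_succ_iff_deriv_of_isOpen hI] at hU
  exact ⟨fun t ht => (hU.1.differentiableAt (hI.mem_nhds ht)).hasDerivAt, hU.2.2⟩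

theorem IsLift.div_sq {U : ℓ²(ℕ+, ℝ)} {c : ℕ+ → ℝ} (h : IsLift (s - 2) U c) :
    IsLift s U fun j => c j / (j : ℝ) ^ 2 := fun j => by
  rw [h j, Real.rpow_sub (pnat_cast_pos j), Real.rpow_two]
  ring

theorem IsWeakSolution.isSineRegular (hs : 1 / 2 < s) (h : IsWeakSolution m s I u₀ v₀ u) :
    ∀ t ∈ I, IsSineRegular (u t) := fun t ht => (h.mem t ht).isSineRegular hs

theorem IsWeakSolution.isLift_modalAccel (hm : -1 < m) (hs : 1 / 2 < s) (hI : IsOpen I)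
    (h : IsWeakSolution m s I u₀ v₀ u) {U V A : ℝ → ℓ²(ℕ+, ℝ)}
    (hU : ∀ t ∈ I, IsLift (s - 2) (U t) (sineCoeff (u t)))
    (hUV : ∀ t ∈ I, HasDerivAt U (V t) t) (hVA : ∀ t ∈ I, HasDerivAt V (A t) t) (ht : t ∈ I) :
    IsLift (s - 2) (A t) (modalAccel m (sineCoeff (u t))) := by
  have ha := isLift_div (s - 2) (A t)
  set a : ℕ+ → ℝ := fun j => A t j / (j : ℝ) ^ (s - 2)
  have hreg := h.isSineRegular hs
  have hsum : Summable fun j : ℕ+ => |(a j - modalAccel m (sineCoeff (u t)) j) / (j : ℝ) ^ 2| := by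
    refine ((ha.div_sq.summable_abs hs).add (summable_abs_modalAccel_div_sq hm
      (hreg t ht).summable_zero (hreg t ht).summable_two)).of_nonneg_of_le
      (fun _ => abs_nonneg _) fun j => ?_
    rw [sub_div]
    exact abs_sub _ _
  have hweak (η : ℝ → ℝ) (hη : IsTestFunction η) :
      HasSum (fun j => (a j - modalAccel m (sineCoeff (u t)) j) * sineCoeff η j) 0 := by
    rw [← h.weak_eq t ht η hη, add_assoc]
    convert (hη.hasSum_iteratedDeriv_two hs hI hreg hU hUV hVA ht ha).add
      ((hreg t ht).hasSum_weak_form hm hη) using 2 with j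
    ring
  intro j
  rw [ha j, sub_eq_zero.1 (eq_zero_of_hasSum_mul_sineCoeff hsum hweak j)]

theorem IsWeakSolution.velocity_zero (hs : 1 / 2 < s) (hI : IsTimeInterval I)
    (h : IsWeakSolution m s I u₀ v₀ u) {U V : ℝ → ℓ²(ℕ+, ℝ)}
    (hU : ∀ t ∈ I, IsLift s (U t) (sineCoeff (u t))) (hUV : ∀ t ∈ I, HasDerivAt U (V t) t)
    {d : ℕ+ → ℝ} (hd : IsLift s (V 0) d) : d = sineCoeff v₀ := by
  have hI₀ := hI.1.mem_nhds hI.2.2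
  have habs := hd.summable_abs hs
  refine funext fun j => (sineCoeff_of_hasSum habs (fun x hx => ?_) j).symm
  have hx' := Ioo_subset_Icc_self hx
  have hvel : HasDerivAt (fun t => u t x) (sineSeries d x) 0 :=
    (hasDerivAt_sineSeries_of_isLift hs (eventually_of_mem hI₀ hU) hd
      (hUV 0 hI.2.2) x).congr_of_eventuallyEq
      (eventually_of_mem hI₀ fun τ hτ => (h.mem τ hτ).eq_sineSeries hx')
  rw [(h.init_vel x hx').unique hvel]
  exact hasSum_sineSeries habs x

theorem IsWeakSolution.exists_isModalCurve (hm : -1 < m) (hs : 1 / 2 < s) (hI : IsTimeInterval I)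
    (h : IsWeakSolution m s I u₀ v₀ u) :
    ∃ d, IsModalCurve m s I (fun t => sineCoeff (u t)) d ∧ d 0 = sineCoeff v₀ := by
  obtain ⟨U₀, hU₀, hU₀c⟩ := h.continuous
  obtain ⟨U₁, hU₁, hU₁c⟩ := h.contDiff_one
  obtain ⟨U₂, hU₂, hU₂c⟩ := h.contDiff_two
  obtain ⟨hU₁V, hV⟩ := hasDerivAt_deriv_and_contDiffOn_deriv (n := 0) hI.1 hU₁
  obtain ⟨hU₂V, hV₂⟩ := hasDerivAt_deriv_and_contDiffOn_deriv (n := 1) hI.1 hU₂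
  obtain ⟨hV₂A, -⟩ := hasDerivAt_deriv_and_contDiffOn_deriv (n := 0) hI.1 hV₂
  set d : ℝ → ℕ+ → ℝ := fun t j => deriv U₁ t j / (j : ℝ) ^ s
  have hd : ∀ t, IsLift s (deriv U₁ t) (d t) := fun t => isLift_div s _
  have hpos : ∀ t ∈ I, ∀ j, HasDerivAt (fun τ => sineCoeff (u τ) j) (d t j) t := fun t ht =>
    hasDerivAt_apply_of_isLift (eventually_of_mem (hI.1.mem_nhds ht) hU₁c) (hd t) (hU₁V t ht)
  -- Both regularity levels compute the same velocity, so it lifts to `H^{s-2}_*` as well.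
  have hd₂ : ∀ t ∈ I, IsLift (s - 2) (deriv U₂ t) (d t) := fun t ht j => by
    rw [isLift_div (s - 2) (deriv U₂ t) j]
    exact congrArg _ ((hasDerivAt_apply_of_isLift (eventually_of_mem (hI.1.mem_nhds ht) hU₂c)
      (isLift_div (s - 2) _) (hU₂V t ht) j).unique (hpos t ht j))
  exact ⟨d, ⟨⟨U₀, hU₀.continuousOn, hU₀c⟩, ⟨deriv U₁, hV.continuousOn, fun t _ => hd t⟩, hpos,
    fun t ht => hasDerivAt_apply_of_isLift (eventually_of_mem (hI.1.mem_nhds ht) hd₂)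
      (h.isLift_modalAccel hm hs hI.1 hU₂c hU₂V hV₂A ht) (hV₂A t ht)⟩,
    h.velocity_zero hs hI hU₁c hU₁V (hd 0)⟩

end WeakToModal

/-! ### Modal curves in oscillator variables -/

section Oscillator

open scoped lp

variable {m s r : ℝ} {I : Set ℝ}

theorem omegaFreq_sq_div_le (hm : -1 < m) (j : ℕ+) :
    omegaFreq m j ^ 2 / (j : ℝ) ^ 4 ≤ 1 + |m| := by
  have hj := one_le_pnat_cast j
  rw [div_le_iff₀ (by positivity), omegaFreq_sq hm]
  have htension : m * (j : ℝ) ^ 2 ≤ |m| * (j : ℝ) ^ 4 := by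
    gcongr
    exacts [le_abs_self m, by norm_num]
  linarith

theorem omegaFreq_div_sq_le (hm : -1 < m) (j : ℕ+) :
    omegaFreq m j / (j : ℝ) ^ 2 ≤ 1 + |m| := by
  refine le_of_sq_le_sq ?_ (by positivity)
  calc (omegaFreq m j / (j : ℝ) ^ 2) ^ 2 = omegaFreq m j ^ 2 / (j : ℝ) ^ 4 := by ring
    _ ≤ 1 + |m| := omegaFreq_sq_div_le hm j
    _ ≤ (1 + |m|) ^ 2 := le_self_pow₀ (by linarith [abs_nonneg m]) two_ne_zero

/-- The weighted positions `j^{s+2} c_j` of a state in `H^{s+2}_* × H^s_*`. -/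
def positionOp : ℓ²(ℕ+, ℂ) →L[ℝ] ℓ²(ℕ+, ℝ) :=
  diagOp (fun _ => Complex.reLm) 1 fun _ x => by
    rw [one_mul]
    exact Complex.abs_re_le_norm x

/-- The weighted velocities `j^s d_j` of a state in `H^{s+2}_* × H^s_*`. -/
def velocityOp (hm : -1 < m) : ℓ²(ℕ+, ℂ) →L[ℝ] ℓ²(ℕ+, ℝ) :=
  diagOp (fun j => (omegaFreq m j / (j : ℝ) ^ 2) • Complex.imLm) (1 + |m|) fun j x => by
    rw [LinearMap.smul_apply, norm_smul,
      Real.norm_of_nonneg (div_nonneg (omegaFreq_pos hm j).le (sq_nonneg _))]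
    exact mul_le_mul (omegaFreq_div_sq_le hm j) (Complex.abs_im_le_norm x) (norm_nonneg _)
      (by positivity)

theorem isLift_positionOp (r : ℝ) (z : ℓ²(ℕ+, ℂ)) : IsLift r (positionOp z) (modePosition r z) :=
  isLift_div r (positionOp z)

theorem isLift_velocityOp (hm : -1 < m) (s : ℝ) (z : ℓ²(ℕ+, ℂ)) :
    IsLift s (velocityOp hm z) fun j => omegaFreq m j * modeMomentum (s + 2) z j := fun j => by
  have hj := pnat_cast_pos j
  change omegaFreq m j / (j : ℝ) ^ 2 * (z j).im
    = (j : ℝ) ^ s * (omegaFreq m j * ((z j).im / (j : ℝ) ^ (s + 2)))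
  rw [Real.rpow_add hj, Real.rpow_two]
  field_simp

/-- The state in `H^{s+2}_* × H^s_*` with weighted positions `U` and weighted velocities `V`. -/
def stateOf (hm : -1 / 2 ≤ m) (U V : ℓ²(ℕ+, ℝ)) : ℓ²(ℕ+, ℂ) :=
  diagOp (fun _ => LinearMap.toSpanSingleton ℝ ℂ 1) 1 (fun _ x => by simp) U
    + diagOp
      (fun j : ℕ+ => LinearMap.toSpanSingleton ℝ ℂ (((j : ℝ) ^ 2 / omegaFreq m j) • Complex.I))
      (3 / 2) (fun j x => by
        rw [LinearMap.toSpanSingleton_apply, norm_smul, norm_smul, Complex.norm_I, mul_one,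
          Real.norm_of_nonneg (sq_div_omegaFreq_nonneg m j), mul_comm]
        exact mul_le_mul_of_nonneg_right (sq_div_omegaFreq_le hm j) (norm_nonneg x)) V

theorem continuousOn_stateOf (hm : -1 / 2 ≤ m) {U V : ℝ → ℓ²(ℕ+, ℝ)} (hU : ContinuousOn U I)
    (hV : ContinuousOn V I) : ContinuousOn (fun t => stateOf hm (U t) (V t)) I :=
  (ContinuousLinearMap.continuous _ |>.comp_continuousOn hU).add
    (ContinuousLinearMap.continuous _ |>.comp_continuousOn hV)

theorem stateOf_apply (hm : -1 / 2 ≤ m) (U V : ℓ²(ℕ+, ℝ)) (j : ℕ+) :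
    stateOf hm U V j = ⟨U j, (j : ℝ) ^ 2 / omegaFreq m j * V j⟩ := by
  change U j • (1 : ℂ) + V j • (((j : ℝ) ^ 2 / omegaFreq m j) • Complex.I) = _
  apply Complex.ext <;> simp [pow_two, mul_comm]

theorem modePosition_stateOf (hm : -1 / 2 ≤ m) {U : ℓ²(ℕ+, ℝ)} (V : ℓ²(ℕ+, ℝ)) {c : ℕ+ → ℝ}
    (hU : IsLift r U c) : modePosition r (stateOf hm U V) = c :=
  funext fun j => by rw [modePosition, stateOf_apply, hU.eq_div j]

theorem modeMomentum_stateOf (hm : -1 / 2 ≤ m) (U : ℓ²(ℕ+, ℝ)) {V : ℓ²(ℕ+, ℝ)} {d : ℕ+ → ℝ}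
    (hV : IsLift s V d) :
    modeMomentum (s + 2) (stateOf hm U V) = fun j => d j / omegaFreq m j :=
  funext fun j => by
    have hj := pnat_cast_pos j
    rw [modeMomentum, stateOf_apply, hV j, Real.rpow_add hj, Real.rpow_two]
    field_simp

theorem eq_mk_modePosition_modeMomentum (r : ℝ) (z : ℕ+ → ℂ) (j : ℕ+) :
    z j = ⟨(j : ℝ) ^ r * modePosition r z j, (j : ℝ) ^ r * modeMomentum r z j⟩ := by
  have := rpow_pos_of_pos (pnat_cast_pos j) r
  apply Complex.ext <;> simp only [modePosition, modeMomentum] <;> field_simp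

theorem state_ext {z w : ℓ²(ℕ+, ℂ)} (hpos : modePosition r z = modePosition r w)
    (hmom : modeMomentum r z = modeMomentum r w) : z = w :=
  lp.ext <| funext fun j => by
    rw [eq_mk_modePosition_modeMomentum r z, hpos, hmom, ← eq_mk_modePosition_modeMomentum]

theorem hasDerivAt_complex_mk {a b : ℝ → ℝ} {a' b' t : ℝ} (ha : HasDerivAt a a' t)
    (hb : HasDerivAt b b' t) : HasDerivAt (fun τ => (⟨a τ, b τ⟩ : ℂ)) ⟨a', b'⟩ t := by
  simpa only [Complex.mk_eq_add_mul_I] using ha.ofReal_comp.fun_add (hb.ofReal_comp.mul_const _)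

theorem IsModalCurve.exists_isModalSolution (hm : -1 / 2 ≤ m) {c d : ℝ → ℕ+ → ℝ} (hI : IsOpen I)
    (h : IsModalCurve m s I c d) :
    ∃ z, IsModalSolution m (s + 2) I z ∧ ∀ t ∈ I, modePosition (s + 2) (z t) = c t ∧
      modeMomentum (s + 2) (z t) = fun j => d t j / omegaFreq m j := by
  obtain ⟨U, hU, hUc⟩ := h.exists_lift_pos
  obtain ⟨V, hV, hVd⟩ := h.exists_lift_vel
  have hpos : ∀ t ∈ I, modePosition (s + 2) (stateOf hm (U t) (V t)) = c t := fun t ht =>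
    modePosition_stateOf hm (V t) (hUc t ht)
  have hmom : ∀ t ∈ I, modeMomentum (s + 2) (stateOf hm (U t) (V t))
      = fun j => d t j / omegaFreq m j := fun t ht => modeMomentum_stateOf hm (U t) (hVd t ht)
  refine ⟨fun t => stateOf hm (U t) (V t), ⟨continuousOn_stateOf hm hU hV, fun t ht j => ?_⟩,
    fun t ht => ⟨hpos t ht, hmom t ht⟩⟩
  have hω := omegaFreq_pos (by linarith : -1 < m) j
  refine ((hasDerivAt_complex_mk ((h.hasDerivAt_pos t ht j).const_mul ((j : ℝ) ^ (s + 2)))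
    (((h.hasDerivAt_vel t ht j).div_const (omegaFreq m j)).const_mul
      ((j : ℝ) ^ (s + 2)))).congr_of_eventuallyEq ?_).congr_deriv ?_
  · filter_upwards [hI.mem_nhds ht] with τ hτ
    rw [eq_mk_modePosition_modeMomentum (s + 2) (stateOf hm (U τ) (V τ)), hpos τ hτ, hmom τ hτ]
  · rw [modeForce, hpos t ht, eq_mk_modePosition_modeMomentum (s + 2) (stateOf hm (U t) (V t)),
      hpos t ht, hmom t ht, modalAccel]
    apply Complex.ext <;>
      simp only [Complex.add_re, Complex.add_im, Complex.neg_re, Complex.neg_im, Complex.mul_re,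
        Complex.mul_im, Complex.ofReal_re, Complex.ofReal_im, Complex.I_re, Complex.I_im] <;>
      field_simp <;> ring

theorem IsModalSolution.isModalCurve (hm : -1 < m) {z : ℝ → ℓ²(ℕ+, ℂ)}
    (hz : IsModalSolution m (s + 2) I z) :
    IsModalCurve m s I (fun t => modePosition (s + 2) (z t))
      fun t j => omegaFreq m j * modeMomentum (s + 2) (z t) j where
  exists_lift_pos := ⟨fun t => positionOp (z t), positionOp.continuous.comp_continuousOn hz.1,
    fun t _ => isLift_positionOp _ (z t)⟩
  exists_lift_vel := ⟨fun t => velocityOp hm (z t),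
    (velocityOp hm).continuous.comp_continuousOn hz.1, fun t _ => isLift_velocityOp hm s (z t)⟩
  hasDerivAt_pos := fun t ht j => hasDerivAt_modePosition (hz.2 t ht j)
  hasDerivAt_vel := fun t ht j => by
    refine ((hasDerivAt_modeMomentum (hz.2 t ht j)).const_mul _).congr_deriv ?_
    have := omegaFreq_pos hm j
    rw [modalAccel]
    field_simp
    ring

end Oscillator

/-! ### From modal curves to weak solutions -/

section ModalToWeak

open scoped lp

variable {m s r q t : ℝ} {I : Set ℝ} {u₀ v₀ : ℝ → ℝ} {u : ℝ → ℝ → ℝ} {c d : ℝ → ℕ+ → ℝ}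

theorem contDiffOn_succ_of_hasDerivAt {E : Type*} [NormedAddCommGroup E] [NormedSpace ℝ E]
    (hI : IsOpen I) {n : ℕ} {U V : ℝ → E} (h : ∀ t ∈ I, HasDerivAt U (V t) t)
    (hV : ContDiffOn ℝ n V I) : ContDiffOn ℝ ((n + 1 : ℕ) : WithTop ℕ∞) U I := by
  rw [Nat.cast_add_one]
  exact (contDiffOn_succ_iff_deriv_of_isOpen hI).2
    ⟨fun t ht => (h t ht).differentiableAt.differentiableWithinAt, by simp,
      hV.congr fun t ht => (h t ht).deriv⟩

/-- Division of the `j`-th entry by `j^n`, which turns lifts to `H^r_*` into lifts to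
`H^{r-n}_*`. -/
def lowerOp (n : ℕ) : ℓ²(ℕ+, ℝ) →L[ℝ] ℓ²(ℕ+, ℝ) :=
  multiplierOp (fun j : ℕ+ => ((j : ℝ) ^ n)⁻¹) 1 fun j => by
    rw [abs_of_nonneg (by positivity)]
    exact inv_le_one_of_one_le₀ (one_le_pow₀ (one_le_pnat_cast j))

theorem IsLift.lowerOp {U : ℓ²(ℕ+, ℝ)} {c : ℕ+ → ℝ} {n : ℕ} (h : IsLift r U c) (hr : q + n = r) :
    IsLift q (lowerOp n U) c := fun j => by
  have hj := pnat_cast_pos j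
  change ((j : ℝ) ^ n)⁻¹ * U j = _
  rw [h j, ← hr, Real.rpow_add hj, Real.rpow_natCast]
  field_simp

theorem continuousOn_modalStretch (hr : 1 ≤ r) {U : ℝ → ℓ²(ℕ+, ℝ)} (hU : ContinuousOn U I)
    (hUc : ∀ t ∈ I, IsLift r (U t) (c t)) : ContinuousOn (fun t => modalStretch (c t)) I := by
  have hbound (j : ℕ+) : |(j : ℝ) ^ (1 - r)| ≤ 1 := by
    rw [abs_of_nonneg (by positivity)]
    exact Real.rpow_le_one_of_one_le_of_nonpos (one_le_pnat_cast j) (by linarith)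
  refine (continuousOn_tsum_sq hU hbound).congr fun t ht => tsum_congr fun j => ?_
  rw [hUc t ht, ← mul_assoc, ← Real.rpow_add (pnat_cast_pos j), sub_add_cancel, Real.rpow_one,
    mul_pow]

theorem exists_lift_modalAccel (hm : -1 < m) (hs : -1 ≤ s) {U : ℝ → ℓ²(ℕ+, ℝ)}
    (hU : ContinuousOn U I) (hUc : ∀ t ∈ I, IsLift (s + 2) (U t) (c t)) :
    ∃ A : ℝ → ℓ²(ℕ+, ℝ), ContinuousOn A I ∧
      ∀ t ∈ I, IsLift (s - 2) (A t) (modalAccel m (c t)) := by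
  have hsymbol (j : ℕ+) : |omegaFreq m j ^ 2 / (j : ℝ) ^ 4| ≤ 1 + |m| := by
    rw [abs_of_nonneg (by positivity)]
    exact omegaFreq_sq_div_le hm j
  set bend : ℓ²(ℕ+, ℝ) →L[ℝ] ℓ²(ℕ+, ℝ) := multiplierOp _ _ hsymbol
  refine ⟨fun t => -bend (U t) - (1 / (2 * π) * modalStretch (c t)) • lowerOp 2 (U t),
    (bend.continuous.comp_continuousOn hU).neg.sub
      ((continuousOn_const.mul (continuousOn_modalStretch (by linarith) hU hUc)).smul
        ((lowerOp 2).continuous.comp_continuousOn hU)), fun t ht j => ?_⟩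
  have hj := pnat_cast_pos j
  change -(omegaFreq m j ^ 2 / (j : ℝ) ^ 4 * U t j)
    - 1 / (2 * π) * modalStretch (c t) * (((j : ℝ) ^ 2)⁻¹ * U t j) = _
  rw [hUc t ht, Real.rpow_add hj, Real.rpow_sub hj, Real.rpow_two, modalAccel]
  field_simp
  ring

theorem sineCoeff_sineSeries_of_isLift (hr : 1 / 2 < r) {U : ℓ²(ℕ+, ℝ)} {c : ℕ+ → ℝ}
    (h : IsLift r U c) : sineCoeff (sineSeries c) = c :=
  funext (sineCoeff_sineSeries (h.summable_abs hr))

theorem memHstar_sineSeries (hr : 1 / 2 < r) {U : ℓ²(ℕ+, ℝ)} {c : ℕ+ → ℝ} (h : IsLift r U c) :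
    MemHstar r (sineSeries c) := by
  rw [MemHstar, sineCoeff_sineSeries_of_isLift hr h]
  exact ⟨h.summable_rpow_mul_sq, fun x _ => hasSum_sineSeries (h.summable_abs hr) x⟩

theorem weak_eq_of_isLift_modalAccel (hm : -1 < m) (hs : 1 / 2 < s) (hI : IsOpen I)
    (hu : ∀ t ∈ I, IsSineRegular (u t)) {U V A : ℝ → ℓ²(ℕ+, ℝ)}
    (hU : ∀ t ∈ I, IsLift (s - 2) (U t) (sineCoeff (u t)))
    (hUV : ∀ t ∈ I, HasDerivAt U (V t) t) (hVA : ∀ t ∈ I, HasDerivAt V (A t) t) (ht : t ∈ I)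
    (hA : IsLift (s - 2) (A t) (modalAccel m (sineCoeff (u t)))) {η : ℝ → ℝ}
    (hη : IsTestFunction η) :
    iteratedDeriv 2 (fun τ => ∫ x in (0 : ℝ)..π, u τ x * η x) t
      + (∫ x in (0 : ℝ)..π, iteratedDeriv 2 (u t) x * iteratedDeriv 2 η x)
      + (m + 1 / (2 * π) * ∫ x in (0 : ℝ)..π, deriv (u t) x ^ 2)
          * (∫ x in (0 : ℝ)..π, deriv (u t) x * deriv η x) = 0 := by
  have hsum := (hη.hasSum_iteratedDeriv_two hs hI hu hU hUV hVA ht hA).add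
    ((hu t ht).hasSum_weak_form hm hη)
  simp only [neg_mul, add_neg_cancel] at hsum
  rw [add_assoc]
  exact hsum.unique hasSum_zero

theorem IsModalCurve.exists_lifts (hm : -1 < m) (hs : -1 ≤ s) (hI : IsOpen I)
    (hIc : I.OrdConnected) (h : IsModalCurve m s I c d) :
    ∃ U V A : ℝ → ℓ²(ℕ+, ℝ), (ContinuousOn U I ∧ ContinuousOn V I ∧ ContinuousOn A I) ∧
      (∀ t ∈ I, IsLift (s + 2) (U t) (c t) ∧ IsLift s (V t) (d t) ∧
        IsLift (s - 2) (A t) (modalAccel m (c t))) ∧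
      ∀ t ∈ I, HasDerivAt (fun τ => lowerOp 2 (U τ)) (V t) t ∧
        HasDerivAt (fun τ => lowerOp 4 (U τ)) (lowerOp 2 (V t)) t ∧
        HasDerivAt (fun τ => lowerOp 2 (V τ)) (A t) t := by
  obtain ⟨U, hU, hUc⟩ := h.exists_lift_pos
  obtain ⟨V, hV, hVd⟩ := h.exists_lift_vel
  obtain ⟨A, hA, hAc⟩ := exists_lift_modalAccel hm hs hU hUc
  have hV₂d : ∀ t ∈ I, IsLift (s - 2) (lowerOp 2 (V t)) (d t) := fun t ht =>
    (hVd t ht).lowerOp (by norm_num)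
  refine ⟨U, V, A, ⟨hU, hV, hA⟩, fun t ht => ⟨hUc t ht, hVd t ht, hAc t ht⟩,
    fun t ht => ⟨?_, ?_, ?_⟩⟩
  · exact hasDerivAt_of_isLift hI hIc (fun t ht => (hUc t ht).lowerOp (by norm_num)) hVd hV
      h.hasDerivAt_pos ht
  · exact hasDerivAt_of_isLift (V := fun t => lowerOp 2 (V t)) hI hIc
      (fun t ht => (hUc t ht).lowerOp (by norm_num; ring)) hV₂d
      ((lowerOp 2).continuous.comp_continuousOn hV) h.hasDerivAt_pos ht
  · exact hasDerivAt_of_isLift hI hIc hV₂d hAc hA h.hasDerivAt_vel ht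

theorem IsModalCurve.isWeakSolution (hm : -1 < m) (hs : 1 / 2 < s) (hI : IsTimeInterval I)
    (hu₀ : MemHstar (s + 2) u₀) (hv₀ : MemHstar s v₀) (h : IsModalCurve m s I c d)
    (hc₀ : c 0 = sineCoeff u₀) (hd₀ : d 0 = sineCoeff v₀) :
    IsWeakSolution m s I u₀ v₀ fun t => sineSeries (c t) := by
  obtain ⟨hIo, hIc, hI₀⟩ := hI
  obtain ⟨U, V, A, ⟨hU, hV, hA⟩, hlift, hderiv⟩ := h.exists_lifts hm (by linarith) hIo hIc
  have hs₂ : 1 / 2 < s + 2 := by linarith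
  have hcoeff : ∀ t ∈ I, sineCoeff (sineSeries (c t)) = c t := fun t ht =>
    sineCoeff_sineSeries_of_isLift hs₂ (hlift t ht).1
  have hmem : ∀ t ∈ I, MemHstar (s + 2) (sineSeries (c t)) := fun t ht =>
    memHstar_sineSeries hs₂ (hlift t ht).1
  have hU₁ : ∀ t ∈ I, IsLift s (lowerOp 2 (U t)) (c t) := fun t ht =>
    (hlift t ht).1.lowerOp (by norm_num)
  have hU₂ : ∀ t ∈ I, IsLift (s - 2) (lowerOp 4 (U t)) (sineCoeff (sineSeries (c t))) :=
    fun t ht => by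
      rw [hcoeff t ht]
      exact (hlift t ht).1.lowerOp (by norm_num; ring)
  refine
    { mem := hmem
      continuous := ⟨U, contDiffOn_zero.2 hU, fun t ht => by
        rw [hcoeff t ht]
        exact (hlift t ht).1⟩
      contDiff_one := ⟨_, contDiffOn_succ_of_hasDerivAt hIo (fun t ht => (hderiv t ht).1)
        (contDiffOn_zero.2 hV), fun t ht => by
        rw [hcoeff t ht]
        exact hU₁ t ht⟩
      contDiff_two := ⟨_, contDiffOn_succ_of_hasDerivAt hIo (fun t ht => (hderiv t ht).2.1)
        (contDiffOn_succ_of_hasDerivAt hIo (fun t ht => (hderiv t ht).2.2)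
          (contDiffOn_zero.2 hA)), hU₂⟩
      init_pos := fun x hx => by rw [hc₀, hu₀.eq_sineSeries hx]
      init_vel := fun x hx => ?_
      weak_eq := fun t ht η hη => ?_ }
  · rw [hv₀.eq_sineSeries hx, ← hd₀]
    exact hasDerivAt_sineSeries_of_isLift hs (eventually_of_mem (hIo.mem_nhds hI₀) hU₁)
      (hlift 0 hI₀).2.1 (hderiv 0 hI₀).1 x
  · refine weak_eq_of_isLift_modalAccel hm hs hIo (fun t ht => (hmem t ht).isSineRegular hs) hU₂
      (fun t ht => (hderiv t ht).2.1) (fun t ht => (hderiv t ht).2.2) ht ?_ hη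
    rw [hcoeff t ht]
    exact (hlift t ht).2.2

end ModalToWeak

/-! ### The stability constants -/

section Constants

theorem inv_exp_bounds : 0 < 1 / (80 * Real.exp 1) ∧ 1 / (80 * Real.exp 1) ≤ 0.0046 := by
  have := Real.exp_one_gt_d9
  refine ⟨by positivity, ?_⟩
  rw [div_le_iff₀ (by positivity)]
  linarith

theorem cStar_bounds : 1.7 ≤ cStar ∧ cStar ≤ 1.762 := by
  obtain ⟨hpos, hle⟩ := inv_exp_bounds
  set a := 5 / 6 - 1 / (80 * Real.exp 1) with ha
  have ha_lower : 0.8287 ≤ a := by rw [ha]; linarith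
  have : a ≤ 0.8334 := by rw [ha]; linarith
  have ha_sq : 0 < a ^ 2 := by positivity
  rw [cStar, ← ha, ← div_eq_mul_inv]
  constructor
  · rw [le_div_iff₀ ha_sq]
    nlinarith
  · rw [div_le_iff₀ ha_sq]
    nlinarith

theorem cDagger_bounds : 37 ≤ cDagger ∧ cDagger ≤ 38.08 := by
  have hexp_lower := Real.exp_one_gt_d9
  have hexp_upper := Real.exp_one_lt_d9
  have hpi_lower := pi_gt_d4
  have hpi_upper := pi_lt_d4
  rw [cDagger, le_div_iff₀ pi_pos, div_le_iff₀ pi_pos]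
  constructor <;> linarith

theorem cDagger_mul_cStar_le : cDagger * cStar ≤ 68 :=
  calc cDagger * cStar ≤ 38.08 * 1.762 :=
        mul_le_mul cDagger_bounds.2 cStar_bounds.2 (by linarith [cStar_bounds.1]) (by norm_num)
    _ ≤ 68 := by norm_num

theorem cDagger_mul_cStar_sq_bounds :
    94.8 ≤ cDagger * cStar ^ 2 ∧ cDagger * cStar ^ 2 ≤ 118.5 := by
  obtain ⟨hStar_lower, hStar_upper⟩ := cStar_bounds
  obtain ⟨hDagger_lower, hDagger_upper⟩ := cDagger_bounds
  have hsq_lower := pow_le_pow_left₀ (by norm_num) hStar_lower 2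
  have hsq_upper := pow_le_pow_left₀ (by linarith) hStar_upper 2
  constructor <;> nlinarith

variable {m ε : ℝ}

theorem T0_le (hm : -1 < m) : T0 m ε ≤ 0.01 := by
  have hdenom := cDagger_mul_cStar_sq_bounds.1
  have hcorrection : 0 ≤ cDagger * cStar * ε ^ 2 / mu m := by
    have := mu_pos hm
    have := cStar_bounds.1
    have := cDagger_bounds.1
    positivity
  rw [T0, div_le_iff₀ (by linarith)]
  linarith

theorem le_T0 (hm : -1 < m) (hε : 0 ≤ ε) (hεμ : ε ≤ 0.08 * √(mu m)) :
    0.008 * (1 - 68 * ε ^ 2 / mu m) ≤ T0 m ε := by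
  have hsmall := sq_div_le_of_le_mul_sqrt (mu_pos hm) hε hεμ
  have hnonneg : 0 ≤ ε ^ 2 / mu m := div_nonneg (sq_nonneg _) (mu_pos hm).le
  obtain ⟨hdenom_lower, hdenom_upper⟩ := cDagger_mul_cStar_sq_bounds
  have hnum := cDagger_mul_cStar_le
  rw [T0, mul_div_assoc, mul_div_assoc (cDagger * cStar), le_div_iff₀ (by linarith)]
  nlinarith

theorem le_T0_lower_bound (hm : -1 < m) (hε : 0 ≤ ε) (hεμ : ε ≤ 0.08 * √(mu m)) :
    0.0045 ≤ 0.008 * (1 - 68 * ε ^ 2 / mu m) := by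
  have hsmall := sq_div_le_of_le_mul_sqrt (mu_pos hm) hε hεμ
  rw [mul_div_assoc]
  linarith

end Constants

/-! ### Pointwise bounds from the energy -/

section SupBound

theorem sq_le_tsum_mul_tsum_of_hasSum {ι : Type*} {f g : ι → ℝ} {y : ℝ}
    (h : HasSum (fun i => f i * g i) y) (hf : Summable fun i => f i ^ 2)
    (hg : Summable fun i => g i ^ 2) : y ^ 2 ≤ (∑' i, f i ^ 2) * ∑' i, g i ^ 2 := by
  refine le_of_tendsto (h.pow 2) (Eventually.of_forall fun t => ?_)
  calc (∑ i ∈ t, f i * g i) ^ 2 ≤ (∑ i ∈ t, f i ^ 2) * ∑ i ∈ t, g i ^ 2 :=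
        Finset.sum_mul_sq_le_sq_mul_sq t f g
    _ ≤ _ := mul_le_mul (hf.sum_le_tsum t fun i _ => sq_nonneg _)
        (hg.sum_le_tsum t fun i _ => sq_nonneg _) (Finset.sum_nonneg fun i _ => sq_nonneg _)
        (tsum_nonneg fun i => sq_nonneg _)

theorem hasSum_pnat_zeta_two : HasSum (fun j : ℕ+ => 1 / (j : ℝ) ^ 2) (π ^ 2 / 6) :=
  (PNat.coe_injective.hasSum_iff fun n hn => by
    have : n = 0 := by
      by_contra h0
      exact hn ⟨⟨n, Nat.pos_of_ne_zero h0⟩, rfl⟩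
    simp [this]).2 hasSum_zeta_two

theorem phi_div_sq_le (j : ℕ+) (x : ℝ) : (phi j x / j) ^ 2 ≤ 2 / π * (1 / (j : ℝ) ^ 2) := by
  rw [div_pow, div_eq_mul_one_div]
  gcongr
  rw [← sq_abs, ← Real.sq_sqrt (by positivity : 0 ≤ 2 / π)]
  exact pow_le_pow_left₀ (abs_nonneg _) (abs_phi_le_sqrt j x) 2

theorem sq_le_of_hasSum_phi {c : ℕ+ → ℝ} {x y : ℝ} (h : HasSum (fun j => c j * phi j x) y)
    (hc : Summable fun j : ℕ+ => (j : ℝ) ^ 2 * c j ^ 2) :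
    y ^ 2 ≤ π / 3 * ∑' j : ℕ+, (j : ℝ) ^ 2 * c j ^ 2 := by
  have hmajorant := hasSum_pnat_zeta_two.mul_left (2 / π)
  have hphi : Summable fun j : ℕ+ => (phi j x / j) ^ 2 :=
    Summable.of_nonneg_of_le (fun j => sq_nonneg _) (phi_div_sq_le · x) hmajorant.summable
  have hphi_le : ∑' j : ℕ+, (phi j x / j) ^ 2 ≤ π / 3 :=
    calc _ ≤ 2 / π * (π ^ 2 / 6) := hasSum_le (phi_div_sq_le · x) hphi.hasSum hmajorant
      _ = π / 3 := by field_simp; norm_num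
  simp_rw [← mul_pow] at hc ⊢
  have hcs : y ^ 2 ≤ (∑' j : ℕ+, ((j : ℝ) * c j) ^ 2) * ∑' j : ℕ+, (phi j x / j) ^ 2 :=
    sq_le_tsum_mul_tsum_of_hasSum (h.congr_fun fun j => by
      have := pnat_cast_pos j
      field_simp) hc hphi
  calc y ^ 2 ≤ _ := hcs
    _ ≤ (∑' j : ℕ+, ((j : ℝ) * c j) ^ 2) * (π / 3) :=
        mul_le_mul_of_nonneg_left hphi_le (tsum_nonneg fun j => sq_nonneg _)
    _ = _ := mul_comm _ _

end SupBound

/-! ### Initial data and stability -/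

section Data

open scoped lp

variable {m r s : ℝ} {u₀ v₀ : ℝ → ℝ}

theorem hNorm_nonneg (r : ℝ) (f : ℝ → ℝ) : 0 ≤ hNorm r f := Real.sqrt_nonneg _

theorem hTildeNegOneNorm_nonneg (m : ℝ) (f : ℝ → ℝ) : 0 ≤ hTildeNegOneNorm m f :=
  Real.sqrt_nonneg _

theorem MemHstar.exists_isLift {f : ℝ → ℝ} (hf : MemHstar r f) : ∃ U, IsLift r U (sineCoeff f) :=
  ⟨lpTwoOfSummable (fun j => (j : ℝ) ^ r * sineCoeff f j) <| hf.1.congr fun j => by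
    rw [Real.norm_eq_abs, sq_abs, mul_pow, pnat_rpow_sq], fun _ => rfl⟩

/-- The state `z` encodes the initial data `(u₀, v₀)`: its amplitudes are the sine coefficients of
`u₀` and those of `v₀`, the latter measured in units of the frequencies. -/
structure IsStateOfData (m s : ℝ) (u₀ v₀ : ℝ → ℝ) (z : ℓ²(ℕ+, ℂ)) : Prop where
  position : modePosition (s + 2) z = sineCoeff u₀
  momentum : modeMomentum (s + 2) z = fun j => sineCoeff v₀ j / omegaFreq m j

theorem exists_isStateOfData (hm : -1 / 2 ≤ m) (hu₀ : MemHstar (s + 2) u₀) (hv₀ : MemHstar s v₀) :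
    ∃ z, IsStateOfData m s u₀ v₀ z := by
  obtain ⟨U, hU⟩ := hu₀.exists_isLift
  obtain ⟨V, hV⟩ := hv₀.exists_isLift
  exact ⟨stateOf hm U V, modePosition_stateOf hm V hU, modeMomentum_stateOf hm U hV⟩

theorem IsStateOfData.unique {z w : ℓ²(ℕ+, ℂ)} (hz : IsStateOfData m s u₀ v₀ z)
    (hw : IsStateOfData m s u₀ v₀ w) : z = w :=
  state_ext (hz.position.trans hw.position.symm) (hz.momentum.trans hw.momentum.symm)

theorem summable_sq_mul_amplitude (hr : 1 ≤ r) (z : ℓ²(ℕ+, ℂ)) :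
    Summable fun j : ℕ+ => (j : ℝ) ^ 2 * (modePosition r z j ^ 2 + modeMomentum r z j ^ 2) :=
  Summable.of_nonneg_of_le (fun j => by positivity)
    (fun j => mul_le_mul_of_nonneg_right (sq_le_weightN hr 0 j) (by positivity))
    (summable_weightedEnergy hr 0 z)

theorem tendsto_weightedEnergy (hr : 1 ≤ r) (z : ℓ²(ℕ+, ℂ)) :
    Tendsto (fun N => weightedEnergy r N z) atTop
      (𝓝 (∑' j : ℕ+, (j : ℝ) ^ 2 * (modePosition r z j ^ 2 + modeMomentum r z j ^ 2))) := by
  refine tendsto_tsum_of_dominated_convergence (summable_weightedEnergy hr 0 z) (fun j => ?_)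
    (Eventually.of_forall fun N j => ?_)
  · refine tendsto_const_nhds.congr' ?_
    filter_upwards [eventually_ge_atTop (j : ℕ)] with N hN
    rw [weightN, if_pos hN]
  · have := weightN_pos r N j
    rw [Real.norm_of_nonneg (by positivity)]
    refine mul_le_mul_of_nonneg_right ((weightN_le_rpow hr N j).trans_eq ?_) (by positivity)
    rw [weightN, if_neg (Nat.not_le.2 j.pos)]

theorem IsStateOfData.tsum_eq (hs : -1 ≤ s) {z : ℓ²(ℕ+, ℂ)} (hz : IsStateOfData m s u₀ v₀ z) :
    ∑' j : ℕ+, (j : ℝ) ^ 2 * (modePosition (s + 2) z j ^ 2 + modeMomentum (s + 2) z j ^ 2)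
      = hNorm 1 u₀ ^ 2 + hTildeNegOneNorm m v₀ ^ 2 := by
  have hsum := summable_sq_mul_amplitude (by linarith : 1 ≤ s + 2) z
  simp_rw [mul_add] at hsum ⊢
  rw [Summable.tsum_add
    (hsum.of_nonneg_of_le (fun j => by positivity) fun j => le_add_of_nonneg_right (by positivity))
    (hsum.of_nonneg_of_le (fun j => by positivity) fun j => le_add_of_nonneg_left (by positivity)),
    hz.position, hz.momentum, hNorm, hTildeNegOneNorm,
    Real.sq_sqrt (tsum_nonneg fun j => by positivity),
    Real.sq_sqrt (tsum_nonneg fun j => by positivity)]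
  simp only [mul_one, Real.rpow_two]
  exact congrArg _ (tsum_congr fun j => by ring)

theorem IsStateOfData.exists_weightedEnergy_le (hs : -1 ≤ s) {z : ℓ²(ℕ+, ℂ)}
    (hz : IsStateOfData m s u₀ v₀ z) {ε : ℝ} (hε : 0 < ε) (hu₀ε : hNorm 1 u₀ ≤ ε)
    (hv₀ε : hTildeNegOneNorm m v₀ ≤ ε) : ∃ N, 1 ≤ N ∧ weightedEnergy (s + 2) N z ≤ 2.1 * ε ^ 2 := by
  have hlim := tendsto_weightedEnergy (by linarith : 1 ≤ s + 2) z
  have hlt : hNorm 1 u₀ ^ 2 + hTildeNegOneNorm m v₀ ^ 2 < 2.1 * ε ^ 2 := by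
    linarith [pow_le_pow_left₀ (hNorm_nonneg 1 u₀) hu₀ε 2,
      pow_le_pow_left₀ (hTildeNegOneNorm_nonneg m v₀) hv₀ε 2, pow_pos hε 2]
  rw [hz.tsum_eq hs] at hlim
  obtain ⟨N, hN, hN₁⟩ := ((hlim.eventually_lt_const hlt).and (eventually_ge_atTop 1)).exists
  exact ⟨N, hN₁, hN.le⟩

theorem IsStateOfData.eq_zero (hs : -1 ≤ s) {z : ℓ²(ℕ+, ℂ)} (hz : IsStateOfData m s u₀ v₀ z)
    (hu₀ : hNorm 1 u₀ = 0) (hv₀ : hTildeNegOneNorm m v₀ = 0) : z = 0 := by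
  have hsum := (summable_sq_mul_amplitude (by linarith : 1 ≤ s + 2) z).hasSum
  rw [hz.tsum_eq hs, hu₀, hv₀, zero_pow two_ne_zero, add_zero,
    hasSum_zero_iff_of_nonneg fun j => by positivity] at hsum
  have hamplitude : ∀ j, modePosition (s + 2) z j = 0 ∧ modeMomentum (s + 2) z j = 0 := fun j => by
    have hterm := congrFun hsum j
    have := pnat_cast_pos j
    simp only [Pi.zero_apply, mul_eq_zero, pow_eq_zero_iff two_ne_zero, this.ne', false_or] at hterm
    rwa [add_eq_zero_iff_of_nonneg (sq_nonneg _) (sq_nonneg _), sq_eq_zero_iff, sq_eq_zero_iff]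
      at hterm
  refine state_ext (r := s + 2) (funext fun j => ?_) (funext fun j => ?_)
  · rw [(hamplitude j).1]
    simp [modePosition]
  · rw [(hamplitude j).2]
    simp [modeMomentum]

theorem sq_div_omegaFreq_sq_le (hm : -1 < m) (j : ℕ+) :
    (j : ℝ) ^ 2 / omegaFreq m j ^ 2 ≤ 1 / (1 + m) := by
  have hj : (1 : ℝ) ≤ (j : ℝ) ^ 2 := one_le_pow₀ (one_le_pnat_cast j)
  rw [div_le_div_iff₀ (pow_pos (omegaFreq_pos hm j) 2) (by linarith), omegaFreq_sq hm]
  nlinarith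

theorem hTildeNegOneNorm_le (hm : -1 < m) (hs : 0 ≤ s) (hv₀ : MemHstar s v₀) :
    hTildeNegOneNorm m v₀ ≤ hNorm 0 v₀ / √(1 + m) := by
  have hsum : Summable fun j : ℕ+ => (j : ℝ) ^ (2 * (0 : ℝ)) * sineCoeff v₀ j ^ 2 :=
    Summable.of_nonneg_of_le (fun j => by positivity) (fun j => by
      gcongr
      exact one_le_pnat_cast j) hv₀.1
  have hle : ∀ j : ℕ+, (j : ℝ) ^ 2 / omegaFreq m j ^ 2 * sineCoeff v₀ j ^ 2
      ≤ (j : ℝ) ^ (2 * (0 : ℝ)) * sineCoeff v₀ j ^ 2 / (1 + m) := fun j => by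
    rw [mul_zero, Real.rpow_zero, one_mul, div_eq_mul_one_div (_ ^ 2) (1 + m), mul_comm]
    exact mul_le_mul_of_nonneg_left (sq_div_omegaFreq_sq_le hm j) (sq_nonneg _)
  rw [hTildeNegOneNorm, hNorm, ← Real.sqrt_div' _ (by linarith), ← tsum_div_const]
  exact Real.sqrt_le_sqrt (Summable.tsum_le_tsum hle
    ((hsum.div_const _).of_nonneg_of_le (fun j => by positivity) hle) (hsum.div_const _))

end Data

section WeightedNorm

open scoped lp

variable {r : ℝ} {f : ℝ → ℝ}

theorem hNormN_sq (r : ℝ) (N : ℕ) (f : ℝ → ℝ) :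
    hNormN r N f ^ 2 = ∑' j, weightN r N j * sineCoeff f j ^ 2 :=
  Real.sq_sqrt (tsum_nonneg fun j => mul_nonneg (weightN_pos r N j).le (sq_nonneg _))

theorem MemHstar.summable_weightN_mul_sq (hr : 1 ≤ r) (hf : MemHstar r f) (N : ℕ) :
    Summable fun j => weightN r N j * sineCoeff f j ^ 2 :=
  Summable.of_nonneg_of_le (fun j => mul_nonneg (weightN_pos r N j).le (sq_nonneg _))
    (fun j => mul_le_mul_of_nonneg_right (weightN_le_rpow hr N j) (sq_nonneg _)) hf.1

theorem MemHstar.sq_le_hNormN_sq (hr : 1 ≤ r) (hf : MemHstar r f) (N : ℕ) {x : ℝ}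
    (hx : x ∈ Icc 0 π) : f x ^ 2 ≤ π / 3 * hNormN r N f ^ 2 := by
  have hle : ∀ j : ℕ+, (j : ℝ) ^ 2 * sineCoeff f j ^ 2 ≤ weightN r N j * sineCoeff f j ^ 2 :=
    fun j => mul_le_mul_of_nonneg_right (sq_le_weightN hr N j) (sq_nonneg _)
  have hsumN := hf.summable_weightN_mul_sq hr N
  have hsum : Summable fun j : ℕ+ => (j : ℝ) ^ 2 * sineCoeff f j ^ 2 :=
    hsumN.of_nonneg_of_le (fun j => by positivity) hle
  rw [hNormN_sq]
  exact (sq_le_of_hasSum_phi (hf.2 x hx) hsum).trans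
    (mul_le_mul_of_nonneg_left (hsum.tsum_le_tsum hle hsumN) (by positivity))

theorem hNormN_sq_le_weightedEnergy (hr : 1 ≤ r) (N : ℕ) {z : ℓ²(ℕ+, ℂ)} (hf : MemHstar r f)
    (hz : modePosition r z = sineCoeff f) : hNormN r N f ^ 2 ≤ weightedEnergy r N z := by
  rw [hNormN_sq, weightedEnergy, hz]
  refine (hf.summable_weightN_mul_sq hr N).tsum_le_tsum (fun j => ?_)
    (hz ▸ summable_weightedEnergy hr N z)
  exact mul_le_mul_of_nonneg_left (le_add_of_nonneg_right (sq_nonneg _)) (weightN_pos r N j).le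

end WeightedNorm

section Stability

open scoped lp

variable {m s ε : ℝ} {I : Set ℝ} {u₀ v₀ : ℝ → ℝ} {z₀ : ℓ²(ℕ+, ℂ)} {z : ℝ → ℓ²(ℕ+, ℂ)}
  {u w : ℝ → ℝ → ℝ}

theorem IsWeakSolution.exists_isModalSolution (hm : -1 / 2 ≤ m) (hs : 1 / 2 < s)
    (hI : IsTimeInterval I) (h : IsWeakSolution m s I u₀ v₀ u) :
    ∃ z, IsModalSolution m (s + 2) I z ∧ IsStateOfData m s u₀ v₀ (z 0) ∧
      ∀ t ∈ I, modePosition (s + 2) (z t) = sineCoeff (u t) := by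
  obtain ⟨d, hd, hd₀⟩ := h.exists_isModalCurve (by linarith) hs hI
  obtain ⟨z, hz, hzd⟩ := hd.exists_isModalSolution hm hI.1
  obtain ⟨hpos, hmom⟩ := hzd 0 hI.2.2
  exact ⟨z, hz, ⟨hpos.trans (sineCoeff_congr h.init_pos), hd₀ ▸ hmom⟩, fun t ht => (hzd t ht).1⟩

theorem IsModalSolution.isWeakSolution (hm : -1 < m) (hs : 1 / 2 < s) (hI : IsTimeInterval I)
    (hz : IsModalSolution m (s + 2) I z) (hu₀ : MemHstar (s + 2) u₀) (hv₀ : MemHstar s v₀)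
    (hz₀ : IsStateOfData m s u₀ v₀ (z 0)) :
    IsWeakSolution m s I u₀ v₀ fun t => sineSeries (modePosition (s + 2) (z t)) :=
  (hz.isModalCurve hm).isWeakSolution hm hs hI hu₀ hv₀ hz₀.position <| funext fun j => by
    rw [hz₀.momentum, mul_div_cancel₀ _ (omegaFreq_pos hm j).ne']

theorem IsWeakSolution.eq_of_mem (hm : -1 / 2 ≤ m) (hs : 1 / 2 < s) (hI : IsTimeInterval I)
    (hu : IsWeakSolution m s I u₀ v₀ u) (hw : IsWeakSolution m s I u₀ v₀ w) {t x : ℝ} (ht : t ∈ I)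
    (hx : x ∈ Icc 0 π) : u t x = w t x := by
  obtain ⟨y, hy, hy₀, hyu⟩ := hu.exists_isModalSolution hm hs hI
  obtain ⟨z, hz, hz₀, hzw⟩ := hw.exists_isModalSolution hm hs hI
  have hyz : y t = z t := hy.eqOn hm (by linarith) hz hI (hy₀.unique hz₀) ht
  rw [(hu.mem t ht).eq_sineSeries hx, (hw.mem t ht).eq_sineSeries hx, ← hyu t ht, ← hzw t ht, hyz]

theorem isTimeInterval_Ioo {T : ℝ} (hT : 0 < T) : IsTimeInterval (Ioo (-T) T) :=
  ⟨isOpen_Ioo, ordConnected_Ioo, neg_lt_zero.2 hT, hT⟩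

theorem IsStateOfData.exists_isModalSolution (hm : -1 / 2 ≤ m) (hs : -1 / 2 ≤ s)
    (hz₀ : IsStateOfData m s u₀ v₀ z₀) (hu₀ε : hNorm 1 u₀ ≤ ε) (hv₀ε : hTildeNegOneNorm m v₀ ≤ ε)
    (hεμ : ε ≤ 0.08 * √(mu m)) :
    ∃ I z, IsTimeInterval I ∧ {t : ℝ | |t| * ε ^ 4 < 0.02 * mu m} ⊆ I ∧
      IsModalSolution m (s + 2) I z ∧ z 0 = z₀ := by
  have hμ : 0 < mu m := mu_pos (by linarith)
  have hs₁ : -1 ≤ s := by linarith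
  rcases ((hNorm_nonneg 1 u₀).trans hu₀ε : 0 ≤ ε).eq_or_lt' with rfl | hε
  · exact ⟨univ, 0, ⟨isOpen_univ, ordConnected_univ, mem_univ _⟩, subset_univ _,
      isModalSolution_zero m (s + 2) univ,
      (hz₀.eq_zero hs₁ (hu₀ε.antisymm (hNorm_nonneg 1 u₀))
        (hv₀ε.antisymm (hTildeNegOneNorm_nonneg m v₀))).symm⟩
  · obtain ⟨N, hN, hE⟩ := hz₀.exists_weightedEnergy_le hs₁ hε hu₀ε hv₀ε
    set T := 0.02 * mu m / ε ^ 4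
    have hT : 0 < T := by positivity
    have hTε : T * ε ^ 4 = 0.02 * mu m := div_mul_cancel₀ _ (by positivity)
    obtain ⟨z, hz, hz0⟩ :=
      _root_.exists_isModalSolution hm (by linarith) hN hT hε hεμ hTε.le hE
    refine ⟨Ioo (-T) T, z, isTimeInterval_Ioo hT, fun t ht => abs_lt.1 ?_, hz, hz0⟩
    exact lt_of_mul_lt_mul_right (a := ε ^ 4) (hTε ▸ ht) (by positivity)

theorem exists_isWeakSolution_of_small (hm : -1 / 2 ≤ m) (hs : 1 / 2 < s)
    (hu₀ : MemHstar (s + 2) u₀) (hv₀ : MemHstar s v₀) (hu₀ε : hNorm 1 u₀ ≤ ε)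
    (hv₀ε : hTildeNegOneNorm m v₀ ≤ ε) (hεμ : ε ≤ 0.08 * √(mu m)) :
    ∃ (I : Set ℝ) (u : ℝ → ℝ → ℝ), IsTimeInterval I ∧
      {t : ℝ | |t| * ε ^ 4 < 0.02 * mu m} ⊆ I ∧ IsWeakSolution m s I u₀ v₀ u := by
  obtain ⟨z₀, hz₀⟩ := exists_isStateOfData hm hu₀ hv₀
  obtain ⟨I, z, hI, hsub, hz, rfl⟩ :=
    hz₀.exists_isModalSolution hm (by linarith) hu₀ε hv₀ε hεμ
  exact ⟨I, _, hI, hsub, hz.isWeakSolution (by linarith) hs hI hu₀ hv₀ hz₀⟩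

theorem IsStateOfData.exists_weightedEnergy_bound (hm : -1 / 2 ≤ m) (hs : -1 / 2 ≤ s)
    (hz₀ : IsStateOfData m s u₀ v₀ z₀) (hu₀ε : hNorm 1 u₀ ≤ ε) (hv₀ε : hTildeNegOneNorm m v₀ ≤ ε)
    (hεμ : ε ≤ 0.08 * √(mu m)) :
    ∃ N, 1 ≤ N ∧ ∀ I z, IsTimeInterval I → IsModalSolution m (s + 2) I z → z 0 = z₀ →
      ∀ t ∈ I, |t| * ε ^ 4 ≤ 0.02 * mu m → weightedEnergy (s + 2) N (z t) ≤ 3 * ε ^ 2 := by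
  have hs₁ : -1 ≤ s := by linarith
  rcases ((hNorm_nonneg 1 u₀).trans hu₀ε : 0 ≤ ε).eq_or_lt' with rfl | hε
  · refine ⟨1, le_rfl, fun I z hI hz hz0 t ht _ => ?_⟩
    have hzero : z₀ = 0 := hz₀.eq_zero hs₁ (hu₀ε.antisymm (hNorm_nonneg 1 u₀))
      (hv₀ε.antisymm (hTildeNegOneNorm_nonneg m v₀))
    rw [hz.eqOn hm (by linarith) (isModalSolution_zero m (s + 2) I) hI (hz0.trans hzero) ht]
    simp [weightedEnergy, modePosition, modeMomentum]
  · obtain ⟨N, hN, hE⟩ := hz₀.exists_weightedEnergy_le hs₁ hε hu₀ε hv₀ε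
    exact ⟨N, hN, fun I z hI hz hz0 t ht htε => (weightedEnergy_lt hm (by linarith) hI.2.1 hI.2.2
      hz.1 (fun t ht _ => hz.2 t ht) hε hεμ (hz0 ▸ hE) ht htε).le⟩

theorem exists_uniform_bound_of_small (hm : -1 / 2 ≤ m) (hs : 1 / 2 < s)
    (hu₀ : MemHstar (s + 2) u₀) (hv₀ : MemHstar s v₀) (hu₀ε : hNorm 1 u₀ ≤ ε)
    (hv₀ε : hTildeNegOneNorm m v₀ ≤ ε) (hεμ : ε ≤ 0.08 * √(mu m)) :
    ∃ N : ℕ, 1 ≤ N ∧ ∀ (I : Set ℝ) (u : ℝ → ℝ → ℝ), IsTimeInterval I →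
      IsWeakSolution m s I u₀ v₀ u → ∀ t ∈ I, |t| * ε ^ 4 ≤ 0.02 * mu m →
        MemHstar (s + 2) (u t) ∧ hNormN (s + 2) N (u t) ≤ 1.9 * ε ∧
          ∀ x ∈ Icc (0 : ℝ) π, |u t x| ≤ 2 * ε := by
  have hε : 0 ≤ ε := (hNorm_nonneg 1 u₀).trans hu₀ε
  obtain ⟨z₀, hz₀⟩ := exists_isStateOfData hm hu₀ hv₀
  obtain ⟨N, hN, hbound⟩ :=
    hz₀.exists_weightedEnergy_bound hm (by linarith) hu₀ε hv₀ε hεμ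
  refine ⟨N, hN, fun I u hI hu t ht htε => ?_⟩
  obtain ⟨z, hz, hzdata, hzu⟩ := hu.exists_isModalSolution hm hs hI
  have hmem := hu.mem t ht
  have hnorm : hNormN (s + 2) N (u t) ^ 2 ≤ 3 * ε ^ 2 :=
    (hNormN_sq_le_weightedEnergy (by linarith) N hmem (hzu t ht)).trans
      (hbound I z hI hz (hzdata.unique hz₀) t ht htε)
  refine ⟨hmem, le_of_sq_le_sq (hnorm.trans ?_) (by positivity), fun x hx =>
    abs_le_of_sq_le_sq ?_ (by positivity)⟩
  · nlinarith [sq_nonneg ε]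
  · calc u t x ^ 2 ≤ π / 3 * hNormN (s + 2) N (u t) ^ 2 :=
          hmem.sq_le_hNormN_sq (by linarith) N hx
      _ ≤ π / 3 * (3 * ε ^ 2) := by gcongr
      _ = π * ε ^ 2 := by ring
      _ ≤ 4 * ε ^ 2 := by
          gcongr
          exact pi_le_four
      _ = (2 * ε) ^ 2 := by ring

end Stability

end

theorem theorem1 (m s : ℝ) (hm : -1 / 2 ≤ m) (hs : 1 / 2 < s) (u₀ v₀ : ℝ → ℝ)
    (hu₀ : MemHstar (s + 2) u₀) (hv₀ : MemHstar s v₀) :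
    -- uniqueness of the weak solution
    (∀ (I : Set ℝ) (u w : ℝ → ℝ → ℝ), IsTimeInterval I →
      IsWeakSolution m s I u₀ v₀ u → IsWeakSolution m s I u₀ v₀ w →
        ∀ t ∈ I, ∀ x ∈ Icc (0 : ℝ) π, u t x = w t x) ∧
    -- stability for data small in `H¹ × L²`
    (∀ ε : ℝ, ε = max (hNorm 1 u₀) (hNorm 0 v₀ / √(1 + m)) → ε ≤ 0.08 * √(mu m) →
      0.008 * (1 - 68 * ε ^ 2 / mu m) ≤ T0 m ε ∧
      0.0045 ≤ 0.008 * (1 - 68 * ε ^ 2 / mu m) ∧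
      (∃ (I : Set ℝ) (u : ℝ → ℝ → ℝ), IsTimeInterval I ∧
        {t : ℝ | |t| * ε ^ 4 ≤ T0 m ε * mu m} ⊆ I ∧ IsWeakSolution m s I u₀ v₀ u) ∧
      (∀ (I : Set ℝ) (u : ℝ → ℝ → ℝ), IsTimeInterval I → IsWeakSolution m s I u₀ v₀ u →
        ∀ t ∈ I, |t| * ε ^ 4 ≤ T0 m ε * mu m →
          ∀ x ∈ Icc (0 : ℝ) π, |u t x| ≤ 2 * ε)) ∧
    -- sharper form, for data small in `H¹` and in the weighted `H⁻¹`
    (∀ ε : ℝ, ε = max (hNorm 1 u₀) (hTildeNegOneNorm m v₀) → ε ≤ 0.08 * √(mu m) →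
      (∃ (I : Set ℝ) (u : ℝ → ℝ → ℝ), IsTimeInterval I ∧
        {t : ℝ | |t| * ε ^ 4 ≤ T0 m ε * mu m} ⊆ I ∧ IsWeakSolution m s I u₀ v₀ u) ∧
      ∃ N : ℕ, 1 ≤ N ∧
        ∀ (I : Set ℝ) (u : ℝ → ℝ → ℝ), IsTimeInterval I → IsWeakSolution m s I u₀ v₀ u →
          ∀ t ∈ I, |t| * ε ^ 4 ≤ T0 m ε * mu m →
            MemHstar (s + 2) (u t) ∧ hNormN (s + 2) N (u t) ≤ 1.9 * ε ∧
              ∀ x ∈ Icc (0 : ℝ) π, |u t x| ≤ 2 * ε) := by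
  have hm₁ : -1 < m := by linarith
  have hsmall : ∀ {ε t : ℝ}, |t| * ε ^ 4 ≤ T0 m ε * mu m → |t| * ε ^ 4 < 0.02 * mu m :=
    fun ht => ht.trans_lt <|
      mul_lt_mul_of_pos_right ((T0_le hm₁).trans_lt (by norm_num)) (mu_pos hm₁)
  refine ⟨fun I u w hI hu hw t ht x hx => hu.eq_of_mem hm hs hI hw ht hx, fun ε hε hεμ => ?_,
    fun ε hε hεμ => ?_⟩
  · have hu₀ε : hNorm 1 u₀ ≤ ε := hε ▸ le_max_left _ _
    have hv₀ε : hTildeNegOneNorm m v₀ ≤ ε :=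
      (hTildeNegOneNorm_le hm₁ (by linarith) hv₀).trans (hε ▸ le_max_right _ _)
    have hε₀ : 0 ≤ ε := (hNorm_nonneg 1 u₀).trans hu₀ε
    obtain ⟨I, u, hI, hsub, hu⟩ := exists_isWeakSolution_of_small hm hs hu₀ hv₀ hu₀ε hv₀ε hεμ
    obtain ⟨N, -, hN⟩ := exists_uniform_bound_of_small hm hs hu₀ hv₀ hu₀ε hv₀ε hεμ
    exact ⟨le_T0 hm₁ hε₀ hεμ, le_T0_lower_bound hm₁ hε₀ hεμ,
      ⟨I, u, hI, fun t ht => hsub (hsmall ht), hu⟩,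
      fun I u hI hu t ht htε => (hN I u hI hu t ht (hsmall htε).le).2.2⟩
  · have hu₀ε : hNorm 1 u₀ ≤ ε := hε ▸ le_max_left _ _
    have hv₀ε : hTildeNegOneNorm m v₀ ≤ ε := hε ▸ le_max_right _ _
    obtain ⟨I, u, hI, hsub, hu⟩ := exists_isWeakSolution_of_small hm hs hu₀ hv₀ hu₀ε hv₀ε hεμ
    obtain ⟨N, hN₁, hN⟩ := exists_uniform_bound_of_small hm hs hu₀ hv₀ hu₀ε hv₀ε hεμ
    exact ⟨⟨I, u, hI, fun t ht => hsub (hsmall ht), hu⟩, N, hN₁,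
      fun I u hI hu t ht htε => hN I u hI hu t ht (hsmall htε).le⟩
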